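/- Let $V$ be a real vector space of finite dimension $n\ge 2$, and let $0\neq\mu\in\wedge^nV^*$. For a finite-dimensional real vector space $W$ write $\Gamma(W)$ for the $C^\infty(V)$-module of smooth maps $V\to W$. Let $\mathcal F_\mu\subset\mathfrak X(V)=\Gamma(V)$ be the singular foliation of the linear action of $\mathfrak{sl}(V)$, i.e. the $C^\infty(V)$-module generated by the linear vector fields $x\mapsto Ax$ with $\operatorname{tr}A=0$. For $1\le k\le n$ let $\phi_k:\wedge^kV^*\otimes V\to\wedge^{k-1}V^*$, $\phi_k(\alpha\otimes v)=(-1)^{k-1}\iota_v\alpha$, and $K_k=\ker\phi_k$. Let $d_k:\Gamma(\wedge^kV^*\otimes V)\to\Gamma(\wedge^{k-1}V^*\otimes V)$ be the contraction with the Euler vector field $x^i\partial_{x^i}$, let $\partial_n:\Gamma(\wedge^nV^*)\to\Gamma(\wedge^{n-1}V^*)$ be the contraction with $-x^i\partial_{x^i}$, and let $\rho:\Gamma(V^*\otimes V)\to\mathfrak X(V)$, $\rho(\varphi\otimes w)(x)=\varphi(x)w$. Consider $$0\to\Gamma(\wedge^nV^*)\xrightarrow{d_n\phi_n^{-1}\partial_n}\Gamma(K_{n-1})\xrightarrow{d_{n-1}}\cdots\xrightarrow{d_2}\Gamma(K_1)\xrightarrow{\rho}\mathcal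 F_\mu\to0,\qquad(*)$$ with $\Gamma(K_k)$ in degree $-(k-1)$ and $\Gamma(\wedge^nV^*)$ in degree $-(n-1)$. The Nijenhuis–Richardson bracket $\Gamma(\wedge^{k}V^*\otimes V)\times\Gamma(\wedge^{l}V^*\otimes V)\to\Gamma(\wedge^{k+l-1}V^*\otimes V)$ is $$[f_1\varphi_1\otimes w_1,f_2\varphi_2\otimes w_2]=f_1f_2\big(\varphi_1\wedge\iota_{w_1}\varphi_2\otimes w_2-(-1)^{(k-1)(l-1)}\varphi_2\wedge\iota_{w_2}\varphi_1\otimes w_1\big)+\delta_{k,1}f_1\,\rho(\varphi_1\otimes w_1)(f_2)\,\varphi_2\otimes w_2-\delta_{l,1}f_2\,\rho(\varphi_2\otimes w_2)(f_1)\,\varphi_1\otimes w_1 .$$ Then there is exactly one dg-Lie algebroid (an $L_\infty$-algebroid with $\ell_k=0$ for $k\ge3$) over $V$, on the graded bundle with fibres $K_1,\dots,K_{n-1},\wedge^nV^*$ in degrees $0,\dots,-(n-1)$, such that: its unary bracket and anchor are the maps in $(*)$; its binary bracket on $\Gamma(K_k)\times\Gamma(K_l)$, $1\le k,l\le n-1$,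 is the restriction of the Nijenhuis–Richardson bracket (which takes values in $\Gamma(K_{k+l-1})$, where $K_m=0$ for $m\ge n$; in particular, for $k+l-1=n$ the bracket in $\Gamma(\wedge^nV^*)$ is $0$); and $[X,\mu]=0$ for the constant sections $X\in K_1=\mathfrak{sl}(V)$ and $\mu$. Moreover, this dg-Lie algebroid is a universal $L_\infty$-algebroid of $\mathcal F_\mu$, i.e. its unary bracket and anchor form a resolution of $\mathcal F_\mu$ (the sequence $(*)$ is exact), and it is minimal at the origin: all its differentials, as vector bundle maps, vanish at $0\in V$. -/

import Mathlib

open scoped TensorProduct ContDiff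

noncomputable section

namespace LInfSl

/-! ### Smooth functions, sections of trivial bundles, vector fields -/

section Sections

variable (V : Type*) [NormedAddCommGroup V] [NormedSpace ℝ V]

/-- The smooth real functions on `V`, as a subalgebra of all functions. -/
def smoothSubalgebra : Subalgebra ℝ (V → ℝ) where
  carrier := {f | ContDiff ℝ ∞ f}
  mul_mem' := fun {f g} hf hg => by
    have hf : ContDiff ℝ ∞ f := hf
    exact hf.mul hg
  add_mem' := fun {f g} hf hg => by
    have hf : ContDiff ℝ ∞ f := hf
    exact hf.add hg
  algebraMap_mem' c := (contDiff_const : ContDiff ℝ ∞ fun _ : V => c)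

/-- The algebra `C^∞(V)` of smooth real functions on `V`. -/
def SmoothFun : Type _ := smoothSubalgebra V

instance : CommRing (SmoothFun V) := inferInstanceAs (CommRing (smoothSubalgebra V))
instance : Algebra ℝ (SmoothFun V) := inferInstanceAs (Algebra ℝ (smoothSubalgebra V))
instance : CoeFun (SmoothFun V) fun _ => V → ℝ := ⟨Subtype.val⟩

/-- The smooth maps `V → W`, as a `C^∞(V)`-submodule of all maps. Since the finite-dimensional real
vector space `W` carries no chosen norm, a map `V → W` is called smooth if all its components (its
compositions with linear functionals on `W`) are smooth. -/
def secSubmodule (W : Type*) [AddCommGroup W] [Module ℝ W] :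
    Submodule (smoothSubalgebra V) (V → W) where
  carrier := {s | ∀ φ : Module.Dual ℝ W, ContDiff ℝ ∞ fun x => φ (s x)}
  add_mem' := by
    intro s t hs ht φ
    simpa using (hs φ).add (ht φ)
  zero_mem' := by
    intro φ
    simpa using contDiff_const
  smul_mem' := by
    intro f s hs φ
    have h : (fun x => φ ((f • s) x)) = fun x => f.1 x * φ (s x) := by
      funext x
      change φ (f.1 x • s x) = _
      simp
    rw [h]
    exact ContDiff.mul f.2 (hs φ)

/-- `Γ(W)`: the `C^∞(V)`-module of smooth sections of the trivial bundle `W × V → V`, for a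
finite-dimensional real vector space `W`. -/
def Sec (W : Type*) [AddCommGroup W] [Module ℝ W] : Type _ := secSubmodule V W

section SecInstances

variable (W : Type*) [AddCommGroup W] [Module ℝ W]

instance : AddCommGroup (Sec V W) := inferInstanceAs (AddCommGroup (secSubmodule V W))
instance : Module (SmoothFun V) (Sec V W) :=
  inferInstanceAs (Module (smoothSubalgebra V) (secSubmodule V W))
instance : Module ℝ (Sec V W) := Module.compHom _ (algebraMap ℝ (SmoothFun V))
instance : IsScalarTower ℝ (SmoothFun V) (Sec V W) :=
  IsScalarTower.of_algebraMap_smul fun _ _ => rfl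
instance : CoeFun (Sec V W) fun _ => V → W := ⟨Subtype.val⟩

end SecInstances

variable {V}

/-- The constant section with value `w`. -/
def constSec {W : Type*} [AddCommGroup W] [Module ℝ W] (w : W) : Sec V W :=
  ⟨fun _ => w, fun _ => contDiff_const⟩

/-- The derivative at `x`, in the direction `v`, of a section `s` of the trivial bundle with fibre
`W`, computed componentwise in a basis of `W`. -/
def secDeriv {W : Type*} [AddCommGroup W] [Module ℝ W] [FiniteDimensional ℝ W]
    (s : V → W) (x v : V) : W :=
  ∑ i, fderiv ℝ (fun y => (Module.finBasis ℝ W).repr (s y) i) x v • Module.finBasis ℝ W i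

variable [FiniteDimensional ℝ V]

theorem contDiff_of_sec (X : Sec V V) : ContDiff ℝ ∞ X := by
  let b := Module.finBasis ℝ V
  have h : X = fun x => ∑ i, b.coord i (X x) • b i := by
    funext x
    simp [Module.Basis.sum_repr]
  rw [h]
  exact ContDiff.sum fun i _ => ContDiff.smul (X.2 (b.coord i)) contDiff_const

/-- The derivative `X(f)` of a smooth function `f` along a vector field `X`. A vector field on `V`
is a section of the trivial bundle with fibre `V`. -/
def vecApply (X : Sec V V) (f : SmoothFun V) : SmoothFun V :=
  ⟨fun x => fderiv ℝ f x (X x),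
    ContDiff.clm_apply (ContDiff.fderiv_right (m := ∞) (n := ∞) f.2 (by simp)) (contDiff_of_sec X)⟩

end Sections

/-! ### `L_∞`-algebroids over a vector space -/

section LInfty

/-- For arguments of degrees `-d 0, …, -d (n-1)`, the product of the signature and of the Koszul
sign of the unshuffle which moves the arguments with index in `S` (in order) in front of those with
index not in `S` (in order). -/
def unshuffleSign {n : ℕ} (d : Fin n → ℕ) (S : Finset (Fin n)) : ℤ :=
  ∏ p ∈ S, ∏ q ∈ Sᶜ, if q < p then -(-1) ^ (d p * d q) else 1

variable (V : Type*) [NormedAddCommGroup V] [NormedSpace ℝ V]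
  (E : ℕ → Type*) [∀ i, AddCommGroup (E i)] [∀ i, Module ℝ (E i)]

/-- Sections of the graded vector bundle `⨁ E_{-i}`, where `E i` is the fibre in degree `-i`. -/
abbrev TotalSec : Type _ := DirectSum ℕ fun i => Sec V (E i)

/-- The homogeneous sections of degree `-i`. -/
def homog (i : ℕ) : Submodule (SmoothFun V) (TotalSec V E) :=
  LinearMap.range (DirectSum.lof (SmoothFun V) ℕ (fun i => Sec V (E i)) i)

variable {V E} in
/-- A section of `E_{-i}`, seen as a section of the graded bundle. -/
abbrev incl (i : ℕ) (s : Sec V (E i)) : TotalSec V E :=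
  DirectSum.lof (SmoothFun V) ℕ (fun i => Sec V (E i)) i s

/-- An `L_∞`-algebroid over the finite-dimensional vector space `V`, on the non-positively graded
vector bundle with (finite-dimensional) fibre `E i` in degree `-i`. As `V` is contractible, its
vector bundles are trivial, so that only trivial bundles are considered. The bracket `ℓ k` is
`k`-ary and has degree `2 - k`. -/
structure LInftyAlgebroid [FiniteDimensional ℝ V] [∀ i, FiniteDimensional ℝ (E i)] where
  /-- the multibrackets `ℓ k`, `k ≥ 1` (with the convention `ℓ 0 = 0`) -/
  ℓ : ∀ k : ℕ, MultilinearMap ℝ (fun _ : Fin k => TotalSec V E) (TotalSec V E)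
  /-- the anchor, a vector bundle map from `E_0` to `TV` -/
  anchor : Sec V (E 0) →ₗ[SmoothFun V] Sec V V
  ℓ_zero : ℓ 0 = 0
  /-- `ℓ k` has degree `2 - k` -/
  degree : ∀ (k : ℕ) (d : Fin k → ℕ) (x : Fin k → TotalSec V E), (∀ p, x p ∈ homog V E (d p)) →
    ∀ e : ℕ, e + 2 = k + ∑ p, d p → ℓ k x ∈ homog V E e
  /-- there is nothing in positive degrees -/
  degree_pos : ∀ (k : ℕ) (d : Fin k → ℕ) (x : Fin k → TotalSec V E),
    (∀ p, x p ∈ homog V E (d p)) → k + ∑ p, d p < 2 → ℓ k x = 0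
  /-- graded skew-symmetry -/
  skew : ∀ (k : ℕ) (d : Fin k → ℕ) (x : Fin k → TotalSec V E), (∀ p, x p ∈ homog V E (d p)) →
    ∀ p q : Fin k, (p : ℕ) + 1 = q →
      ℓ k (x ∘ Equiv.swap p q) = -((-1 : ℤ) ^ (d p * d q) • ℓ k x)
  /-- The higher Jacobi identities
  `∑_{i+j=n+1} ∑_σ χ(σ) (-1)^{i(j-1)} ℓ_j (ℓ_i (x_{σ 1}, …, x_{σ i}), x_{σ (i+1)}, …, x_{σ n}) = 0`,
  where `σ` runs over the `(i, n-i)`-unshuffles; these correspond to the subsets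
  `S = {σ 1, …, σ i}` with `i` elements. -/
  jacobi : ∀ (n : ℕ) (d : Fin n → ℕ) (x : Fin n → TotalSec V E), (∀ p, x p ∈ homog V E (d p)) →
    ∑ S : Finset (Fin n) with S.Nonempty,
      (unshuffleSign d S * (-1) ^ (S.card * Sᶜ.card)) •
        ℓ (Sᶜ.card + 1) (Fin.cons (ℓ S.card fun p => x (S.orderEmbOfFin rfl p))
          fun q => x (Sᶜ.orderEmbOfFin rfl q)) = 0
  /-- the brackets other than the binary one are `C^∞(V)`-multilinear -/
  smul_linear : ∀ k : ℕ, k ≠ 2 → ∀ (f : SmoothFun V) (x : Fin k → TotalSec V E) (p : Fin k),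
    ℓ k (Function.update x p (f • x p)) = f • ℓ k x
  /-- the Leibniz rule for the binary bracket -/
  leibniz : ∀ (s : Sec V (E 0)) (f : SmoothFun V) (y : TotalSec V E),
    ℓ 2 ![incl 0 s, f • y] = vecApply (anchor s) f • y + f • ℓ 2 ![incl 0 s, y]
  leibniz_neg : ∀ (i : ℕ) (s : Sec V (E (i + 1))) (f : SmoothFun V) (y : TotalSec V E),
    ℓ 2 ![incl (i + 1) s, f • y] = f • ℓ 2 ![incl (i + 1) s, y]
  anchor_diff : ∀ s : Sec V (E 1), anchor (ℓ 1 ![incl 1 s] 0) = 0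
  /-- the anchor intertwines the binary bracket with the Lie bracket of vector fields -/
  anchor_bracket : ∀ s t : Sec V (E 0),
    (anchor (ℓ 2 ![incl 0 s, incl 0 t] 0) : V → V) =
      VectorField.lieBracket ℝ (anchor s : V → V) (anchor t : V → V)

namespace LInftyAlgebroid

variable {V E} [FiniteDimensional ℝ V] [∀ i, FiniteDimensional ℝ (E i)]
  (L : LInftyAlgebroid V E)

/-- A dg-Lie algebroid: only the unary and binary brackets are non-zero. -/
def IsDGLie : Prop := ∀ k : ℕ, 3 ≤ k → L.ℓ k = 0

/-- The component `Γ(E_{-(i+1)}) → Γ(E_{-i})` of the unary bracket. -/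
def diff (i : ℕ) (s : Sec V (E (i + 1))) : Sec V (E i) := L.ℓ 1 ![incl (i + 1) s] i

/-- `L` is a universal `L_∞`-algebroid of the foliation `F` (given by its module of global
sections): its linear part is a resolution of `F`, i.e. the sequence
`⋯ → Γ(E_{-2}) → Γ(E_{-1}) → Γ(E_0) → F → 0` given by the unary bracket and the anchor is exact. -/
structure IsUniversal (F : Submodule (SmoothFun V) (Sec V V)) : Prop where
  range_anchor : LinearMap.range L.anchor = F
  exact_zero : ∀ s : Sec V (E 0), L.anchor s = 0 ↔ ∃ t : Sec V (E 1), L.diff 0 t = s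
  exact_succ : ∀ (i : ℕ) (s : Sec V (E (i + 1))),
    L.diff i s = 0 ↔ ∃ t : Sec V (E (i + 2)), L.diff (i + 1) t = s

/-- `L` is minimal at `p`: all differentials, being vector bundle maps, vanish at `p`. -/
def IsMinimalAt (p : V) : Prop :=
  ∀ (i : ℕ) (s : Sec V (E (i + 1))), L.diff i s p = 0

end LInftyAlgebroid

end LInfty

/-! ### Vector-valued forms, the partial trace and the Nijenhuis–Richardson bracket -/

section Forms

variable (V : Type*) [NormedAddCommGroup V] [NormedSpace ℝ V]

/-- The exterior algebra `∧ V^*`; its homogeneous parts are `⋀[ℝ]^k (Module.Dual ℝ V)`. -/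
abbrev ExtDual : Type _ := ExteriorAlgebra ℝ (Module.Dual ℝ V)

/-- `∧^k V^* ⊗ V`, as a subspace of `∧ V^* ⊗ V`. -/
def VForms (k : ℕ) : Submodule ℝ (ExtDual V ⊗[ℝ] V) :=
  LinearMap.range (LinearMap.rTensor V (⋀[ℝ]^k (Module.Dual ℝ V)).subtype)

variable {V}

/-- The contraction `ι_v : ∧^k V^* → ∧^{k-1} V^*`, inserting `v` in the first slot. -/
def contr : V →ₗ[ℝ] ExtDual V →ₗ[ℝ] ExtDual V :=
  CliffordAlgebra.contractLeft ∘ₗ Module.Dual.eval ℝ V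

/-- The value at the point `x` of the differential `d_k`, the contraction `∧^k V^* ⊗ V →
∧^{k-1} V^* ⊗ V` with the Euler vector field, whose value at `x` is `x`. -/
def eulerContr (x : V) : ExtDual V ⊗[ℝ] V →ₗ[ℝ] ExtDual V ⊗[ℝ] V :=
  LinearMap.rTensor V (contr x)

/-- The value at the point `x` of the anchor `ρ : ∧^1 V^* ⊗ V → V`, `φ ⊗ w ↦ φ(x) w`. -/
def rho (x : V) : ExtDual V ⊗[ℝ] V →ₗ[ℝ] V :=
  TensorProduct.lid ℝ V ∘ₗ
    LinearMap.rTensor V (ExteriorAlgebra.algebraMapInv.toLinearMap ∘ₗ contr x)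

/-- The partial trace `φ_k : ∧^k V^* ⊗ V → ∧^{k-1} V^*`, `α ⊗ v ↦ (-1)^{k-1} ι_v α`, for `k ≥ 1`. -/
def partialTrace (k : ℕ) : ExtDual V ⊗[ℝ] V →ₗ[ℝ] ExtDual V :=
  (-1 : ℝ) ^ (k - 1) • TensorProduct.lift contr.flip

variable (V) in
/-- `K_k ⊆ ∧^k V^* ⊗ V`, the kernel of the partial trace. -/
def KerTrace (k : ℕ) : Submodule ℝ (ExtDual V ⊗[ℝ] V) :=
  VForms V k ⊓ LinearMap.ker (partialTrace k)

/-- The bilinear map `(φ₁ ⊗ w₁, φ₂ ⊗ w₂) ↦ (φ₁ ∧ ι_{w₁} φ₂) ⊗ w₂`. -/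
def insertion : ExtDual V ⊗[ℝ] V →ₗ[ℝ] Module.End ℝ (ExtDual V ⊗[ℝ] V) :=
  TensorProduct.lift
    ((LinearMap.compl₁₂ (LinearMap.mul ℝ (Module.End ℝ (ExtDual V))) (LinearMap.mul ℝ (ExtDual V))
      contr).compr₂ (LinearMap.rTensorHom V))

variable [FiniteDimensional ℝ V]

instance : FiniteDimensional ℝ (ExtDual V) :=
  Module.Finite.of_basis (Module.finBasis ℝ (Module.Dual ℝ V)).ExteriorAlgebra

/-- The Nijenhuis–Richardson bracket
`Γ(∧^k V^* ⊗ V) × Γ(∧^l V^* ⊗ V) → Γ(∧^{k+l-1} V^* ⊗ V)`, `k, l ≥ 1`, evaluated at `x`: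
`[f₁ φ₁ ⊗ w₁, f₂ φ₂ ⊗ w₂]` is the sum of
`f₁ f₂ (φ₁ ∧ ι_{w₁} φ₂ ⊗ w₂ - (-1)^{(k-1)(l-1)} φ₂ ∧ ι_{w₂} φ₁ ⊗ w₁)` and of
`δ_{k,1} f₁ ρ(φ₁ ⊗ w₁)(f₂) φ₂ ⊗ w₂ - δ_{l,1} f₂ ρ(φ₂ ⊗ w₂)(f₁) φ₁ ⊗ w₁`. -/
def nrBracket (k l : ℕ) (P Q : V → ExtDual V ⊗[ℝ] V) (x : V) : ExtDual V ⊗[ℝ] V :=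
  insertion (P x) (Q x) - (-1 : ℝ) ^ ((k - 1) * (l - 1)) • insertion (Q x) (P x)
    + ((if k = 1 then secDeriv Q x (rho x (P x)) else 0)
      - (if l = 1 then secDeriv P x (rho x (Q x)) else 0))

end Forms

/-! ### The foliation and the bundles of its resolution -/

section Resolution

variable (V : Type*) [NormedAddCommGroup V] [NormedSpace ℝ V]

/-- The foliation induced by the linear action of `sl(V)`: the `C^∞(V)`-module generated by the
linear vector fields `x ↦ A x` with `tr A = 0`, i.e. the linear vector fields preserving a constant
volume form. -/
def slFoliation : Submodule (SmoothFun V) (Sec V V) :=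
  Submodule.span (SmoothFun V)
    {X | ∃ A : V →ₗ[ℝ] V, LinearMap.trace ℝ V A = 0 ∧ ∀ x, X x = A x}

/-- The fibre in degree `-i` of the resolution, where `n = dim V`: it is `K_{i+1}` for
`i = 0, …, n-2`, `∧^n V^*` for `i = n-1`, and `0` for `i ≥ n`. All of these are seen as subspaces
of `(∧ V^* ⊗ V) × ∧ V^*`. -/
def slFiber (i : ℕ) : Submodule ℝ ((ExtDual V ⊗[ℝ] V) × ExtDual V) :=
  if i + 1 < Module.finrank ℝ V then (KerTrace V (i + 1)).prod ⊥
  else if i + 1 = Module.finrank ℝ V then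
    (⊥ : Submodule ℝ (ExtDual V ⊗[ℝ] V)).prod (⋀[ℝ]^(Module.finrank ℝ V) (Module.Dual ℝ V))
  else ⊥

/-- The graded vector bundle of the resolution, given by its fibres. -/
abbrev SlBundle (i : ℕ) : Type _ := slFiber V i

variable {V}

/-- The component in `∧ V^* ⊗ V` of a section. -/
def vecPart {i : ℕ} (s : Sec V (SlBundle V i)) (x : V) : ExtDual V ⊗[ℝ] V := (s x).1.1

/-- The component in `∧ V^*` of a section. -/
def topPart {i : ℕ} (s : Sec V (SlBundle V i)) (x : V) : ExtDual V := (s x).1.2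

/-- An element of `∧^n V^*`, as an element of the fibre in degree `-i`, where `i = n - 1`. -/
def topElt {i : ℕ} (hi : i + 1 = Module.finrank ℝ V)
    (μ : ⋀[ℝ]^(Module.finrank ℝ V) (Module.Dual ℝ V)) : SlBundle V i :=
  ⟨(0, (μ : ExtDual V)), by
    rw [slFiber, if_neg (by omega), if_pos hi]
    exact ⟨Submodule.zero_mem _, μ.2⟩⟩

variable [FiniteDimensional ℝ V]

/-- `L` lives on the complex
`0 → Γ(∧^n V^*) → Γ(K_{n-1}) → ⋯ → Γ(K_1) → F → 0`
with differentials `d_n φ_n⁻¹ ∂_n`, `d_{n-1}`, …, `d_2` and anchor `ρ`. -/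
structure HasSlDifferential (L : LInftyAlgebroid V (SlBundle V)) : Prop where
  anchor_eq : ∀ (s : Sec V (SlBundle V 0)) (x : V), L.anchor s x = rho x (vecPart s x)
  /-- `Γ(K_{i+2}) → Γ(K_{i+1})` is `d_{i+2}` -/
  diff_eq : ∀ i : ℕ, i + 2 < Module.finrank ℝ V → ∀ (s : Sec V (SlBundle V (i + 1))) (x : V),
    vecPart (L.diff i s) x = eulerContr x (vecPart s x)
  /-- `Γ(∧^n V^*) → Γ(K_{n-1})` is `d_n φ_n⁻¹ ∂_n`, where `∂_n` is the contraction with the negative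
  of the Euler vector field: `η` is `φ_n⁻¹ (∂_n α)` at the point `x`. -/
  diff_top_eq : ∀ i : ℕ, i + 2 = Module.finrank ℝ V → ∀ (α : Sec V (SlBundle V (i + 1))) (x : V),
    ∃ η ∈ VForms V (Module.finrank ℝ V),
      partialTrace (Module.finrank ℝ V) η = -contr x (topPart α x) ∧
        vecPart (L.diff i α) x = eulerContr x η

/-- On `Γ(K_{i+1}) × Γ(K_{j+1})` the binary bracket of `L` is the restriction of the
Nijenhuis–Richardson bracket (which takes values in `K_{i+j+1}`, where `K_m = 0` for `m ≥ n`);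
if `i + j + 1 = n`, its component in `Γ(∧^n V^*)` is zero. -/
def RestrictsNRBracket (L : LInftyAlgebroid V (SlBundle V)) : Prop :=
  ∀ i j : ℕ, i + 1 < Module.finrank ℝ V → j + 1 < Module.finrank ℝ V →
    ∀ (s : Sec V (SlBundle V i)) (t : Sec V (SlBundle V j)) (x : V),
      vecPart (L.ℓ 2 ![incl i s, incl j t] (i + j)) x
          = nrBracket (i + 1) (j + 1) (vecPart s) (vecPart t) x ∧
        topPart (L.ℓ 2 ![incl i s, incl j t] (i + j)) x = 0

/-- `[X, μ] = 0` for (the constant extensions of) `X ∈ K_1` and `μ ∈ ∧^n V^*`. -/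
def VolumeBracketZero (L : LInftyAlgebroid V (SlBundle V)) (hn : 2 ≤ Module.finrank ℝ V)
    (μ : ⋀[ℝ]^(Module.finrank ℝ V) (Module.Dual ℝ V)) : Prop :=
  ∀ X : SlBundle V 0, L.ℓ 2 ![incl 0 (constSec X),
    incl (Module.finrank ℝ V - 1) (constSec (topElt (Nat.sub_add_cancel (by omega)) μ))] = 0

end Resolution

end LInfSl

end

open LInfSl

/-! The axioms are checked by realising sections as operators. A vector-valued form P acts on
Γ(∧V^*) by an operator D_P (`derivOf`): the algebraic derivation φ ⊗ w ↦ φ ∧ ι_w plus the derivative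
of the coefficients along ρ(P). P is recovered from D_P on constant covectors, and D turns the
Nijenhuis–Richardson bracket into the graded commutator (`derivOf_nrSec`). A top form α acts on
Γ(∧V^*) × ℝ by (ξ, c) ↦ (cα, 0), so that [P, α] is D_P α. Each homogeneous piece thus embeds in an
associative algebra (`opLin_injective`, `opLin_slBr`), and skew-symmetry and the Jacobi identity
follow from those of graded commutators.

Let E be the Euler field. On Γ(K_k) the differential is the graded commutator with ι_E
(`slOpDiff_of_topSec_eq_zero`), hence a derivation of the bracket. On top forms it is α ↦ (-1)^n ι_E
α ⊗ E, because φ_n is injective on ∧^n V^* ⊗ V and sends (-1)^n α ⊗ E to -ι_E α. Compatibility with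
top forms then reduces, for degree reasons, to [P, ι_E α ⊗ E] = ι_E(D_P α) ⊗ E (`nrSec_eulerTop`)
and to [dQ, α] = 0 for Q of degree -1; the latter holds because a traceless P acts on top forms by
the derivative along ρ(P) alone, and ρ ∘ d = 0.

Uniqueness: by degree, the only bracket not prescribed is that of K_1 with ∧^n V^*. It vanishes on
constant sections, as μ spans ∧^n V^*, and the Leibniz rule then forces it to be the derivative
along the anchor (`LInftyAlgebroid.bracket_eq_nabla`).

Exactness: the Koszul complexes of forms and of vector-valued forms are exact in positive form
degree, by a radial homotopy (`exists_bilin_eulerSec_eq`). A primitive η of a section of K has trace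
ι_E β for some β. Below top degree β is itself a trace, and η is corrected by a Koszul boundary to
become traceless; in top degree η = β ⊗ E, which is where ∧^n V^* enters the resolution
(`exists_slD_eq`). -/

noncomputable section

namespace LInfSl

/-! ### Sections of trivial bundles and the flat connection. -/

section SecCalculus

variable {V : Type*} [NormedAddCommGroup V] [NormedSpace ℝ V]
variable {W W' W₁ W₂ W₃ : Type*} [AddCommGroup W] [Module ℝ W] [AddCommGroup W'] [Module ℝ W']
  [AddCommGroup W₁] [Module ℝ W₁] [AddCommGroup W₂] [Module ℝ W₂] [AddCommGroup W₃] [Module ℝ W₃]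

@[ext] theorem SmoothFun.ext {f g : SmoothFun V} (h : ∀ x, f x = g x) : f = g :=
  Subtype.ext (funext h)

@[ext] theorem Sec.ext {s t : Sec V W} (h : ∀ x, s x = t x) : s = t := Subtype.ext (funext h)

@[simp] theorem SmoothFun.mul_apply (f g : SmoothFun V) (x : V) : (f * g) x = f x * g x := rfl

@[simp] theorem Sec.add_apply (s t : Sec V W) (x : V) : (s + t) x = s x + t x := rfl
@[simp] theorem Sec.sub_apply (s t : Sec V W) (x : V) : (s - t) x = s x - t x := rfl
@[simp] theorem Sec.zero_apply (x : V) : (0 : Sec V W) x = 0 := rfl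
@[simp] theorem Sec.smul_apply (f : SmoothFun V) (s : Sec V W) (x : V) :
    (f • s) x = f x • s x := rfl
@[simp] theorem Sec.real_smul_apply (c : ℝ) (s : Sec V W) (x : V) : (c • s) x = c • s x := rfl

@[simp] theorem constSec_apply (w : W) (x : V) : (constSec w : Sec V W) x = w := rfl

/-- Evaluation of sections at a point. -/
def Sec.eval (x : V) : Sec V W →ₗ[ℝ] W where
  toFun s := s x
  map_add' _ _ := rfl
  map_smul' _ _ := rfl

theorem Sec.sum_apply {ι : Type*} (a : Finset ι) (s : ι → Sec V W) (x : V) :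
    (∑ i ∈ a, s i) x = ∑ i ∈ a, s i x := map_sum (Sec.eval x) s a

/-- Composition of sections with a linear map of the fibres. -/
def Sec.map (g : W →ₗ[ℝ] W') : Sec V W →ₗ[SmoothFun V] Sec V W' where
  toFun s := ⟨fun x => g (s x), fun φ => s.2 (φ ∘ₗ g)⟩
  map_add' s t := Sec.ext fun x => map_add g (s x) (t x)
  map_smul' f s := Sec.ext fun x => map_smul g (f x) (s x)

@[simp] theorem Sec.map_apply (g : W →ₗ[ℝ] W') (s : Sec V W) (x : V) :
    Sec.map g s x = g (s x) := rfl

/-- A section with values in a subspace. -/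
def Sec.codRestrict (p : Submodule ℝ W) (s : Sec V W) (h : ∀ x, s x ∈ p) : Sec V p :=
  ⟨fun x => ⟨s x, h x⟩, fun φ => by
    obtain ⟨ψ, hψ⟩ := LinearMap.exists_extend φ
    have : (fun x => φ ⟨s x, h x⟩) = fun x => ψ (s x) := by
      funext x
      rw [← hψ]; rfl
    rw [this]
    exact s.2 ψ⟩

/-- The composition of a section with a linear functional. -/
def Sec.coeff (φ : Module.Dual ℝ W) (s : Sec V W) : SmoothFun V := ⟨fun x => φ (s x), s.2 φ⟩

@[simp] theorem Sec.coeff_apply (φ : Module.Dual ℝ W) (s : Sec V W) (x : V) :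
    Sec.coeff φ s x = φ (s x) := rfl

theorem dual_ext {w w' : W} (h : ∀ φ : Module.Dual ℝ W, φ w = φ w') : w = w' :=
  sub_eq_zero.1 <| (Module.forall_dual_apply_eq_zero_iff ℝ _).1 fun φ => by simp [h φ]

theorem dual_apply_eq_sum {ι : Type*} [Fintype ι] (b : Module.Basis ι ℝ W) (φ : Module.Dual ℝ W)
    (w : W) : φ w = ∑ i, b.coord i w * φ (b i) := by
  conv_lhs => rw [← b.sum_repr w, map_sum]
  simp only [map_smul, smul_eq_mul, Module.Basis.coord_apply]

theorem dual_bilin_apply_eq_sum {ι κ : Type*} [Fintype ι] [Fintype κ] (b₁ : Module.Basis ι ℝ W₁)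
    (b₂ : Module.Basis κ ℝ W₂) (b : W₁ →ₗ[ℝ] W₂ →ₗ[ℝ] W₃) (φ : Module.Dual ℝ W₃) (w₁ : W₁)
    (w₂ : W₂) : φ (b w₁ w₂) =
      ∑ i, ∑ j, (b₁.coord i w₁ * b₂.coord j w₂) * φ (b (b₁ i) (b₂ j)) := by
  refine (dual_apply_eq_sum b₁ (φ ∘ₗ b.flip w₂) w₁).trans (Finset.sum_congr rfl fun i _ => ?_)
  refine (congrArg _ (dual_apply_eq_sum b₂ (φ ∘ₗ b (b₁ i)) w₂)).trans ?_
  rw [Finset.mul_sum]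
  exact Finset.sum_congr rfl fun j _ => (mul_assoc _ _ _).symm

theorem Sec.eq_sum {ι : Type*} [Fintype ι] (b : Module.Basis ι ℝ W) (s : Sec V W) :
    s = ∑ i, Sec.coeff (b.coord i) s • constSec (b i) := by
  ext x
  rw [Sec.sum_apply]
  simp [b.sum_repr]

/-- The section obtained by applying a bilinear map to two sections. -/
def Sec.bilin [FiniteDimensional ℝ W₁] [FiniteDimensional ℝ W₂] (b : W₁ →ₗ[ℝ] W₂ →ₗ[ℝ] W₃) :
    Sec V W₁ →ₗ[SmoothFun V] Sec V W₂ →ₗ[SmoothFun V] Sec V W₃ :=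
  LinearMap.mk₂ (SmoothFun V)
    (fun s t => ⟨fun x => b (s x) (t x), fun φ => by
      let b₁ := Module.finBasis ℝ W₁
      let b₂ := Module.finBasis ℝ W₂
      have h : (fun x => φ (b (s x) (t x))) = fun x =>
          ∑ i, ∑ j, (b₁.coord i (s x) * b₂.coord j (t x)) * φ (b (b₁ i) (b₂ j)) :=
        funext fun x => dual_bilin_apply_eq_sum b₁ b₂ b φ (s x) (t x)
      rw [h]
      exact ContDiff.sum fun i _ => ContDiff.sum fun j _ =>
        ((s.2 _).mul (t.2 _)).mul contDiff_const⟩)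
    (fun s s' t => Sec.ext fun x => by
      change b (s x + s' x) (t x) = _; rw [map_add]; rfl)
    (fun f s t => Sec.ext fun x => by
      change b (f x • s x) (t x) = _; rw [map_smul]; rfl)
    (fun s t t' => Sec.ext fun x => by
      change b (s x) (t x + t' x) = _; rw [map_add]; rfl)
    (fun f s t => Sec.ext fun x => by
      change b (s x) (f x • t x) = _; rw [map_smul]; rfl)

@[simp] theorem Sec.bilin_apply [FiniteDimensional ℝ W₁] [FiniteDimensional ℝ W₂]
    (b : W₁ →ₗ[ℝ] W₂ →ₗ[ℝ] W₃) (s : Sec V W₁) (t : Sec V W₂) (x : V) :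
    Sec.bilin b s t x = b (s x) (t x) := rfl

/-! #### Directional derivatives of sections -/

theorem differentiable_coeff (φ : Module.Dual ℝ W) (s : Sec V W) :
    Differentiable ℝ fun x => φ (s x) := (s.2 φ).differentiable (by simp)

/-- The basis in `secDeriv` is immaterial: functionals commute with differentiation. Through
`dual_ext`, identities for vector-valued derivatives reduce to scalar ones. -/
theorem dual_secDeriv [FiniteDimensional ℝ W] (φ : Module.Dual ℝ W) (s : Sec V W) (x v : V) :
    φ (secDeriv s x v) = fderiv ℝ (fun y => φ (s y)) x v := by
  let b := Module.finBasis ℝ W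
  have h : (fun y => φ (s y)) = fun y => ∑ i, b.coord i (s y) * φ (b i) :=
    funext fun y => dual_apply_eq_sum b φ (s y)
  have hd : ∀ i, DifferentiableAt ℝ (fun y => b.coord i (s y)) x := fun i =>
    differentiable_coeff (b.coord i) s x
  rw [h, fderiv_fun_sum fun i _ => (hd i).mul_const _, secDeriv, map_sum,
    sum_apply]
  refine Finset.sum_congr rfl fun i _ => ?_
  rw [fderiv_mul_const (hd i), map_smul, smul_apply, smul_eq_mul, smul_eq_mul, mul_comm]
  rfl

theorem secDeriv_eq_zero [FiniteDimensional ℝ W] (s : Sec V W) (x : V) :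
    secDeriv s x 0 = 0 := by simp [secDeriv]

theorem secDeriv_add_right [FiniteDimensional ℝ W] (s : V → W) (x v v' : V) :
    secDeriv s x (v + v') = secDeriv s x v + secDeriv s x v' := by
  simp [secDeriv, add_smul, Finset.sum_add_distrib]

theorem secDeriv_smul_right [FiniteDimensional ℝ W] (s : V → W) (x : V) (c : ℝ) (v : V) :
    secDeriv s x (c • v) = c • secDeriv s x v := by
  simp [secDeriv, mul_smul, Finset.smul_sum]

theorem secDeriv_map [FiniteDimensional ℝ W] [FiniteDimensional ℝ W'] (g : W →ₗ[ℝ] W')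
    (s : Sec V W) (x v : V) : secDeriv (Sec.map g s) x v = g (secDeriv s x v) :=
  dual_ext fun φ => by
    rw [dual_secDeriv]
    exact (dual_secDeriv (φ ∘ₗ g) s x v).symm

theorem secDeriv_constSec [FiniteDimensional ℝ W] (w : W) (x v : V) :
    secDeriv (constSec w : Sec V W) x v = 0 :=
  dual_ext fun φ => by
    rw [dual_secDeriv]
    simp

/-- Differentiation commutes with the projection to the quotient by p, where the section becomes
constantly zero. -/
theorem secDeriv_mem [FiniteDimensional ℝ W] (p : Submodule ℝ W) (s : Sec V W)
    (h : ∀ x, s x ∈ p) (x v : V) : secDeriv s x v ∈ p := by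
  rw [← Submodule.Quotient.mk_eq_zero, ← Submodule.mkQ_apply, ← secDeriv_map]
  have : Sec.map p.mkQ s = constSec 0 := Sec.ext fun y => by simp [h y]
  rw [this, secDeriv_constSec]

theorem secDeriv_bilin [FiniteDimensional ℝ W₁] [FiniteDimensional ℝ W₂] [FiniteDimensional ℝ W₃]
    (b : W₁ →ₗ[ℝ] W₂ →ₗ[ℝ] W₃) (s : Sec V W₁) (t : Sec V W₂) (x v : V) :
    secDeriv (Sec.bilin b s t) x v = b (secDeriv s x v) (t x) + b (s x) (secDeriv t x v) := by
  refine dual_ext fun φ => ?_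
  rw [dual_secDeriv]
  let b₁ := Module.finBasis ℝ W₁
  let b₂ := Module.finBasis ℝ W₂
  have e : (fun y => φ (Sec.bilin b s t y)) = _ :=
    funext fun y => dual_bilin_apply_eq_sum b₁ b₂ b φ (s y) (t y)
  rw [e, map_add, dual_bilin_apply_eq_sum b₁ b₂ b φ (secDeriv s x v),
    dual_bilin_apply_eq_sum b₁ b₂ b φ (s x)]
  have d₁ : ∀ i, DifferentiableAt ℝ (fun y => b₁.coord i (s y)) x := fun i =>
    differentiable_coeff (b₁.coord i) s x
  have d₂ : ∀ i, DifferentiableAt ℝ (fun y => b₂.coord i (t y)) x := fun i =>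
    differentiable_coeff (b₂.coord i) t x
  rw [fderiv_fun_sum fun i _ => DifferentiableAt.fun_sum fun j _ =>
    ((d₁ i).fun_mul (d₂ j)).mul_const _, sum_apply, ← Finset.sum_add_distrib]
  refine Finset.sum_congr rfl fun i _ => ?_
  rw [fderiv_fun_sum fun j _ => ((d₁ i).fun_mul (d₂ j)).mul_const _, sum_apply,
    ← Finset.sum_add_distrib]
  refine Finset.sum_congr rfl fun j _ => ?_
  rw [fderiv_mul_const ((d₁ i).fun_mul (d₂ j)), fderiv_fun_mul (d₁ i) (d₂ j),
    dual_secDeriv, dual_secDeriv]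
  simp only [smul_apply, add_apply, smul_eq_mul]
  ring

variable [FiniteDimensional ℝ V]

theorem differentiable_vec (X : Sec V V) : Differentiable ℝ X :=
  (contDiff_of_sec X).differentiable (by simp)

theorem secDeriv_vec (X : Sec V V) (x v : V) : secDeriv X x v = fderiv ℝ X x v := by
  refine dual_ext fun φ => ?_
  rw [dual_secDeriv]
  have h := (LinearMap.toContinuousLinearMap φ).hasFDerivAt.comp x
    (differentiable_vec X x).hasFDerivAt
  exact congrArg (fun L => L v) h.fderiv

/-- The covariant derivative of a section along a vector field, for the trivial connection. -/
def nabla [FiniteDimensional ℝ W] (X : Sec V V) : Sec V W →ₗ[ℝ] Sec V W where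
  toFun s := ⟨fun x => secDeriv s x (X x), fun φ => by
    simp only [dual_secDeriv]
    exact (vecApply X (Sec.coeff φ s)).2⟩
  map_add' s t := Sec.ext fun x => dual_ext fun φ => by
    change φ (secDeriv _ x _) = φ (secDeriv _ x _ + secDeriv _ x _)
    rw [map_add, dual_secDeriv, dual_secDeriv, dual_secDeriv]
    simp only [Sec.add_apply, map_add]
    rw [fderiv_fun_add (differentiable_coeff φ s x) (differentiable_coeff φ t x)]
    rfl
  map_smul' c s := Sec.ext fun x => dual_ext fun φ => by
    change φ (secDeriv _ x _) = φ (c • secDeriv _ x _)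
    rw [map_smul, dual_secDeriv, dual_secDeriv]
    simp only [Sec.real_smul_apply, map_smul, smul_eq_mul]
    rw [fderiv_const_mul (differentiable_coeff φ s x)]
    rfl

theorem nabla_apply [FiniteDimensional ℝ W] (X : Sec V V) (s : Sec V W) (x : V) :
    nabla X s x = secDeriv s x (X x) := rfl

@[simp] theorem nabla_zero_left [FiniteDimensional ℝ W] (s : Sec V W) : nabla 0 s = 0 :=
  Sec.ext fun x => secDeriv_eq_zero s x

theorem nabla_add_left [FiniteDimensional ℝ W] (X Y : Sec V V) (s : Sec V W) :
    nabla (X + Y) s = nabla X s + nabla Y s :=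
  Sec.ext fun x => secDeriv_add_right s x _ _

theorem nabla_smul_left [FiniteDimensional ℝ W] (f : SmoothFun V) (X : Sec V V) (s : Sec V W) :
    nabla (f • X) s = f • nabla X s :=
  Sec.ext fun x => secDeriv_smul_right s x _ _

theorem nabla_bilin [FiniteDimensional ℝ W₁] [FiniteDimensional ℝ W₂] [FiniteDimensional ℝ W₃]
    (b : W₁ →ₗ[ℝ] W₂ →ₗ[ℝ] W₃) (X : Sec V V) (s : Sec V W₁) (t : Sec V W₂) :
    nabla X (Sec.bilin b s t) = Sec.bilin b (nabla X s) t + Sec.bilin b s (nabla X t) :=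
  Sec.ext fun x => secDeriv_bilin b s t x (X x)

theorem nabla_smul [FiniteDimensional ℝ W] (X : Sec V V) (f : SmoothFun V) (s : Sec V W) :
    nabla X (f • s) = vecApply X f • s + f • nabla X s := by
  refine Sec.ext fun x => dual_ext fun φ => ?_
  simp only [nabla_apply, Sec.add_apply, Sec.smul_apply, map_add, map_smul, dual_secDeriv,
    smul_eq_mul]
  have hf : DifferentiableAt ℝ (fun y => f y) x :=
    (show ContDiff ℝ ∞ f from f.2).differentiable (by simp) x
  rw [fderiv_fun_mul hf (differentiable_coeff φ s x)]
  simp only [add_apply, smul_apply, smul_eq_mul]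
  change _ = fderiv ℝ f x (X x) * _ + _
  ring

@[simp] theorem nabla_constSec [FiniteDimensional ℝ W] (X : Sec V V) (w : W) :
    nabla X (constSec w) = 0 := Sec.ext fun x => secDeriv_constSec w x _

theorem nabla_mem [FiniteDimensional ℝ W] (p : Submodule ℝ W) (X : Sec V V) (s : Sec V W)
    (h : ∀ x, s x ∈ p) (x : V) : nabla X s x ∈ p := secDeriv_mem p s h x _

theorem lieBracket_eq_nabla (X Y : Sec V V) (x : V) :
    VectorField.lieBracket ℝ (X : V → V) (Y : V → V) x = (nabla X Y - nabla Y X) x := by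
  rw [VectorField.lieBracket, Sec.sub_apply, nabla_apply, nabla_apply, secDeriv_vec, secDeriv_vec]

/-- Flatness of the trivial connection, i.e. symmetry of second derivatives, applied to each
component. -/
theorem nabla_nabla_sub [FiniteDimensional ℝ W] (X Y : Sec V V) (s : Sec V W) :
    nabla X (nabla Y s) - nabla Y (nabla X s) = nabla (nabla X Y - nabla Y X) s := by
  refine Sec.ext fun x => dual_ext fun φ => ?_
  rw [nabla_apply (nabla X Y - nabla Y X), ← lieBracket_eq_nabla, dual_secDeriv,
    VectorField.fderiv_apply_lieBracket (n := ∞) (s.2 φ).contDiffAt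
      (by simpa using WithTop.coe_le_coe.2 (le_top (a := (2 : ℕ∞))))
      (differentiable_vec Y x) (differentiable_vec X x)]
  simp only [Sec.sub_apply, map_sub]
  rw [nabla_apply, nabla_apply, dual_secDeriv, dual_secDeriv]
  simp only [nabla_apply, dual_secDeriv]

variable (V) in
/-- The Euler vector field. -/
def eulerSec : Sec V V := ⟨fun x => x, fun φ => φ.toContinuousLinearMap.contDiff⟩

@[simp] theorem eulerSec_apply (x : V) : eulerSec V x = x := rfl

@[simp] theorem nabla_eulerSec (X : Sec V V) : nabla X (eulerSec V) = X := by
  refine Sec.ext fun x => ?_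
  rw [nabla_apply, secDeriv_vec]
  change fderiv ℝ (fun y => y) x (X x) = _
  simp

end SecCalculus

end LInfSl

end

/-! ### Exterior algebra: contractions, algebraic derivations, traces. -/

noncomputable section

namespace LInfSl

section ExteriorCalculus

variable {V : Type*} [NormedAddCommGroup V] [NormedSpace ℝ V]

/-- The covector `η`, as an element of `∧ V^*`. -/
abbrev covec (η : Module.Dual ℝ V) : ExtDual V := ExteriorAlgebra.ι ℝ η

theorem contr_covec_mul (v : V) (η : Module.Dual ℝ V) (b : ExtDual V) :
    contr v (covec η * b) = η v • b - covec η * contr v b :=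
  CliffordAlgebra.contractLeft_ι_mul _ _ _

@[simp] theorem contr_algebraMap (v : V) (c : ℝ) : contr v (algebraMap ℝ (ExtDual V) c) = 0 :=
  CliffordAlgebra.contractLeft_algebraMap _ _ _

theorem contr_covec (v : V) (η : Module.Dual ℝ V) :
    contr v (covec η) = algebraMap ℝ (ExtDual V) (η v) :=
  CliffordAlgebra.contractLeft_ι _ _ _

@[simp] theorem contr_contr_self (v : V) (a : ExtDual V) : contr v (contr v a) = 0 :=
  CliffordAlgebra.contractLeft_contractLeft _ _

theorem contr_comm (v w : V) (a : ExtDual V) : contr v (contr w a) = -contr w (contr v a) :=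
  CliffordAlgebra.contractLeft_comm _ _ _

theorem forms_zero : (⋀[ℝ]^0 (Module.Dual ℝ V)) = 1 := pow_zero _

/-- Exterior powers are powers of the space of covectors, so graded identities can be proved by
multiplying by one covector at a time. -/
theorem forms_induction {p : ℕ → ExtDual V → Prop}
    (algebraMap : ∀ c, p 0 (algebraMap ℝ (ExtDual V) c))
    (add : ∀ k a b, p k a → p k b → p k (a + b))
    (mul : ∀ (k : ℕ) (η : Module.Dual ℝ V) (a : ExtDual V), a ∈ ⋀[ℝ]^k (Module.Dual ℝ V) →
      p k a → p (k + 1) (covec η * a)) {k : ℕ} {a : ExtDual V}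
    (ha : a ∈ ⋀[ℝ]^k (Module.Dual ℝ V)) : p k a :=
  Submodule.pow_induction_on_left' _ (C := fun k a _ => p k a) algebraMap
    (fun a b k _ _ => add k a b)
    (fun m hm k a ha h => by obtain ⟨η, rfl⟩ := hm; exact mul k η a ha h) ha

theorem covec_mul_mem {k : ℕ} (η : Module.Dual ℝ V) {a : ExtDual V}
    (ha : a ∈ ⋀[ℝ]^k (Module.Dual ℝ V)) : covec η * a ∈ ⋀[ℝ]^(k + 1) (Module.Dual ℝ V) := by
  rw [ExteriorAlgebra.exteriorPower, pow_succ']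
  exact Submodule.mul_mem_mul ⟨η, rfl⟩ ha

theorem covec_mem (η : Module.Dual ℝ V) : covec η ∈ ⋀[ℝ]^1 (Module.Dual ℝ V) := by
  rw [ExteriorAlgebra.exteriorPower, pow_one]
  exact ⟨η, rfl⟩

theorem forms_mul_mem {k l : ℕ} {a b : ExtDual V} (ha : a ∈ ⋀[ℝ]^k (Module.Dual ℝ V))
    (hb : b ∈ ⋀[ℝ]^l (Module.Dual ℝ V)) : a * b ∈ ⋀[ℝ]^(k + l) (Module.Dual ℝ V) := by
  rw [ExteriorAlgebra.exteriorPower, pow_add]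
  exact Submodule.mul_mem_mul ha hb

theorem contr_eq_zero (v : V) {a : ExtDual V} (ha : a ∈ ⋀[ℝ]^0 (Module.Dual ℝ V)) :
    contr v a = 0 := by
  rw [forms_zero] at ha
  obtain ⟨c, rfl⟩ := Submodule.mem_one.1 ha
  simp

theorem contr_mem_pred (v : V) {k : ℕ} {a : ExtDual V} (ha : a ∈ ⋀[ℝ]^k (Module.Dual ℝ V)) :
    contr v a ∈ ⋀[ℝ]^(k - 1) (Module.Dual ℝ V) := by
  refine forms_induction (p := fun k a => contr v a ∈ ⋀[ℝ]^(k - 1) (Module.Dual ℝ V)) ?_ ?_ ?_ ha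
  · intro c; simp
  · intro k a b ha hb; rw [map_add]; exact add_mem ha hb
  · intro k η a ha h
    rw [contr_covec_mul]
    refine sub_mem (Submodule.smul_mem _ _ ha) ?_
    rcases k with _ | k
    · rw [contr_eq_zero v ha, mul_zero]; exact zero_mem _
    · exact covec_mul_mem η h

theorem contr_mem (v : V) {k : ℕ} {a : ExtDual V} (ha : a ∈ ⋀[ℝ]^(k + 1) (Module.Dual ℝ V)) :
    contr v a ∈ ⋀[ℝ]^k (Module.Dual ℝ V) := contr_mem_pred v ha

theorem contr_mul (v : V) {k : ℕ} {a : ExtDual V} (ha : a ∈ ⋀[ℝ]^k (Module.Dual ℝ V))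
    (b : ExtDual V) : contr v (a * b) = contr v a * b + (-1 : ℝ) ^ k • (a * contr v b) := by
  refine forms_induction (p := fun k a => contr v (a * b) =
    contr v a * b + (-1 : ℝ) ^ k • (a * contr v b)) ?_ ?_ ?_ ha
  · intro c; simp [← Algebra.smul_def]
  · intro k a a' h h'
    rw [add_mul, map_add, h, h', map_add, add_mul, add_mul, smul_add]
    abel
  · intro k η a _ h
    rw [mul_assoc, contr_covec_mul, h, contr_covec_mul, sub_mul, mul_add, pow_succ, smul_mul_assoc,
      mul_smul_comm, mul_assoc, mul_assoc]
    module

theorem covec_mul_comm {k : ℕ} (η : Module.Dual ℝ V) {a : ExtDual V}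
    (ha : a ∈ ⋀[ℝ]^k (Module.Dual ℝ V)) : a * covec η = (-1 : ℝ) ^ k • (covec η * a) := by
  refine forms_induction (p := fun k a => a * covec η = (-1 : ℝ) ^ k • (covec η * a)) ?_ ?_ ?_ ha
  · intro c; simp [Algebra.commutes]
  · intro k a a' h h'
    rw [add_mul, h, h', mul_add, smul_add]
  · intro k ζ a _ h
    have e : covec ζ * covec η = -(covec η * covec ζ) :=
      eq_neg_of_add_eq_zero_left (ExteriorAlgebra.ι_add_mul_swap ζ η)
    rw [mul_assoc, h, mul_smul_comm, ← mul_assoc, e, pow_succ, neg_mul, mul_assoc]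
    module

theorem forms_mul_comm {k l : ℕ} {a b : ExtDual V} (ha : a ∈ ⋀[ℝ]^k (Module.Dual ℝ V))
    (hb : b ∈ ⋀[ℝ]^l (Module.Dual ℝ V)) : a * b = (-1 : ℝ) ^ (k * l) • (b * a) := by
  refine forms_induction (p := fun k a => a * b = (-1 : ℝ) ^ (k * l) • (b * a)) ?_ ?_ ?_ ha
  · intro c; simp [Algebra.commutes]
  · intro k a a' h h'
    rw [add_mul, h, h', mul_add, smul_add]
  · intro k η a _ h
    rw [mul_assoc, h, mul_smul_comm, ← mul_assoc, ← mul_assoc, covec_mul_comm η hb, add_mul,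
      one_mul, smul_mul_assoc, smul_smul, mul_assoc, pow_add, mul_assoc, ← pow_add _ l,
      ← two_mul, pow_mul]
    simp

theorem sum_coord_smul {ι : Type*} [Fintype ι] (b : Module.Basis ι ℝ V) (η : Module.Dual ℝ V) :
    ∑ i, η (b i) • b.coord i = η := by
  ext v
  rw [LinearMap.sum_apply, dual_apply_eq_sum b η v]
  exact Finset.sum_congr rfl fun i _ => mul_comm _ _

/-- The number operator: passing a covector η through ∑ e^i ∧ ι_{e_i} produces the extra term ∑
η(e_i) e^i = η, so the eigenvalue grows by one with each factor. It supplies the factor n - k in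
`trc_cotrc` and the eigenvalue in the Koszul homotopy. -/
theorem sum_covec_mul_contr {ι : Type*} [Fintype ι] (b : Module.Basis ι ℝ V) {k : ℕ}
    {a : ExtDual V} (ha : a ∈ ⋀[ℝ]^k (Module.Dual ℝ V)) :
    ∑ i, covec (b.coord i) * contr (b i) a = (k : ℝ) • a := by
  refine forms_induction (p := fun k a => ∑ i, covec (b.coord i) * contr (b i) a = (k : ℝ) • a)
    ?_ ?_ ?_ ha
  · intro c; simp
  · intro k a a' h h'
    simp only [map_add, mul_add, Finset.sum_add_distrib, h, h', smul_add]
  · intro k η a _ h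
    have e : ∀ i, covec (b.coord i) * contr (b i) (covec η * a) =
        (η (b i) • covec (b.coord i)) * a +
          covec η * (covec (b.coord i) * contr (b i) a) := by
      intro i
      have e' : covec (b.coord i) * covec η = -(covec η * covec (b.coord i)) :=
        eq_neg_of_add_eq_zero_left (ExteriorAlgebra.ι_add_mul_swap _ _)
      rw [contr_covec_mul, mul_sub, ← mul_assoc (covec _) (covec _), e', mul_smul_comm, smul_mul_assoc, neg_mul, sub_neg_eq_add, mul_assoc]
    rw [Finset.sum_congr rfl fun i _ => e i, Finset.sum_add_distrib, ← Finset.sum_mul,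
      ← Finset.mul_sum, h, Finset.sum_congr rfl fun i _ => (map_smul _ (η (b i)) _).symm, ← map_sum,
      sum_coord_smul, mul_smul_comm]
    push_cast
    module

theorem forms_eq_bot [FiniteDimensional ℝ V] {k : ℕ} (hk : Module.finrank ℝ V < k) :
    (⋀[ℝ]^k (Module.Dual ℝ V)) = ⊥ := by
  rw [← Submodule.finrank_eq_zero (R := ℝ), exteriorPower.finrank_eq, Subspace.dual_finrank_eq,
    Nat.choose_eq_zero_of_lt hk]

/-! #### Vector-valued forms -/

theorem tmul_mem_VForms {k : ℕ} {a : ExtDual V} (ha : a ∈ ⋀[ℝ]^k (Module.Dual ℝ V)) (v : V) :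
    a ⊗ₜ[ℝ] v ∈ VForms V k := ⟨⟨a, ha⟩ ⊗ₜ v, rfl⟩

theorem VForms_induction {k : ℕ} {p : ExtDual V ⊗[ℝ] V → Prop} (zero : p 0)
    (add : ∀ P Q, p P → p Q → p (P + Q))
    (tmul : ∀ a ∈ ⋀[ℝ]^k (Module.Dual ℝ V), ∀ v : V, p (a ⊗ₜ v)) {P : ExtDual V ⊗[ℝ] V}
    (hP : P ∈ VForms V k) : p P := by
  obtain ⟨z, rfl⟩ := hP
  induction z using TensorProduct.induction_on with
  | zero => simpa using zero
  | tmul a v => exact tmul a a.2 v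
  | add y z hy hz => rw [map_add]; exact add _ _ hy hz

theorem VForms_induction₂ {k l : ℕ} {p : ExtDual V ⊗[ℝ] V → ExtDual V ⊗[ℝ] V → Prop}
    (zero_left : ∀ Q, p 0 Q) (zero_right : ∀ P, p P 0)
    (add_left : ∀ P P' Q, p P Q → p P' Q → p (P + P') Q)
    (add_right : ∀ P Q Q', p P Q → p P Q' → p P (Q + Q'))
    (tmul : ∀ a ∈ ⋀[ℝ]^k (Module.Dual ℝ V), ∀ v : V, ∀ b ∈ ⋀[ℝ]^l (Module.Dual ℝ V), ∀ w : V,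
      p (a ⊗ₜ v) (b ⊗ₜ w)) {P Q : ExtDual V ⊗[ℝ] V}
    (hP : P ∈ VForms V k) (hQ : Q ∈ VForms V l) : p P Q :=
  VForms_induction (p := fun P => p P Q) (zero_left Q) (fun P P' => add_left P P' Q)
    (fun a ha v => VForms_induction (p := fun Q => p (a ⊗ₜ v) Q) (zero_right _)
      (fun Q Q' => add_right _ Q Q') (fun b hb w => tmul a ha v b hb w) hQ) hP

/-- The algebraic derivation `φ ⊗ w ↦ φ ∧ ι_w` of `∧ V^*`. -/
def act : ExtDual V ⊗[ℝ] V →ₗ[ℝ] Module.End ℝ (ExtDual V) :=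
  TensorProduct.lift (LinearMap.compl₁₂ (LinearMap.mul ℝ (Module.End ℝ (ExtDual V)))
    (LinearMap.mul ℝ (ExtDual V)) contr)

@[simp] theorem act_tmul (a : ExtDual V) (v : V) (ξ : ExtDual V) :
    act (a ⊗ₜ v) ξ = a * contr v ξ := rfl

@[simp] theorem insertion_tmul_left (a : ExtDual V) (v : V) (b : ExtDual V) (w : V) :
    insertion (a ⊗ₜ v) (b ⊗ₜ w) = (a * contr v b) ⊗ₜ w := rfl

@[simp] theorem eulerContr_tmul (x : V) (a : ExtDual V) (v : V) :
    eulerContr x (a ⊗ₜ v) = contr x a ⊗ₜ v := rfl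

@[simp] theorem rho_tmul (x : V) (a : ExtDual V) (v : V) :
    rho x (a ⊗ₜ v) = ExteriorAlgebra.algebraMapInv (contr x a) • v := rfl

/-- The trace `φ ⊗ w ↦ ι_w φ`, without sign. -/
def trc : ExtDual V ⊗[ℝ] V →ₗ[ℝ] ExtDual V := TensorProduct.lift contr.flip

@[simp] theorem trc_tmul (a : ExtDual V) (v : V) : trc (a ⊗ₜ v) = contr v a := rfl

theorem partialTrace_eq (k : ℕ) : partialTrace (V := V) k = (-1 : ℝ) ^ (k - 1) • trc := rfl

theorem mem_KerTrace {k : ℕ} {P : ExtDual V ⊗[ℝ] V} :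
    P ∈ KerTrace V k ↔ P ∈ VForms V k ∧ trc P = 0 := by
  rw [KerTrace, Submodule.mem_inf, LinearMap.mem_ker, partialTrace_eq, LinearMap.smul_apply,
    smul_eq_zero_iff_right (pow_ne_zero _ (by norm_num))]

/-- On a covector η the action of P is the contraction of its V-factor with η, so P = ∑ P(e^i) ⊗ e_i
is determined by its values on covectors. This is the source of faithfulness. -/
theorem act_eq_zero {P : ExtDual V ⊗[ℝ] V} [FiniteDimensional ℝ V]
    (h : ∀ η : Module.Dual ℝ V, act P (covec η) = 0) : P = 0 := by
  have key : ∀ (η : Module.Dual ℝ V) (P : ExtDual V ⊗[ℝ] V), act P (covec η) =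
      TensorProduct.rid ℝ _ (LinearMap.lTensor _ η P) := by
    intro η P
    induction P using TensorProduct.induction_on with
    | zero => simp
    | tmul a v =>
      rw [act_tmul, contr_covec, ← Algebra.commutes, ← Algebra.smul_def]
      simp
    | add P Q hP hQ => simp [hP, hQ]
  let b := Module.finBasis ℝ V
  have expand : ∀ P : ExtDual V ⊗[ℝ] V, P = ∑ i, act P (covec (b.coord i)) ⊗ₜ b i := by
    intro P
    simp_rw [key]
    induction P using TensorProduct.induction_on with
    | zero => simp
    | tmul a v =>
      simp only [LinearMap.lTensor_tmul, TensorProduct.rid_tmul, TensorProduct.smul_tmul,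
        ← TensorProduct.tmul_sum]
      exact congrArg _ (b.sum_repr v).symm
    | add P Q hP hQ =>
      conv_lhs => rw [hP, hQ]
      simp [TensorProduct.add_tmul, Finset.sum_add_distrib]
  rw [expand P]
  simp [h]

theorem act_mem {i k : ℕ} {P : ExtDual V ⊗[ℝ] V} (hP : P ∈ VForms V (i + 1)) {ξ : ExtDual V}
    (hξ : ξ ∈ ⋀[ℝ]^k (Module.Dual ℝ V)) : act P ξ ∈ ⋀[ℝ]^(i + k) (Module.Dual ℝ V) := by
  refine VForms_induction (p := fun P => act P ξ ∈ ⋀[ℝ]^(i + k) (Module.Dual ℝ V))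
    (by simp) (fun P Q h h' => by rw [map_add]; exact add_mem h h') (fun a ha v => ?_) hP
  rcases k with _ | k
  · rw [act_tmul, contr_eq_zero v hξ, mul_zero]; exact zero_mem _
  · rw [show i + (k + 1) = i + 1 + k by omega]
    exact forms_mul_mem ha (contr_mem v hξ)

theorem insertion_mem {i j : ℕ} {P Q : ExtDual V ⊗[ℝ] V} (hP : P ∈ VForms V (i + 1))
    (hQ : Q ∈ VForms V (j + 1)) : insertion P Q ∈ VForms V (i + j + 1) := by
  refine VForms_induction₂ (p := fun P Q => insertion P Q ∈ VForms V (i + j + 1)) ?_ ?_ ?_ ?_ ?_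
    hP hQ
  · intro Q; simp
  · intro P; simp
  · intro P P' Q h h'; rw [map_add]; exact add_mem h h'
  · intro P Q Q' h h'; rw [map_add]; exact add_mem h h'
  · intro a ha v b hb w
    rw [insertion_tmul_left, show i + j + 1 = i + 1 + j by omega]
    exact tmul_mem_VForms (forms_mul_mem ha (contr_mem v hb)) w

/-- Each composite of two algebraic derivations has a first-order part, the insertion, and a
second-order part φ₁ ∧ φ₂ ∧ ι ι; the second-order parts cancel in the graded commutator. -/
theorem act_insertion {i j : ℕ} {P Q : ExtDual V ⊗[ℝ] V} (hP : P ∈ VForms V (i + 1))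
    (hQ : Q ∈ VForms V (j + 1)) (ξ : ExtDual V) :
    act (insertion P Q) ξ - (-1 : ℝ) ^ (i * j) • act (insertion Q P) ξ =
      act P (act Q ξ) - (-1 : ℝ) ^ (i * j) • act Q (act P ξ) := by
  refine VForms_induction₂ (p := fun P Q =>
    act (insertion P Q) ξ - (-1 : ℝ) ^ (i * j) • act (insertion Q P) ξ =
      act P (act Q ξ) - (-1 : ℝ) ^ (i * j) • act Q (act P ξ)) ?_ ?_ ?_ ?_ ?_ hP hQ
  · intro Q; simp
  · intro P; simp
  · intro P P' Q h h'
    simp only [map_add, LinearMap.add_apply, smul_add]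
    rw [add_sub_add_comm, h, h', add_sub_add_comm]
  · intro P Q Q' h h'
    simp only [map_add, LinearMap.add_apply, smul_add]
    rw [add_sub_add_comm, h, h', add_sub_add_comm]
  · intro a ha v b hb w
    simp only [insertion_tmul_left, act_tmul]
    rw [contr_mul v hb, contr_mul w ha, contr_comm w v, mul_add, mul_add, mul_smul_comm,
      mul_smul_comm, mul_neg, mul_neg, ← mul_assoc b a, forms_mul_comm hb ha]
    simp only [smul_mul_assoc, smul_neg, smul_add, smul_smul, mul_assoc]
    -- The exponents come from the graded commutator, from moving a contraction past a form of
    -- degree i + 1, and from exchanging the two forms.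
    have e : (-1 : ℝ) ^ (i * j) * (-1) ^ (i + 1) * (-1) ^ ((j + 1) * (i + 1)) = (-1) ^ (j + 2) := by
      rw [← pow_add, ← pow_add, show i * j + (i + 1) + (j + 1) * (i + 1) =
        2 * (i * j + i) + (j + 2) by ring, pow_add _ (2 * _), pow_mul]
      simp
    rw [mul_assoc] at e
    rw [e, pow_add, pow_add]
    module

/-- Where both contractions hit different factors, the products of the two contracted forms agree up
to the commutation sign and cancel. What remains only involves the traces of P and Q, so the bracket
preserves the kernel of the trace. -/
theorem trc_insertion {i j : ℕ} {P Q : ExtDual V ⊗[ℝ] V} (hP : P ∈ VForms V (i + 1))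
    (hQ : Q ∈ VForms V (j + 1)) :
    trc (insertion P Q) - (-1 : ℝ) ^ (i * j) • trc (insertion Q P) =
      (-1 : ℝ) ^ i • act P (trc Q) - ((-1 : ℝ) ^ (i * j) * (-1 : ℝ) ^ j) • act Q (trc P) := by
  refine VForms_induction₂ (p := fun P Q =>
    trc (insertion P Q) - (-1 : ℝ) ^ (i * j) • trc (insertion Q P) =
      (-1 : ℝ) ^ i • act P (trc Q) - ((-1 : ℝ) ^ (i * j) * (-1 : ℝ) ^ j) • act Q (trc P))
    ?_ ?_ ?_ ?_ ?_ hP hQ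
  · intro Q; simp
  · intro P; simp
  · intro P P' Q h h'
    simp only [map_add, LinearMap.add_apply, smul_add]
    rw [add_sub_add_comm, h, h', add_sub_add_comm]
  · intro P Q Q' h h'
    simp only [map_add, LinearMap.add_apply, smul_add]
    rw [add_sub_add_comm, h, h', add_sub_add_comm]
  · intro a ha v b hb w
    simp only [insertion_tmul_left, act_tmul, trc_tmul]
    rw [contr_mul w ha, contr_mul v hb, contr_comm w v, contr_comm v w a,
      forms_mul_comm (contr_mem v hb) (contr_mem w ha)]
    simp only [smul_add, smul_smul, mul_neg, smul_neg]
    have e : (-1 : ℝ) ^ (i * j) * (-1) ^ (j * i) = 1 := by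
      rw [← pow_add, show i * j + j * i = 2 * (i * j) by ring, pow_mul]
      simp
    rw [e, pow_succ, pow_succ]
    module

theorem eulerContr_mem (x : V) {k : ℕ} {P : ExtDual V ⊗[ℝ] V} (hP : P ∈ VForms V (k + 1)) :
    eulerContr x P ∈ VForms V k :=
  VForms_induction (p := fun P => eulerContr x P ∈ VForms V k) (by simp)
    (fun P Q h h' => by rw [map_add]; exact add_mem h h')
    (fun a ha v => tmul_mem_VForms (contr_mem x ha) v) hP

theorem eulerContr_eulerContr (x : V) (P : ExtDual V ⊗[ℝ] V) :
    eulerContr x (eulerContr x P) = 0 := by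
  induction P using TensorProduct.induction_on with
  | zero => simp
  | tmul a v => simp
  | add P Q hP hQ => simp [hP, hQ]

theorem rho_eulerContr (x : V) (P : ExtDual V ⊗[ℝ] V) : rho x (eulerContr x P) = 0 := by
  induction P using TensorProduct.induction_on with
  | zero => simp
  | tmul a v => simp
  | add P Q hP hQ => simp [hP, hQ]

theorem trc_eulerContr (x : V) (P : ExtDual V ⊗[ℝ] V) :
    trc (eulerContr x P) = -contr x (trc P) := by
  induction P using TensorProduct.induction_on with
  | zero => simp
  | tmul a v => exact contr_comm v x a
  | add P Q hP hQ => simp [hP, hQ]; abel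

/-- Contractions anticommute, so moving ι_x past φ ∧ ι_w leaves only (ι_x φ) ∧ ι_w: commuting with
ι_x contracts P. -/
theorem contr_act (x : V) {i : ℕ} {P : ExtDual V ⊗[ℝ] V} (hP : P ∈ VForms V (i + 1))
    (ξ : ExtDual V) :
    contr x (act P ξ) = act (eulerContr x P) ξ + (-1 : ℝ) ^ i • act P (contr x ξ) := by
  refine VForms_induction (p := fun P => contr x (act P ξ) = act (eulerContr x P) ξ +
    (-1 : ℝ) ^ i • act P (contr x ξ)) (by simp) (fun P Q h h' => ?_) (fun a ha v => ?_) hP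
  · simp only [map_add, LinearMap.add_apply, smul_add, h, h']; abel
  · rw [eulerContr_tmul, act_tmul, act_tmul, act_tmul, contr_mul x ha, contr_comm x v, pow_succ]
    simp

/-- The anchor reads off the scalar part of ι_x φ, which is zero unless φ has degree 1. -/
theorem rho_eq_zero (x : V) {k : ℕ} (hk : k ≠ 1) {P : ExtDual V ⊗[ℝ] V} (hP : P ∈ VForms V k) :
    rho x P = 0 := by
  refine VForms_induction (p := fun P => rho x P = 0) (by simp)
    (fun P Q h h' => by rw [map_add, h, h', add_zero]) (fun a ha v => ?_) hP
  rw [rho_tmul]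
  rcases k with _ | _ | k
  · simp [contr_eq_zero x ha]
  · exact absurd rfl hk
  · have h := contr_mem x ha
    rw [ExteriorAlgebra.exteriorPower, pow_succ'] at h
    suffices h' : ExteriorAlgebra.algebraMapInv (contr x a) = 0 by rw [h', zero_smul]
    refine Submodule.mul_induction_on h ?_ ?_
    · rintro _ ⟨η, rfl⟩ b _
      rw [map_mul]
      simp [ExteriorAlgebra.algebraMapInv]
    · intro y z hy hz; rw [map_add, hy, hz, add_zero]

theorem exists_covec {a : ExtDual V} (ha : a ∈ ⋀[ℝ]^1 (Module.Dual ℝ V)) : ∃ η, covec η = a := by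
  rw [ExteriorAlgebra.exteriorPower, pow_one] at ha
  exact ha

theorem VForms_one_induction {p : ExtDual V ⊗[ℝ] V → Prop} (zero : p 0)
    (add : ∀ P Q, p P → p Q → p (P + Q))
    (tmul : ∀ (η : Module.Dual ℝ V) (v : V), p (covec η ⊗ₜ v)) {P : ExtDual V ⊗[ℝ] V}
    (hP : P ∈ VForms V 1) : p P :=
  VForms_induction zero add (fun a ha v => by obtain ⟨η, rfl⟩ := exists_covec ha; exact tmul η v) hP

@[simp] theorem rho_covec_tmul (x : V) (η : Module.Dual ℝ V) (v : V) :
    rho x (covec η ⊗ₜ[ℝ] v) = η x • v := by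
  rw [rho_tmul, contr_covec, ExteriorAlgebra.algebraMap_leftInverse]

theorem eulerContr_eq_one_tmul (x : V) {P : ExtDual V ⊗[ℝ] V} (hP : P ∈ VForms V 1) :
    eulerContr x P = 1 ⊗ₜ rho x P := by
  refine VForms_one_induction (p := fun P => eulerContr x P = 1 ⊗ₜ rho x P) (by simp)
    (fun P Q h h' => ?_) (fun η v => ?_) hP
  · rw [map_add, h, h', map_add, TensorProduct.tmul_add]
  · rw [eulerContr_tmul, contr_covec, rho_covec_tmul, Algebra.algebraMap_eq_smul_one,
      TensorProduct.smul_tmul]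

theorem act_eulerContr (x : V) {P : ExtDual V ⊗[ℝ] V} (hP : P ∈ VForms V 1) (ξ : ExtDual V) :
    act (eulerContr x P) ξ = contr (rho x P) ξ := by
  rw [eulerContr_eq_one_tmul x hP, act_tmul, one_mul]

/-- In V^* ⊗ V = End V insertion is composition, with P applied first. -/
theorem rho_insertion (x : V) {P Q : ExtDual V ⊗[ℝ] V} (hP : P ∈ VForms V 1)
    (hQ : Q ∈ VForms V 1) : rho x (insertion P Q) = rho (rho x P) Q := by
  have hl : ∀ (x : V) (Q : ExtDual V ⊗[ℝ] V), rho x Q =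
      TensorProduct.lid ℝ V (LinearMap.rTensor V (ExteriorAlgebra.algebraMapInv.toLinearMap)
        (LinearMap.rTensor V (contr x) Q)) := by
    intro x Q
    rw [rho, LinearMap.rTensor_comp]; rfl
  refine VForms_one_induction (p := fun P => rho x (insertion P Q) = rho (rho x P) Q) ?_ ?_ ?_ hP
  · simp [hl]
  · intro P P' h h'
    rw [map_add, LinearMap.add_apply, map_add, h, h', map_add, hl _ Q, hl _ Q, hl (_ + _) Q,
      map_add contr, LinearMap.rTensor_add]
    simp
  · intro η v
    refine VForms_one_induction (p := fun Q => rho x (insertion (covec η ⊗ₜ v) Q) =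
      rho (rho x (covec η ⊗ₜ v)) Q) (by simp) ?_ ?_ hQ
    · intro Q Q' h h'
      rw [map_add, map_add, h, h', map_add]
    · intro ζ w
      rw [insertion_tmul_left, contr_covec, ← Algebra.commutes, ← Algebra.smul_def,
        ← TensorProduct.smul_tmul', map_smul, rho_covec_tmul, rho_covec_tmul, rho_covec_tmul,
        map_smul, smul_smul, smul_eq_mul, mul_comm]

/-- Contracting η ∧ β = 0 with v gives η ∧ ι_v β = η(v) β. In particular traceless P kill top forms.
-/
theorem act_top [FiniteDimensional ℝ V] {P : ExtDual V ⊗[ℝ] V} (hP : P ∈ VForms V 1)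
    {β : ExtDual V} (hβ : β ∈ ⋀[ℝ]^(Module.finrank ℝ V) (Module.Dual ℝ V)) :
    act P β = trc P * β := by
  refine VForms_one_induction (p := fun P => act P β = trc P * β) (by simp)
    (fun P Q h h' => by rw [map_add, map_add, LinearMap.add_apply, h, h', add_mul])
    (fun η v => ?_) hP
  have h : covec η * β = 0 := by
    have := covec_mul_mem η hβ
    rwa [forms_eq_bot (Nat.lt_succ_self _)] at this
  have h' := contr_covec_mul v η β
  rw [h, map_zero] at h'
  rw [act_tmul, trc_tmul, contr_covec, ← Algebra.smul_def]
  exact (sub_eq_zero.1 h'.symm).symm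

theorem act_mul {P : ExtDual V ⊗[ℝ] V} (hP : P ∈ VForms V 1) {k : ℕ} {a : ExtDual V}
    (ha : a ∈ ⋀[ℝ]^k (Module.Dual ℝ V)) (b : ExtDual V) :
    act P (a * b) = act P a * b + a * act P b := by
  refine VForms_one_induction (p := fun P => act P (a * b) = act P a * b + a * act P b) (by simp)
    (fun P Q h h' => ?_) (fun η v => ?_) hP
  · simp only [map_add, LinearMap.add_apply, h, h', add_mul, mul_add]; abel
  · rw [act_tmul, act_tmul, act_tmul, contr_mul v ha, mul_add, mul_smul_comm, ← mul_assoc a,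
      covec_mul_comm η ha, smul_mul_assoc, mul_assoc, mul_assoc]

/-- The map `β ↦ ∑ e^i ∧ β ⊗ e_i`, an inverse of the trace up to factors. -/
def cotrc {ι : Type*} [Fintype ι] (b : Module.Basis ι ℝ V) : ExtDual V →ₗ[ℝ] ExtDual V ⊗[ℝ] V :=
  ∑ i, (TensorProduct.mk ℝ (ExtDual V) V).flip (b i) ∘ₗ LinearMap.mulLeft ℝ (covec (b.coord i))

theorem cotrc_apply {ι : Type*} [Fintype ι] (b : Module.Basis ι ℝ V) (β : ExtDual V) :
    cotrc b β = ∑ i, (covec (b.coord i) * β) ⊗ₜ b i := by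
  simp [cotrc]

theorem cotrc_mem {ι : Type*} [Fintype ι] (b : Module.Basis ι ℝ V) {k : ℕ} {β : ExtDual V}
    (hβ : β ∈ ⋀[ℝ]^k (Module.Dual ℝ V)) : cotrc b β ∈ VForms V (k + 1) := by
  rw [cotrc_apply]
  exact sum_mem fun i _ => tmul_mem_VForms (covec_mul_mem _ hβ) _

/-- The terms ι_{e_i}(e^i ∧ β) = β - e^i ∧ ι_{e_i} β sum to n β - k β by the number operator. Hence
the trace is onto ∧^k V^* for k < n. -/
theorem trc_cotrc {ι : Type*} [Fintype ι] (b : Module.Basis ι ℝ V) {k : ℕ} {β : ExtDual V}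
    (hβ : β ∈ ⋀[ℝ]^k (Module.Dual ℝ V)) :
    trc (cotrc b β) = ((Module.finrank ℝ V : ℝ) - k) • β := by
  rw [cotrc_apply, map_sum]
  simp only [trc_tmul, contr_covec_mul, Finset.sum_sub_distrib, sum_covec_mul_contr b hβ]
  rw [Module.finrank_eq_card_basis b]
  simp [sub_smul, Nat.cast_smul_eq_nsmul]

/-- For a top form a one has η ∧ ι_v a = η(v) a, so ∑ e^i ∧ ι_v a ⊗ e_i rebuilds a ⊗ v. Thus the
trace is injective in degree n, whence K_n = 0 and the uniqueness of φ_n⁻¹. -/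
theorem cotrc_trc [FiniteDimensional ℝ V] {ι : Type*} [Fintype ι] (b : Module.Basis ι ℝ V)
    {γ : ExtDual V ⊗[ℝ] V} (hγ : γ ∈ VForms V (Module.finrank ℝ V)) : cotrc b (trc γ) = γ := by
  refine VForms_induction (p := fun γ => cotrc b (trc γ) = γ) (by simp)
    (fun P Q h h' => by rw [map_add, map_add, h, h']) (fun a ha v => ?_) hγ
  have e : ∀ η : Module.Dual ℝ V, covec η * contr v a = η v • a := by
    intro η
    have h : covec η * a = 0 := by
      have := covec_mul_mem η ha
      rwa [forms_eq_bot (Nat.lt_succ_self _)] at this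
    have h' := contr_covec_mul v η a
    rw [h, map_zero] at h'
    exact (sub_eq_zero.1 h'.symm).symm
  rw [trc_tmul, cotrc_apply]
  simp only [e, TensorProduct.smul_tmul, ← TensorProduct.tmul_sum]
  exact congrArg _ (b.sum_repr v)

theorem VForms_eq_zero [FiniteDimensional ℝ V] {k : ℕ} (hk : Module.finrank ℝ V < k)
    {P : ExtDual V ⊗[ℝ] V} (hP : P ∈ VForms V k) : P = 0 := by
  refine VForms_induction (p := fun P => P = 0) rfl (fun P Q h h' => by rw [h, h', add_zero])
    (fun a ha v => ?_) hP
  rw [forms_eq_bot hk, Submodule.mem_bot] at ha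
  rw [ha, TensorProduct.zero_tmul]

theorem KerTrace_eq_zero [FiniteDimensional ℝ V] {k : ℕ} (hk : Module.finrank ℝ V ≤ k)
    {P : ExtDual V ⊗[ℝ] V} (hP : P ∈ KerTrace V k) : P = 0 := by
  rw [mem_KerTrace] at hP
  rcases hk.eq_or_lt with rfl | h
  · rw [← cotrc_trc (Module.finBasis ℝ V) hP.1, hP.2, map_zero]
  · exact VForms_eq_zero h hP.1

/-- The linear endomorphism `x ↦ ρ(P)(x)` defined by an element `P` of `V^* ⊗ V`. -/
theorem trc_eq_trace [FiniteDimensional ℝ V] {P : ExtDual V ⊗[ℝ] V} (hP : P ∈ VForms V 1) :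
    ∃ A : V →ₗ[ℝ] V, (∀ x, rho x P = A x) ∧
      trc P = algebraMap ℝ (ExtDual V) (LinearMap.trace ℝ V A) := by
  refine VForms_one_induction (p := fun P => ∃ A : V →ₗ[ℝ] V, (∀ x, rho x P = A x) ∧
      trc P = algebraMap ℝ (ExtDual V) (LinearMap.trace ℝ V A)) ⟨0, by simp⟩ ?_ ?_ hP
  · rintro P Q ⟨A, h, h'⟩ ⟨B, k, k'⟩
    exact ⟨A + B, fun x => by simp [h, k], by simp [h', k']⟩
  · intro η v
    refine ⟨dualTensorHom ℝ V V (η ⊗ₜ v), fun x => rho_covec_tmul x η v, ?_⟩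
    rw [trc_tmul, contr_covec, LinearMap.trace_eq_contract_apply, contractLeft_apply]

theorem exists_VForms_of_end [FiniteDimensional ℝ V] (A : V →ₗ[ℝ] V) :
    ∃ P ∈ VForms V 1, ∀ x, rho x P = A x := by
  let b := Module.finBasis ℝ V
  refine ⟨∑ i, covec (b.coord i) ⊗ₜ A (b i),
    sum_mem fun i _ => tmul_mem_VForms (covec_mem _) _, fun x => ?_⟩
  simp only [map_sum, rho_covec_tmul, ← map_smul]
  rw [← map_sum]
  exact congrArg A (b.sum_repr x)

end ExteriorCalculus

end LInfSl

end

/-! ### The derivation of differential forms attached to a vector-valued form. -/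

noncomputable section

namespace LInfSl

section Derivations

variable {V : Type*} [NormedAddCommGroup V] [NormedSpace ℝ V]

/-- The anchor `(x, P) ↦ ρ(P)(x)`, as a bilinear map. -/
def rhoLin : V →ₗ[ℝ] ExtDual V ⊗[ℝ] V →ₗ[ℝ] V :=
  LinearMap.mk₂ ℝ (fun x P => rho x P)
    (fun x y P => by simp [rho, LinearMap.comp_add, LinearMap.rTensor_add])
    (fun c x P => by simp [rho, LinearMap.comp_smul, LinearMap.rTensor_smul])
    (fun x P Q => map_add _ _ _) (fun c x P => map_smul _ _ _)

/-- The contraction of vector-valued forms, as a bilinear map. -/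
def eulerLin : V →ₗ[ℝ] ExtDual V ⊗[ℝ] V →ₗ[ℝ] ExtDual V ⊗[ℝ] V :=
  LinearMap.rTensorHom V ∘ₗ contr

variable [FiniteDimensional ℝ V]

/-- The vector field `ρ(P)`. -/
def rhoSec : Sec V (ExtDual V ⊗[ℝ] V) →ₗ[SmoothFun V] Sec V V :=
  Sec.bilin rhoLin (eulerSec V)

@[simp] theorem rhoSec_apply (P : Sec V (ExtDual V ⊗[ℝ] V)) (x : V) :
    rhoSec P x = rho x (P x) := rfl

/-- The contraction of a vector-valued form with the Euler vector field. -/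
def eulerC : Sec V (ExtDual V ⊗[ℝ] V) →ₗ[SmoothFun V] Sec V (ExtDual V ⊗[ℝ] V) :=
  Sec.bilin eulerLin (eulerSec V)

@[simp] theorem eulerC_apply (P : Sec V (ExtDual V ⊗[ℝ] V)) (x : V) :
    eulerC P x = eulerContr x (P x) := rfl

/-- The contraction of a form with the Euler vector field. -/
def eulerI : Sec V (ExtDual V) →ₗ[SmoothFun V] Sec V (ExtDual V) :=
  Sec.bilin contr (eulerSec V)

/-- The map `α ↦ ι_E α ⊗ E`, where `E` is the Euler vector field. -/
def eulerTop : Sec V (ExtDual V) →ₗ[SmoothFun V] Sec V (ExtDual V ⊗[ℝ] V) :=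
  (Sec.bilin (TensorProduct.mk ℝ (ExtDual V) V)).flip (eulerSec V) ∘ₗ eulerI

@[simp] theorem eulerTop_apply (α : Sec V (ExtDual V)) (x : V) :
    eulerTop α x = contr x (α x) ⊗ₜ x := rfl

theorem rhoSec_eq_zero {i : ℕ} (hi : i ≠ 0) {P : Sec V (ExtDual V ⊗[ℝ] V)}
    (hP : ∀ x, P x ∈ VForms V (i + 1)) : rhoSec P = 0 :=
  Sec.ext fun x => rho_eq_zero x (by omega) (hP x)

theorem rhoSec_eulerTop (α : Sec V (ExtDual V)) : rhoSec (eulerTop α) = 0 :=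
  Sec.ext fun x => by simp

theorem rhoSec_eulerC (P : Sec V (ExtDual V ⊗[ℝ] V)) : rhoSec (eulerC P) = 0 :=
  Sec.ext fun x => rho_eulerContr x _

theorem eulerC_eulerC (P : Sec V (ExtDual V ⊗[ℝ] V)) : eulerC (eulerC P) = 0 :=
  Sec.ext fun x => eulerContr_eulerContr x _

theorem eulerC_eulerTop (α : Sec V (ExtDual V)) : eulerC (eulerTop α) = 0 :=
  Sec.ext fun x => by simp

/-- The derivation of the algebra of differential forms on `V` defined by a vector-valued form `P`:
it is the sum of the algebraic derivation defined by `P` and of the derivative of the coefficients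
along `ρ(P)`. -/
def derivOf : Sec V (ExtDual V ⊗[ℝ] V) →ₗ[ℝ] Module.End ℝ (Sec V (ExtDual V)) :=
  LinearMap.mk₂ ℝ (fun P ξ => Sec.bilin act P ξ + nabla (rhoSec P) ξ)
    (fun P Q ξ => by
      rw [map_add, map_add, LinearMap.add_apply, nabla_add_left]; abel)
    (fun c P ξ => by
      change Sec.bilin act (algebraMap ℝ (SmoothFun V) c • P) ξ +
        nabla (rhoSec (algebraMap ℝ (SmoothFun V) c • P)) ξ = algebraMap ℝ (SmoothFun V) c • _
      rw [map_smul, map_smul, LinearMap.smul_apply, nabla_smul_left, smul_add])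
    (fun P ξ ζ => by rw [map_add, map_add]; abel)
    (fun c P ξ => by
      rw [(nabla (rhoSec P)).map_smul, smul_add]
      exact congrArg (· + _) (map_smul (Sec.bilin act P) (algebraMap ℝ (SmoothFun V) c) ξ))

theorem derivOf_apply (P : Sec V (ExtDual V ⊗[ℝ] V)) (ξ : Sec V (ExtDual V)) :
    derivOf P ξ = Sec.bilin act P ξ + nabla (rhoSec P) ξ := rfl

theorem derivOf_smul_left (f : SmoothFun V) (P : Sec V (ExtDual V ⊗[ℝ] V))
    (ξ : Sec V (ExtDual V)) : derivOf (f • P) ξ = f • derivOf P ξ := by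
  rw [derivOf_apply, map_smul, map_smul, LinearMap.smul_apply, nabla_smul_left, ← smul_add]
  rfl

theorem derivOf_smul (f : SmoothFun V) (P : Sec V (ExtDual V ⊗[ℝ] V)) (ξ : Sec V (ExtDual V)) :
    derivOf P (f • ξ) = vecApply (rhoSec P) f • ξ + f • derivOf P ξ := by
  rw [derivOf_apply, map_smul, nabla_smul, derivOf_apply, smul_add]
  abel

/-- On constant covectors the derivative of the coefficients vanishes and only the algebraic part is
seen. -/
theorem derivOf_injective {P Q : Sec V (ExtDual V ⊗[ℝ] V)} (h : derivOf P = derivOf Q) :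
    P = Q := by
  refine Sec.ext fun x => sub_eq_zero.1 (act_eq_zero fun η => ?_)
  have := congrArg (fun D => D (constSec (covec η)) x) h
  simp only [derivOf_apply, nabla_constSec, add_zero, Sec.bilin_apply, constSec_apply] at this
  rw [map_sub, LinearMap.sub_apply, this, sub_self]

/-- The Nijenhuis–Richardson bracket of sections. -/
def nrSec (i j : ℕ) (P Q : Sec V (ExtDual V ⊗[ℝ] V)) : Sec V (ExtDual V ⊗[ℝ] V) :=
  Sec.bilin insertion P Q - (-1 : ℝ) ^ (i * j) • Sec.bilin insertion Q P
    + (nabla (rhoSec P) Q - nabla (rhoSec Q) P)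

theorem nrSec_apply {i j : ℕ} {P Q : Sec V (ExtDual V ⊗[ℝ] V)}
    (hP : ∀ x, P x ∈ VForms V (i + 1)) (hQ : ∀ x, Q x ∈ VForms V (j + 1)) (x : V) :
    nrSec i j P Q x = nrBracket (i + 1) (j + 1) P Q x := by
  have key : ∀ (i : ℕ) (P Q : Sec V (ExtDual V ⊗[ℝ] V)), (∀ x, P x ∈ VForms V (i + 1)) →
      nabla (rhoSec P) Q x = if i + 1 = 1 then secDeriv Q x (rho x (P x)) else 0 := by
    intro i P Q hP
    split_ifs with h
    · rfl
    · rw [rhoSec_eq_zero (by omega) hP, nabla_zero_left, Sec.zero_apply]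
  rw [nrBracket, ← key i P Q hP, ← key j Q P hQ]
  rfl

theorem nrSec_mem {i j : ℕ} {P Q : Sec V (ExtDual V ⊗[ℝ] V)}
    (hP : ∀ x, P x ∈ VForms V (i + 1)) (hQ : ∀ x, Q x ∈ VForms V (j + 1)) (x : V) :
    nrSec i j P Q x ∈ VForms V (i + j + 1) := by
  have key : ∀ (i j : ℕ) (P Q : Sec V (ExtDual V ⊗[ℝ] V)), (∀ x, P x ∈ VForms V (i + 1)) →
      (∀ x, Q x ∈ VForms V (j + 1)) → nabla (rhoSec P) Q x ∈ VForms V (i + j + 1) := by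
    intro i j P Q hP hQ
    by_cases hi : i = 0
    · subst hi
      rw [zero_add]
      exact nabla_mem _ _ _ hQ x
    · rw [rhoSec_eq_zero hi hP, nabla_zero_left]
      exact zero_mem _
  refine add_mem (sub_mem (insertion_mem (hP x) (hQ x)) (Submodule.smul_mem _ _ ?_))
    (sub_mem (key i j P Q hP hQ) ?_)
  · rw [add_comm i]; exact insertion_mem (hQ x) (hP x)
  · rw [add_comm i]; exact key j i Q P hQ hP

theorem nrSec_mem_KerTrace {i j : ℕ} {P Q : Sec V (ExtDual V ⊗[ℝ] V)}
    (hP : ∀ x, P x ∈ KerTrace V (i + 1)) (hQ : ∀ x, Q x ∈ KerTrace V (j + 1)) (x : V) :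
    nrSec i j P Q x ∈ KerTrace V (i + j + 1) := by
  simp only [mem_KerTrace, forall_and] at hP hQ
  refine mem_KerTrace.2 ⟨nrSec_mem hP.1 hQ.1 x, ?_⟩
  change trc (insertion (P x) (Q x) - (-1 : ℝ) ^ (i * j) • insertion (Q x) (P x) +
    (nabla (rhoSec P) Q x - nabla (rhoSec Q) P x)) = 0
  have hn : ∀ (X : Sec V V) (R : Sec V (ExtDual V ⊗[ℝ] V)), (∀ x, trc (R x) = 0) →
      trc (nabla X R x) = 0 := fun X R hR =>
    nabla_mem (LinearMap.ker trc) X R hR x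
  rw [map_add, map_sub, map_sub, map_smul, trc_insertion (hP.1 x) (hQ.1 x), hn _ _ hP.2,
    hn _ _ hQ.2, hP.2, hQ.2]
  simp

/-- Since ρ(Q) is Q paired with E and ∇_X E = X, the derivative ∇_{ρ(P)} ρ(Q) is ρ of the insertion
plus ρ of ∇_{ρ(P)} Q. Outside degree (0, 0) both sides vanish. -/
theorem rhoSec_nrSec {i j : ℕ} {P Q : Sec V (ExtDual V ⊗[ℝ] V)}
    (hP : ∀ x, P x ∈ VForms V (i + 1)) (hQ : ∀ x, Q x ∈ VForms V (j + 1)) :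
    rhoSec (nrSec i j P Q) = nabla (rhoSec P) (rhoSec Q) - nabla (rhoSec Q) (rhoSec P) := by
  by_cases hij : i = 0 ∧ j = 0
  · obtain ⟨rfl, rfl⟩ := hij
    have key : ∀ P Q : Sec V (ExtDual V ⊗[ℝ] V), (∀ x, P x ∈ VForms V 1) →
        (∀ x, Q x ∈ VForms V 1) → nabla (rhoSec P) (rhoSec Q) =
          rhoSec (Sec.bilin insertion P Q) + rhoSec (nabla (rhoSec P) Q) := by
      intro P Q hP hQ
      conv_lhs => rw [rhoSec, nabla_bilin, nabla_eulerSec]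
      refine congrArg₂ _ (Sec.ext fun x => ?_) rfl
      exact (rho_insertion x (hP x) (hQ x)).symm
    rw [key P Q hP hQ, key Q P hQ hP, nrSec, map_add, map_sub, map_sub, mul_zero, pow_zero, one_smul]
    abel
  · rw [rhoSec_eq_zero (by omega) (nrSec_mem hP hQ)]
    by_cases hi : i = 0
    · rw [rhoSec_eq_zero (i := j) (by tauto) hQ, map_zero, nabla_zero_left, sub_zero]
    · rw [rhoSec_eq_zero hi hP, map_zero, nabla_zero_left, sub_zero]

/-- The algebraic parts match by `act_insertion`, the coefficient derivatives by flatness, and the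
mixed terms are the derivatives of the coefficients of P and Q in the bracket. -/
theorem derivOf_nrSec {i j : ℕ} {P Q : Sec V (ExtDual V ⊗[ℝ] V)}
    (hP : ∀ x, P x ∈ VForms V (i + 1)) (hQ : ∀ x, Q x ∈ VForms V (j + 1))
    (ξ : Sec V (ExtDual V)) :
    derivOf (nrSec i j P Q) ξ =
      derivOf P (derivOf Q ξ) - (-1 : ℝ) ^ (i * j) • derivOf Q (derivOf P ξ) := by
  have hins : Sec.bilin act (Sec.bilin insertion P Q) ξ -
      (-1 : ℝ) ^ (i * j) • Sec.bilin act (Sec.bilin insertion Q P) ξ =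
      Sec.bilin act P (Sec.bilin act Q ξ) -
        (-1 : ℝ) ^ (i * j) • Sec.bilin act Q (Sec.bilin act P ξ) :=
    Sec.ext fun x => act_insertion (hP x) (hQ x) (ξ x)
  have hs : ∀ (c : ℝ) (R : Sec V (ExtDual V ⊗[ℝ] V)), Sec.bilin act (c • R) ξ =
      c • Sec.bilin act R ξ := fun c R =>
    congrArg (fun g => g ξ) (map_smul (Sec.bilin act) (algebraMap ℝ (SmoothFun V) c) R)
  simp only [derivOf_apply]
  rw [rhoSec_nrSec hP hQ, ← nabla_nabla_sub, nrSec]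
  simp only [map_add, map_sub, LinearMap.add_apply, LinearMap.sub_apply, hs, hins, nabla_bilin]
  -- Either the sign is 1, or both anchors vanish and only the algebraic parts are left.
  by_cases hi : i = 0 ∨ j = 0
  · have : (-1 : ℝ) ^ (i * j) = 1 := by rcases hi with rfl | rfl <;> simp
    rw [this]
    simp only [one_smul]
    abel
  · rw [not_or] at hi
    rw [rhoSec_eq_zero hi.1 hP, rhoSec_eq_zero hi.2 hQ]
    simp

theorem eulerI_derivOf {i : ℕ} {P : Sec V (ExtDual V ⊗[ℝ] V)}
    (hP : ∀ x, P x ∈ VForms V (i + 2)) (ξ : Sec V (ExtDual V)) :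
    eulerI (derivOf P ξ) =
      derivOf (eulerC P) ξ + (-1 : ℝ) ^ (i + 1) • derivOf P (eulerI ξ) := by
  simp only [derivOf_apply]
  rw [rhoSec_eq_zero (Nat.succ_ne_zero i) hP, rhoSec_eulerC]
  simp only [nabla_zero_left, add_zero]
  exact Sec.ext fun x => contr_act x (hP x) (ξ x)

/-- Commuting ι_E with the algebraic part yields ι_{ρ(P)}, and differentiating E in ι_E along ρ(P)
yields the same term, so the two contributions cancel. -/
theorem eulerI_derivOf_zero {P : Sec V (ExtDual V ⊗[ℝ] V)}
    (hP : ∀ x, P x ∈ VForms V 1) (ξ : Sec V (ExtDual V)) :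
    eulerI (derivOf P ξ) = derivOf P (eulerI ξ) := by
  simp only [derivOf_apply]
  rw [eulerI, nabla_bilin, nabla_eulerSec]
  refine Sec.ext fun x => ?_
  have h := contr_act x (hP x) (ξ x)
  rw [act_eulerContr x (hP x), pow_zero, one_smul] at h
  simp only [map_add, Sec.add_apply, Sec.bilin_apply, eulerSec_apply, h, rhoSec_apply]
  abel

theorem derivOf_eulerTop (α ξ : Sec V (ExtDual V)) :
    derivOf (eulerTop α) ξ = Sec.bilin (LinearMap.mul ℝ (ExtDual V)) (eulerI α) (eulerI ξ) := by
  rw [derivOf_apply, rhoSec_eulerTop, nabla_zero_left, add_zero]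
  rfl

theorem derivOf_mul {P : Sec V (ExtDual V ⊗[ℝ] V)} (hP : ∀ x, P x ∈ VForms V 1) {k : ℕ}
    {a : Sec V (ExtDual V)} (ha : ∀ x, a x ∈ ⋀[ℝ]^k (Module.Dual ℝ V)) (ξ : Sec V (ExtDual V)) :
    derivOf P (Sec.bilin (LinearMap.mul ℝ (ExtDual V)) a ξ) =
      Sec.bilin (LinearMap.mul ℝ (ExtDual V)) (derivOf P a) ξ +
        Sec.bilin (LinearMap.mul ℝ (ExtDual V)) a (derivOf P ξ) := by
  simp only [derivOf_apply]
  rw [nabla_bilin]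
  have h : Sec.bilin act P (Sec.bilin (LinearMap.mul ℝ (ExtDual V)) a ξ) =
      Sec.bilin (LinearMap.mul ℝ (ExtDual V)) (Sec.bilin act P a) ξ +
        Sec.bilin (LinearMap.mul ℝ (ExtDual V)) a (Sec.bilin act P ξ) :=
    Sec.ext fun x => act_mul (hP x) (ha x) (ξ x)
  rw [h]
  simp only [map_add, LinearMap.add_apply]
  abel

theorem derivOf_top {P : Sec V (ExtDual V ⊗[ℝ] V)} (hP : ∀ x, P x ∈ KerTrace V 1)
    {β : Sec V (ExtDual V)} (hβ : ∀ x, β x ∈ ⋀[ℝ]^(Module.finrank ℝ V) (Module.Dual ℝ V)) :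
    derivOf P β = nabla (rhoSec P) β := by
  rw [derivOf_apply, add_eq_right]
  refine Sec.ext fun x => ?_
  have h := mem_KerTrace.1 (hP x)
  rw [Sec.bilin_apply, act_top h.1 (hβ x), h.2, zero_mul, Sec.zero_apply]

/-- As an operator, ι_E α ⊗ E is ξ ↦ ι_E α ∧ ι_E ξ. Since D_P is a degree-0 derivation commuting
with ι_E, the commutator merely replaces α by D_P α. -/
theorem nrSec_eulerTop {m : ℕ} (hm : m + 2 = Module.finrank ℝ V) {P : Sec V (ExtDual V ⊗[ℝ] V)}
    (hP : ∀ x, P x ∈ VForms V 1) {α : Sec V (ExtDual V)}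
    (hα : ∀ x, α x ∈ ⋀[ℝ]^(Module.finrank ℝ V) (Module.Dual ℝ V)) :
    nrSec 0 m P (eulerTop α) = eulerTop (derivOf P α) := by
  have h1 : ∀ x, eulerI α x ∈ ⋀[ℝ]^(m + 1) (Module.Dual ℝ V) := fun x =>
    contr_mem x (by rw [hm]; exact hα x)
  have h2 : ∀ x, eulerTop α x ∈ VForms V (m + 1) := fun x => tmul_mem_VForms (h1 x) x
  refine derivOf_injective (LinearMap.ext fun ξ => ?_)
  rw [derivOf_nrSec hP h2, derivOf_eulerTop, derivOf_eulerTop, derivOf_eulerTop, derivOf_mul hP h1,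
    zero_mul, pow_zero, one_smul, eulerI_derivOf_zero hP, eulerI_derivOf_zero hP, add_sub_cancel_right]

end Derivations

end LInfSl

end

/-! ### From dg-Lie algebroids to `LInftyAlgebroid`. -/

noncomputable section

namespace LInfSl

section DGLie

variable (V : Type*) [NormedAddCommGroup V] [NormedSpace ℝ V]
  (E : ℕ → Type*) [∀ i, AddCommGroup (E i)] [∀ i, Module ℝ (E i)]

/-- The data of a dg-Lie algebroid over `V`: a differential, a bracket and an anchor. -/
structure DGLieData [FiniteDimensional ℝ V] [∀ i, FiniteDimensional ℝ (E i)] where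
  /-- the differential -/
  d : TotalSec V E →ₗ[SmoothFun V] TotalSec V E
  /-- the bracket -/
  br : TotalSec V E →ₗ[ℝ] TotalSec V E →ₗ[ℝ] TotalSec V E
  /-- the anchor -/
  anchor : Sec V (E 0) →ₗ[SmoothFun V] Sec V V
  d_zero : ∀ s, d (incl 0 s) = 0
  d_mem : ∀ i s, d (incl (i + 1) s) ∈ homog V E i
  br_mem : ∀ i j s t, br (incl i s) (incl j t) ∈ homog V E (i + j)
  skew : ∀ i j s t, br (incl j t) (incl i s) = -((-1 : ℤ) ^ (i * j) • br (incl i s) (incl j t))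
  d_d : ∀ i s, d (d (incl i s)) = 0
  d_br : ∀ i j s t, d (br (incl i s) (incl j t)) - br (d (incl i s)) (incl j t)
    + (-1 : ℤ) ^ (i * j) • br (d (incl j t)) (incl i s) = 0
  jac : ∀ i j k s t u, br (br (incl i s) (incl j t)) (incl k u)
    - (-1 : ℤ) ^ (j * k) • br (br (incl i s) (incl k u)) (incl j t)
    + (-1 : ℤ) ^ (i * (j + k)) • br (br (incl j t) (incl k u)) (incl i s) = 0
  leibniz : ∀ (s : Sec V (E 0)) (f : SmoothFun V) (j : ℕ) (t : Sec V (E j)),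
    br (incl 0 s) (incl j (f • t)) =
      vecApply (anchor s) f • incl j t + f • br (incl 0 s) (incl j t)
  leibniz_neg : ∀ (i : ℕ) (s : Sec V (E (i + 1))) (f : SmoothFun V) (j : ℕ) (t : Sec V (E j)),
    br (incl (i + 1) s) (incl j (f • t)) = f • br (incl (i + 1) s) (incl j t)
  anchor_diff : ∀ s : Sec V (E 1), anchor (d (incl 1 s) 0) = 0
  anchor_bracket : ∀ s t : Sec V (E 0),
    (anchor (br (incl 0 s) (incl 0 t) 0) : V → V) =
      VectorField.lieBracket ℝ (anchor s : V → V) (anchor t : V → V)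

namespace DGLieData

variable {V E} [FiniteDimensional ℝ V] [∀ i, FiniteDimensional ℝ (E i)] (D : DGLieData V E)

/-- The differential as a multilinear map. -/
def unary : MultilinearMap ℝ (fun _ : Fin 1 => TotalSec V E) (TotalSec V E) where
  toFun x := D.d (x 0)
  map_update_add' x i a b := by
    obtain rfl := Subsingleton.elim i 0
    simp
  map_update_smul' x i c a := by
    obtain rfl := Subsingleton.elim i 0
    simp only [Function.update_self]
    exact map_smul D.d (algebraMap ℝ (SmoothFun V) c) a

/-- The bracket as a multilinear map. -/
def binary : MultilinearMap ℝ (fun _ : Fin 2 => TotalSec V E) (TotalSec V E) where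
  toFun x := D.br (x 0) (x 1)
  map_update_add' x i a b := by
    fin_cases i <;> simp [Function.update]
  map_update_smul' x i c a := by
    fin_cases i <;> simp [Function.update]

/-- The multibrackets. -/
def brackets : ∀ k : ℕ, MultilinearMap ℝ (fun _ : Fin k => TotalSec V E) (TotalSec V E)
  | 0 => 0
  | 1 => D.unary
  | 2 => D.binary
  | _ + 3 => 0

theorem brackets_eq_zero {k : ℕ} (hk : 3 ≤ k) : D.brackets k = 0 := by
  obtain ⟨k, rfl⟩ := Nat.exists_eq_add_of_le' hk
  rfl

theorem brackets_one (x : Fin 1 → TotalSec V E) : D.brackets 1 x = D.d (x 0) := rfl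

theorem brackets_two (x : Fin 2 → TotalSec V E) : D.brackets 2 x = D.br (x 0) (x 1) := rfl

theorem brackets_card {n m : ℕ} (x : Fin n → TotalSec V E) (S : Finset (Fin n)) (h : S.card = m) :
    D.brackets S.card (fun p => x (S.orderEmbOfFin rfl p)) =
      D.brackets m fun p => x (S.orderEmbOfFin h p) := by
  subst h; rfl

theorem brackets_cons_card {n m : ℕ} (x : Fin n → TotalSec V E) (y : TotalSec V E)
    (S : Finset (Fin n)) (h : S.card = m) :
    D.brackets (S.card + 1) (Fin.cons y fun p => x (S.orderEmbOfFin rfl p)) =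
      D.brackets (m + 1) (Fin.cons y fun p => x (S.orderEmbOfFin h p)) := by
  subst h; rfl

theorem brackets_singleton {n : ℕ} (x : Fin n → TotalSec V E) {S : Finset (Fin n)} {a : Fin n}
    (hS : S = {a}) :
    D.brackets S.card (fun p => x (S.orderEmbOfFin rfl p)) = D.d (x a) := by
  subst hS
  rw [brackets_card D x _ (Finset.card_singleton a), brackets_one, Finset.orderEmbOfFin_singleton]

theorem brackets_pair {n : ℕ} (x : Fin n → TotalSec V E) {S : Finset (Fin n)} {a b : Fin n}
    (hab : a < b) (hS : S = {a, b}) :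
    D.brackets S.card (fun p => x (S.orderEmbOfFin rfl p)) = D.br (x a) (x b) := by
  subst hS
  have h := Finset.orderEmbOfFin_unique (s := {a, b}) (Finset.card_pair hab.ne) (f := ![a, b])
    (fun i => by fin_cases i <;> simp)
    (fun i j hij => by fin_cases i <;> fin_cases j <;> simp_all)
  rw [brackets_card D x _ (Finset.card_pair hab.ne), brackets_two, ← h]
  rfl

theorem brackets_cons_empty {n : ℕ} (x : Fin n → TotalSec V E) (y : TotalSec V E)
    {S : Finset (Fin n)} (hS : S = ∅) :
    D.brackets (S.card + 1) (Fin.cons y fun p => x (S.orderEmbOfFin rfl p)) = D.d y := by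
  subst hS
  rfl

theorem brackets_cons_singleton {n : ℕ} (x : Fin n → TotalSec V E) (y : TotalSec V E)
    {S : Finset (Fin n)} {a : Fin n} (hS : S = {a}) :
    D.brackets (S.card + 1) (Fin.cons y fun p => x (S.orderEmbOfFin rfl p)) = D.br y (x a) := by
  subst hS
  rw [brackets_cons_card D x y _ (Finset.card_singleton a), brackets_two]
  change D.br y (x (Finset.orderEmbOfFin {a} _ 0)) = _
  rw [Finset.orderEmbOfFin_singleton]

theorem jacobi_term_eq_zero {n : ℕ} (x : Fin n → TotalSec V E) (S : Finset (Fin n))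
    (h : 3 ≤ S.card ∨ 2 ≤ Sᶜ.card) :
    D.brackets (Sᶜ.card + 1) (Fin.cons (D.brackets S.card fun p => x (S.orderEmbOfFin rfl p))
      fun q => x (Sᶜ.orderEmbOfFin rfl q)) = 0 := by
  rcases h with h | h
  · rw [D.brackets_eq_zero h]
    exact MultilinearMap.map_coord_zero _ 0 rfl
  · rw [D.brackets_eq_zero (k := Sᶜ.card + 1) (by omega)]
    rfl

theorem jacobi_one (d : Fin 1 → ℕ) (x : Fin 1 → TotalSec V E) (hx : ∀ p, x p ∈ homog V E (d p)) :
    ∑ S : Finset (Fin 1) with S.Nonempty,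
      (unshuffleSign d S * (-1) ^ (S.card * Sᶜ.card)) •
        D.brackets (Sᶜ.card + 1) (Fin.cons (D.brackets S.card fun p => x (S.orderEmbOfFin rfl p))
          fun q => x (Sᶜ.orderEmbOfFin rfl q)) = 0 := by
  rw [show (Finset.univ.filter fun S : Finset (Fin 1) => S.Nonempty) = {{0}} by decide,
    Finset.sum_singleton, D.brackets_singleton x (a := 0) rfl, D.brackets_cons_empty x _ (by decide)]
  obtain ⟨s, hs⟩ := hx 0
  rw [← hs, D.d_d, smul_zero]

theorem jacobi_two (d : Fin 2 → ℕ) (x : Fin 2 → TotalSec V E) (hx : ∀ p, x p ∈ homog V E (d p)) :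
    ∑ S : Finset (Fin 2) with S.Nonempty,
      (unshuffleSign d S * (-1) ^ (S.card * Sᶜ.card)) •
        D.brackets (Sᶜ.card + 1) (Fin.cons (D.brackets S.card fun p => x (S.orderEmbOfFin rfl p))
          fun q => x (Sᶜ.orderEmbOfFin rfl q)) = 0 := by
  have c0 : ({0} : Finset (Fin 2))ᶜ = {1} := by decide
  have c1 : ({1} : Finset (Fin 2))ᶜ = {0} := by decide
  have c01 : ({0, 1} : Finset (Fin 2))ᶜ = ∅ := by decide
  rw [show (Finset.univ.filter fun S : Finset (Fin 2) => S.Nonempty) = {{0, 1}, {0}, {1}} by decide,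
    Finset.sum_insert (by decide), Finset.sum_insert (by decide), Finset.sum_singleton,
    D.brackets_singleton x (a := 0) rfl, D.brackets_singleton x (a := 1) rfl,
    D.brackets_pair x (a := 0) (b := 1) (by decide) rfl,
    D.brackets_cons_empty x _ c01, D.brackets_cons_singleton x _ c0,
    D.brackets_cons_singleton x _ c1]
  obtain ⟨s, hs⟩ := hx 0
  obtain ⟨t, ht⟩ := hx 1
  rw [← hs, ← ht, ← D.d_br (d 0) (d 1) s t]
  simp only [unshuffleSign, c0, c1, c01]
  simp [mul_comm (d 1)]
  abel

theorem jacobi_three (d : Fin 3 → ℕ) (x : Fin 3 → TotalSec V E)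
    (hx : ∀ p, x p ∈ homog V E (d p)) :
    ∑ S : Finset (Fin 3) with S.Nonempty,
      (unshuffleSign d S * (-1) ^ (S.card * Sᶜ.card)) •
        D.brackets (Sᶜ.card + 1) (Fin.cons (D.brackets S.card fun p => x (S.orderEmbOfFin rfl p))
          fun q => x (Sᶜ.orderEmbOfFin rfl q)) = 0 := by
  have c01 : ({0, 1} : Finset (Fin 3))ᶜ = {2} := by decide
  have c02 : ({0, 2} : Finset (Fin 3))ᶜ = {1} := by decide
  have c12 : ({1, 2} : Finset (Fin 3))ᶜ = {0} := by decide
  -- Only two-element sets contribute: a singleton leaves an outer ternary bracket, and the full set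
  -- is an inner ternary bracket.
  rw [← Finset.sum_subset (s₁ := {{0, 1}, {0, 2}, {1, 2}}) (by decide) fun S _ hS => by
    rw [D.jacobi_term_eq_zero x S (by revert S; decide), smul_zero],
    Finset.sum_insert (by decide), Finset.sum_insert (by decide), Finset.sum_singleton,
    D.brackets_pair x (a := 0) (b := 1) (by decide) rfl,
    D.brackets_pair x (a := 0) (b := 2) (by decide) rfl,
    D.brackets_pair x (a := 1) (b := 2) (by decide) rfl,
    D.brackets_cons_singleton x _ c01, D.brackets_cons_singleton x _ c02,
    D.brackets_cons_singleton x _ c12]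
  obtain ⟨s, hs⟩ := hx 0
  obtain ⟨t, ht⟩ := hx 1
  obtain ⟨u, hu⟩ := hx 2
  rw [← hs, ← ht, ← hu, ← D.jac (d 0) (d 1) (d 2) s t u]
  simp only [unshuffleSign, c01, c02, c12]
  simp [mul_comm (d 2), mul_comm (d 1) (d 0), mul_add, pow_add]
  abel

/-- With at least four arguments, either S has three elements or its complement has two, so every
term contains a bracket of arity at least 3. -/
theorem jacobi_of_le {n : ℕ} (hn : 4 ≤ n) (d : Fin n → ℕ) (x : Fin n → TotalSec V E) :
    ∑ S : Finset (Fin n) with S.Nonempty,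
      (unshuffleSign d S * (-1) ^ (S.card * Sᶜ.card)) •
        D.brackets (Sᶜ.card + 1) (Fin.cons (D.brackets S.card fun p => x (S.orderEmbOfFin rfl p))
          fun q => x (Sᶜ.orderEmbOfFin rfl q)) = 0 := by
  refine Finset.sum_eq_zero fun S _ => ?_
  have := S.card_add_card_compl
  rw [Fintype.card_fin] at this
  rw [D.jacobi_term_eq_zero x S (by omega), smul_zero]

/-- The `L_∞`-algebroid defined by a dg-Lie algebroid. -/
def toLInftyAlgebroid : LInftyAlgebroid V E where
  ℓ := D.brackets
  anchor := D.anchor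
  ℓ_zero := rfl
  degree k d x hx e he := by
    match k with
    | 0 => simp at he
    | 1 =>
      obtain ⟨s, hs⟩ := hx 0
      rw [Fin.sum_univ_one] at he
      rw [brackets_one, ← hs]
      obtain h : d 0 = e + 1 := by omega
      revert s
      rw [h]
      exact fun s _ => D.d_mem e s
    | 2 =>
      obtain ⟨s, hs⟩ := hx 0
      obtain ⟨t, ht⟩ := hx 1
      rw [Fin.sum_univ_two] at he
      rw [brackets_two, ← hs, ← ht, show e = d 0 + d 1 by omega]
      exact D.br_mem _ _ s t
    | k + 3 => exact zero_mem _
  degree_pos k d x hx h := by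
    match k with
    | 0 => rfl
    | 1 =>
      obtain ⟨s, hs⟩ := hx 0
      rw [Fin.sum_univ_one] at h
      rw [brackets_one, ← hs]
      obtain h : d 0 = 0 := by omega
      revert s
      rw [h]
      exact fun s _ => D.d_zero s
    | 2 => omega
    | k + 3 => rfl
  skew k d x hx p q hpq := by
    match k with
    | 0 => exact p.elim0
    | 1 => omega
    | 2 =>
      obtain rfl : p = 0 := by omega
      obtain rfl : q = 1 := by omega
      obtain ⟨s, hs⟩ := hx 0
      obtain ⟨t, ht⟩ := hx 1
      rw [brackets_two, brackets_two, Function.comp_apply, Function.comp_apply,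
        Equiv.swap_apply_left, Equiv.swap_apply_right, ← hs, ← ht]
      exact D.skew _ _ s t
    | k + 3 => rw [D.brackets_eq_zero (by omega)]; simp
  jacobi n d x hx := by
    match n with
    | 0 => rfl
    | 1 => exact D.jacobi_one d x hx
    | 2 => exact D.jacobi_two d x hx
    | 3 => exact D.jacobi_three d x hx
    | n + 4 => exact D.jacobi_of_le (by omega) d x
  smul_linear k hk f x p := by
    match k with
    | 0 => exact p.elim0
    | 1 =>
      obtain rfl := Subsingleton.elim p 0
      rw [brackets_one, brackets_one, Function.update_self, map_smul]
    | 2 => exact absurd rfl hk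
    | k + 3 => rw [D.brackets_eq_zero (by omega)]; simp
  leibniz s f y := by
    change D.br (incl 0 s) (f • y) = vecApply (D.anchor s) f • y + f • D.br (incl 0 s) y
    induction y using DirectSum.induction_on with
    | zero => simp
    | of j t =>
      rw [← DirectSum.lof_eq_of (SmoothFun V), ← map_smul]
      exact D.leibniz s f j t
    | add y z hy hz => rw [smul_add, map_add, hy, hz, map_add, smul_add, smul_add]; abel
  leibniz_neg i s f y := by
    change D.br (incl (i + 1) s) (f • y) = f • D.br (incl (i + 1) s) y
    induction y using DirectSum.induction_on with
    | zero => simp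
    | of j t =>
      rw [← DirectSum.lof_eq_of (SmoothFun V), ← map_smul]
      exact D.leibniz_neg i s f j t
    | add y z hy hz => rw [smul_add, map_add, hy, hz, map_add, smul_add]
  anchor_diff := D.anchor_diff
  anchor_bracket := D.anchor_bracket

end DGLieData

end DGLie

end LInfSl

end

/-! ### Graded commutators in an associative algebra. -/

noncomputable section

namespace LInfSl

section GradedCommutators

variable {R : Type*} [Ring R] [Algebra ℝ R]

/-- Only the parities of ij, ik and jk matter; for each choice of signs this is an identity in a
noncommutative ring. -/
theorem graded_jacobi (a b c : R) (i j k : ℕ) :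
    ((a * b - (-1 : ℝ) ^ (i * j) • (b * a)) * c
        - (-1 : ℝ) ^ ((i + j) * k) • (c * (a * b - (-1 : ℝ) ^ (i * j) • (b * a))))
      - (-1 : ℝ) ^ (j * k) • ((a * c - (-1 : ℝ) ^ (i * k) • (c * a)) * b
        - (-1 : ℝ) ^ ((i + k) * j) • (b * (a * c - (-1 : ℝ) ^ (i * k) • (c * a))))
      + (-1 : ℝ) ^ (i * (j + k)) • ((b * c - (-1 : ℝ) ^ (j * k) • (c * b)) * a
        - (-1 : ℝ) ^ ((j + k) * i) • (a * (b * c - (-1 : ℝ) ^ (j * k) • (c * b)))) = 0 := by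
  simp only [add_mul, mul_add, pow_add, mul_comm k j, mul_comm j i, mul_comm k i]
  rcases neg_one_pow_eq_or ℝ (i * j) with h | h <;>
  rcases neg_one_pow_eq_or ℝ (i * k) with h' | h' <;>
  rcases neg_one_pow_eq_or ℝ (j * k) with h'' | h'' <;>
  rw [h, h', h''] <;> simp only [one_smul, neg_smul, mul_one, mul_neg, neg_neg] <;> noncomm_ring

/-- The graded Jacobi identity with c odd. The sign (-1)^(ij) (-1)^j is the one attached to [c, a],
whose parity is that of i - 1; the product form avoids a truncated exponent. -/
theorem graded_commutator_leibniz (a b c : R) (i j : ℕ) :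
    (c * (a * b - (-1 : ℝ) ^ (i * j) • (b * a))
        - (-1 : ℝ) ^ (i + j) • ((a * b - (-1 : ℝ) ^ (i * j) • (b * a)) * c))
      - ((c * a - (-1 : ℝ) ^ i • (a * c)) * b
        - ((-1 : ℝ) ^ (i * j) * (-1) ^ j) • (b * (c * a - (-1 : ℝ) ^ i • (a * c))))
      + (-1 : ℝ) ^ (i * j) • ((c * b - (-1 : ℝ) ^ j • (b * c)) * a
        - ((-1 : ℝ) ^ (j * i) * (-1) ^ i) • (a * (c * b - (-1 : ℝ) ^ j • (b * c)))) = 0 := by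
  rw [mul_comm j i, pow_add]
  rcases neg_one_pow_eq_or ℝ (i * j) with h | h <;>
  rcases neg_one_pow_eq_or ℝ i with h' | h' <;>
  rcases neg_one_pow_eq_or ℝ j with h'' | h'' <;>
  rw [h, h', h''] <;> simp only [one_smul, neg_smul, mul_one, mul_neg, neg_neg] <;> noncomm_ring

end GradedCommutators

section TotalSections

variable {V : Type*} [NormedAddCommGroup V] [NormedSpace ℝ V]

theorem neg_one_zsmul {M : Type*} [AddCommGroup M] [Module ℝ M] (m : ℕ) (x : M) :
    (-1 : ℤ) ^ m • x = (-1 : ℝ) ^ m • x := by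
  rcases Nat.even_or_odd m with h | h <;> simp [h.neg_one_pow]

variable {E : ℕ → Type*} [∀ i, AddCommGroup (E i)] [∀ i, Module ℝ (E i)]

theorem incl_mem (i : ℕ) (s : Sec V (E i)) : incl i s ∈ homog V E i := ⟨s, rfl⟩

theorem incl_mem_of_eq {i j : ℕ} (h : i = j) (s : Sec V (E i)) : incl i s ∈ homog V E j :=
  h ▸ ⟨s, rfl⟩

theorem toModule_incl {N : Type*} [AddCommGroup N] [Module ℝ N] (φ : ∀ i, Sec V (E i) →ₗ[ℝ] N)
    (i : ℕ) (s : Sec V (E i)) : DirectSum.toModule ℝ ℕ N φ (incl i s) = φ i s := by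
  rw [incl, DirectSum.lof_eq_of (SmoothFun V), ← DirectSum.lof_eq_of ℝ, DirectSum.toModule_lof]

end TotalSections

/-! ### Dg-Lie algebroids with a faithful representation. -/

section Representations

variable (V : Type*) [NormedAddCommGroup V] [NormedSpace ℝ V] [FiniteDimensional ℝ V]
  (E : ℕ → Type*) [∀ i, AddCommGroup (E i)] [∀ i, Module ℝ (E i)]
  (M : Type*) [AddCommGroup M] [Module ℝ M]

variable {V E M} in
/-- The operator which represents the differential of a homogeneous section; the differential
vanishes in degree `0`. -/
def opDiff (op : ∀ i, Sec V (E i) →ₗ[ℝ] Module.End ℝ M)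
    (d : ∀ i, Sec V (E (i + 1)) →ₗ[SmoothFun V] Sec V (E i)) :
    ∀ i, Sec V (E i) → Module.End ℝ M
  | 0 => fun _ => 0
  | i + 1 => fun s => op i (d i s)

/-- A dg-Lie algebroid with a faithful representation of its graded Lie algebra of sections, which
sends brackets to graded commutators. -/
structure DGLieRep where
  /-- the representation -/
  op : ∀ i, Sec V (E i) →ₗ[ℝ] Module.End ℝ M
  /-- the bracket -/
  br : ∀ i j, Sec V (E i) → Sec V (E j) → Sec V (E (i + j))
  /-- the differential -/
  d : ∀ i, Sec V (E (i + 1)) →ₗ[SmoothFun V] Sec V (E i)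
  /-- the anchor -/
  anchor : Sec V (E 0) →ₗ[SmoothFun V] Sec V V
  op_injective : ∀ i, Function.Injective (op i)
  op_br : ∀ i j s t, op (i + j) (br i j s t) =
    op i s * op j t - (-1 : ℝ) ^ (i * j) • (op j t * op i s)
  d_d : ∀ i s, d i (d (i + 1) s) = 0
  -- This and the Leibniz rule below compare operators rather than sections, since the sections
  -- involved lie in bundles with different indices, such as 0 + j and j.
  d_br : ∀ i j s t,
    opDiff op d (i + j) (br i j s t)
      - (opDiff op d i s * op j t
        - ((-1 : ℝ) ^ (i * j) * (-1) ^ j) • (op j t * opDiff op d i s))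
      + (-1 : ℝ) ^ (i * j) • (opDiff op d j t * op i s
        - ((-1 : ℝ) ^ (j * i) * (-1) ^ i) • (op i s * opDiff op d j t)) = 0
  leibniz : ∀ (j : ℕ) (s : Sec V (E 0)) (f : SmoothFun V) (t : Sec V (E j)), op (0 + j) (br 0 j s (f • t)) =
    op j (vecApply (anchor s) f • t) + op (0 + j) (f • br 0 j s t)
  leibniz_neg : ∀ (i j : ℕ) (s : Sec V (E (i + 1))) (f : SmoothFun V) (t : Sec V (E j)),
    br (i + 1) j s (f • t) = f • br (i + 1) j s t
  anchor_d : ∀ s, anchor (d 0 s) = 0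
  anchor_br : ∀ s t : Sec V (E 0), (anchor (br 0 0 s t) : V → V) =
    VectorField.lieBracket ℝ (anchor s : V → V) (anchor t : V → V)

namespace DGLieRep

variable {V E M} (D : DGLieRep V E M)

/-- The bracket of homogeneous sections, as a bilinear map. -/
def brLin (i j : ℕ) : Sec V (E i) →ₗ[ℝ] Sec V (E j) →ₗ[ℝ] Sec V (E (i + j)) :=
  LinearMap.mk₂ ℝ (D.br i j)
    (fun s s' t => D.op_injective _ <| by
      simp only [map_add, D.op_br, add_mul, mul_add, smul_add]; abel)
    (fun c s t => D.op_injective _ <| by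
      simp only [map_smul, D.op_br, smul_mul_assoc, mul_smul_comm, smul_sub]
      rw [smul_comm])
    (fun s t t' => D.op_injective _ <| by
      simp only [map_add, D.op_br, add_mul, mul_add, smul_add]; abel)
    (fun c s t => D.op_injective _ <| by
      simp only [map_smul, D.op_br, smul_mul_assoc, mul_smul_comm, smul_sub]
      rw [smul_comm])

/-- The differential on the total module of sections. -/
def diffTotal : TotalSec V E →ₗ[SmoothFun V] TotalSec V E :=
  DirectSum.toModule _ _ _ fun
    | 0 => 0
    | i + 1 => DirectSum.lof (SmoothFun V) ℕ (fun i => Sec V (E i)) i ∘ₗ D.d i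

/-- The bracket on the total module of sections. -/
def brTotal : TotalSec V E →ₗ[ℝ] TotalSec V E →ₗ[ℝ] TotalSec V E :=
  DirectSum.toModule _ _ _ fun i => LinearMap.flip <| DirectSum.toModule _ _ _ fun j =>
    ((D.brLin i j).compr₂ (DirectSum.lof ℝ ℕ (fun i => Sec V (E i)) (i + j))).flip

/-- The representation of the total module of sections. -/
def opTotal : TotalSec V E →ₗ[ℝ] Module.End ℝ M := DirectSum.toModule _ _ _ D.op

theorem diffTotal_zero (s : Sec V (E 0)) : D.diffTotal (incl 0 s) = 0 := by
  rw [diffTotal, DirectSum.toModule_lof]; rfl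

theorem diffTotal_succ (i : ℕ) (s : Sec V (E (i + 1))) :
    D.diffTotal (incl (i + 1) s) = incl i (D.d i s) := by
  rw [diffTotal, DirectSum.toModule_lof]; rfl

theorem brTotal_incl (i j : ℕ) (s : Sec V (E i)) (t : Sec V (E j)) :
    D.brTotal (incl i s) (incl j t) = incl (i + j) (D.br i j s t) := by
  rw [brTotal, toModule_incl, LinearMap.flip_apply, toModule_incl]
  rfl

theorem opTotal_incl (i : ℕ) (s : Sec V (E i)) : D.opTotal (incl i s) = D.op i s :=
  toModule_incl D.op i s

/-- Faithfulness is assumed degree by degree, hence the homogeneity condition. It reduces each axiom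
to an identity of operators, even when its terms carry indices like i + j and j + i. -/
theorem eq_zero_of_opTotal {m : ℕ} {y : TotalSec V E} (hy : y ∈ homog V E m)
    (h : D.opTotal y = 0) : y = 0 := by
  obtain ⟨s, rfl⟩ := hy
  rw [opTotal_incl] at h
  rw [D.op_injective m (h.trans (map_zero _).symm), map_zero]

theorem opTotal_brTotal (i j : ℕ) (s : Sec V (E i)) (t : Sec V (E j)) :
    D.opTotal (D.brTotal (incl i s) (incl j t)) =
      D.op i s * D.op j t - (-1 : ℝ) ^ (i * j) • (D.op j t * D.op i s) := by
  rw [brTotal_incl, opTotal_incl, D.op_br]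

theorem opTotal_brTotal_brTotal (i j k : ℕ) (s : Sec V (E i)) (t : Sec V (E j))
    (u : Sec V (E k)) :
    D.opTotal (D.brTotal (D.brTotal (incl i s) (incl j t)) (incl k u)) =
      (D.op i s * D.op j t - (-1 : ℝ) ^ (i * j) • (D.op j t * D.op i s)) * D.op k u -
        (-1 : ℝ) ^ ((i + j) * k) • (D.op k u *
          (D.op i s * D.op j t - (-1 : ℝ) ^ (i * j) • (D.op j t * D.op i s))) := by
  rw [brTotal_incl, opTotal_brTotal, D.op_br]

theorem opTotal_diffTotal (i : ℕ) (s : Sec V (E i)) :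
    D.opTotal (D.diffTotal (incl i s)) = opDiff D.op D.d i s := by
  rcases i with _ | i
  · rw [diffTotal_zero, map_zero]; rfl
  · rw [diffTotal_succ, opTotal_incl]; rfl

theorem diffTotal_mem (i : ℕ) (s : Sec V (E i)) : D.diffTotal (incl i s) ∈ homog V E (i - 1) := by
  rcases i with _ | i
  · rw [diffTotal_zero]; exact zero_mem _
  · rw [diffTotal_succ]; exact incl_mem _ _

theorem brTotal_diffTotal_mem (i j : ℕ) (s : Sec V (E i)) (t : Sec V (E j)) :
    D.brTotal (D.diffTotal (incl i s)) (incl j t) ∈ homog V E (i + j - 1) := by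
  rcases i with _ | i
  · rw [diffTotal_zero, map_zero, LinearMap.zero_apply]; exact zero_mem _
  · rw [diffTotal_succ, brTotal_incl]; exact incl_mem_of_eq (by omega) _

theorem opTotal_brTotal_diffTotal (i j : ℕ) (s : Sec V (E i)) (t : Sec V (E j)) :
    D.opTotal (D.brTotal (D.diffTotal (incl i s)) (incl j t)) =
      opDiff D.op D.d i s * D.op j t -
        ((-1 : ℝ) ^ (i * j) * (-1) ^ j) •
          (D.op j t * opDiff D.op D.d i s) := by
  rcases i with _ | i
  · rw [diffTotal_zero, map_zero, LinearMap.zero_apply, map_zero]; simp [opDiff]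
  · rw [diffTotal_succ, opTotal_brTotal, add_mul, one_mul, pow_add, mul_assoc, ← pow_add,
      ← two_mul, pow_mul]
    simp [opDiff]

variable [∀ i, FiniteDimensional ℝ (E i)]

/-- The dg-Lie algebroid, on the total module of sections. -/
def toDGLieData : DGLieData V E where
  d := D.diffTotal
  br := D.brTotal
  anchor := D.anchor
  d_zero := D.diffTotal_zero
  d_mem i s := D.diffTotal_mem (i + 1) s
  br_mem i j s t := by rw [brTotal_incl]; exact incl_mem _ _
  skew i j s t := by
    rw [← add_eq_zero_iff_eq_neg]
    refine D.eq_zero_of_opTotal (m := i + j) (add_mem ?_ (zsmul_mem ?_ _)) ?_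
    · rw [brTotal_incl]; exact incl_mem_of_eq (by omega) _
    · rw [brTotal_incl]; exact incl_mem _ _
    · rw [map_add, map_zsmul, opTotal_brTotal, opTotal_brTotal, neg_one_zsmul, mul_comm j i]
      rcases neg_one_pow_eq_or ℝ (i * j) with h | h <;> rw [h] <;> module
  d_d i s := by
    match i with
    | 0 => rw [diffTotal_zero, map_zero]
    | 1 => rw [diffTotal_succ, diffTotal_zero]
    | i + 2 => rw [diffTotal_succ, diffTotal_succ, D.d_d]; exact map_zero _
  d_br i j s t := by
    refine D.eq_zero_of_opTotal (m := i + j - 1) (add_mem (sub_mem ?_ ?_) (zsmul_mem ?_ _)) ?_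
    · rw [brTotal_incl]; exact D.diffTotal_mem _ _
    · exact D.brTotal_diffTotal_mem i j s t
    · rw [add_comm i j]; exact D.brTotal_diffTotal_mem j i t s
    · rw [map_add, map_sub, map_zsmul, neg_one_zsmul, opTotal_brTotal_diffTotal,
        opTotal_brTotal_diffTotal, brTotal_incl, opTotal_diffTotal]
      exact D.d_br i j s t
  jac i j k s t u := by
    refine D.eq_zero_of_opTotal (m := i + j + k)
      (add_mem (sub_mem ?_ (zsmul_mem ?_ _)) (zsmul_mem ?_ _)) ?_
    · rw [brTotal_incl, brTotal_incl]; exact incl_mem _ _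
    · rw [brTotal_incl, brTotal_incl]; exact incl_mem_of_eq (by omega) _
    · rw [brTotal_incl, brTotal_incl]; exact incl_mem_of_eq (by omega) _
    · rw [map_add, map_sub, map_zsmul, map_zsmul, neg_one_zsmul, neg_one_zsmul,
        opTotal_brTotal_brTotal, opTotal_brTotal_brTotal, opTotal_brTotal_brTotal]
      exact graded_jacobi _ _ _ i j k
  leibniz s f j t := by
    rw [brTotal_incl, brTotal_incl, ← map_smul, ← map_smul, ← sub_eq_zero]
    refine D.eq_zero_of_opTotal (m := j) (sub_mem (incl_mem_of_eq (zero_add j) _)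
      (add_mem (incl_mem _ _) (incl_mem_of_eq (zero_add j) _))) ?_
    rw [map_sub, map_add, opTotal_incl, opTotal_incl, opTotal_incl, D.leibniz, sub_self]
  leibniz_neg i s f j t := by
    rw [brTotal_incl, brTotal_incl, D.leibniz_neg]; exact map_smul _ _ _
  anchor_diff s := by
    rw [diffTotal_succ, incl, DirectSum.lof_apply, D.anchor_d]
  anchor_bracket s t := by
    rw [brTotal_incl]
    have h : (incl (0 + 0) (D.br 0 0 s t) : TotalSec V E) 0 = D.br 0 0 s t :=
      DirectSum.lof_apply (SmoothFun V) 0 _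
    rw [h]
    exact D.anchor_br s t

end DGLieRep

end Representations

end LInfSl

end

/-! ### The bracket and the differential on the bundles K_k and ∧^n V^*. -/

noncomputable section

namespace LInfSl

section SlAlgebroid

variable {V : Type*} [NormedAddCommGroup V] [NormedSpace ℝ V]

theorem map_real_smul {M N : Type*} [AddCommGroup M] [AddCommGroup N] [Module (SmoothFun V) M]
    [Module (SmoothFun V) N] [Module ℝ M] [Module ℝ N] [IsScalarTower ℝ (SmoothFun V) M]
    [IsScalarTower ℝ (SmoothFun V) N] (g : M →ₗ[SmoothFun V] N) (c : ℝ) (m : M) :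
    g (c • m) = c • g m := by
  rw [← algebraMap_smul (SmoothFun V) c m, map_smul, algebraMap_smul]

/-- The component in `∧ V^* ⊗ V` of a section, as a section. -/
def vecSec (i : ℕ) : Sec V (SlBundle V i) →ₗ[SmoothFun V] Sec V (ExtDual V ⊗[ℝ] V) :=
  Sec.map (LinearMap.fst ℝ _ _ ∘ₗ (slFiber V i).subtype)

/-- The component in `∧ V^*` of a section, as a section. -/
def topSec (i : ℕ) : Sec V (SlBundle V i) →ₗ[SmoothFun V] Sec V (ExtDual V) :=
  Sec.map (LinearMap.snd ℝ _ _ ∘ₗ (slFiber V i).subtype)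

theorem vecSec_apply {i : ℕ} (s : Sec V (SlBundle V i)) (x : V) : vecSec i s x = vecPart s x := rfl

theorem topSec_apply {i : ℕ} (s : Sec V (SlBundle V i)) (x : V) : topSec i s x = topPart s x := rfl

theorem sl_ext {i : ℕ} {s t : Sec V (SlBundle V i)} (h : vecSec i s = vecSec i t)
    (h' : topSec i s = topSec i t) : s = t :=
  Sec.ext fun x => Subtype.ext (Prod.ext (congrArg (fun r => r x) h) (congrArg (fun r => r x) h'))

/-- The section with given components. -/
def mkSec (i : ℕ) (P : Sec V (ExtDual V ⊗[ℝ] V)) (α : Sec V (ExtDual V))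
    (h : ∀ x, (P x, α x) ∈ slFiber V i) : Sec V (SlBundle V i) :=
  Sec.codRestrict (slFiber V i)
    (Sec.map (LinearMap.inl ℝ _ _) P + Sec.map (LinearMap.inr ℝ _ _) α)
    fun x => by simpa using h x

@[simp] theorem vecSec_mkSec {i : ℕ} {P : Sec V (ExtDual V ⊗[ℝ] V)} {α : Sec V (ExtDual V)}
    (h : ∀ x, (P x, α x) ∈ slFiber V i) : vecSec i (mkSec i P α h) = P :=
  Sec.ext fun x => add_zero (P x)

@[simp] theorem topSec_mkSec {i : ℕ} {P : Sec V (ExtDual V ⊗[ℝ] V)} {α : Sec V (ExtDual V)}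
    (h : ∀ x, (P x, α x) ∈ slFiber V i) : topSec i (mkSec i P α h) = α :=
  Sec.ext fun x => zero_add (α x)

variable [FiniteDimensional ℝ V]

/-- As K_k = 0 for k ≥ n, the three cases of the definition merge into one description valid in
every degree. -/
theorem mem_slFiber {i : ℕ} {p : (ExtDual V ⊗[ℝ] V) × ExtDual V} :
    p ∈ slFiber V i ↔ p.1 ∈ KerTrace V (i + 1) ∧
      p.2 ∈ ⋀[ℝ]^(Module.finrank ℝ V) (Module.Dual ℝ V) ∧
      (i + 1 ≠ Module.finrank ℝ V → p.2 = 0) := by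
  rw [slFiber]
  split_ifs with h h'
  · simp only [Submodule.mem_prod, Submodule.mem_bot]
    refine and_congr_right fun _ => ⟨fun h2 => ⟨by rw [h2]; exact zero_mem _, fun _ => h2⟩,
      fun h2 => h2.2 h.ne⟩
  · simp only [Submodule.mem_prod, Submodule.mem_bot]
    refine ⟨fun hp => ⟨by rw [hp.1]; exact zero_mem _, hp.2, fun h2 => absurd h' h2⟩,
      fun hp => ⟨KerTrace_eq_zero h'.ge hp.1, hp.2.1⟩⟩
  · refine ⟨fun hp => ?_, fun hp => ?_⟩
    · rw [(Submodule.mem_bot ℝ).1 hp]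
      exact ⟨zero_mem _, zero_mem _, fun _ => rfl⟩
    · exact (Submodule.mem_bot ℝ).2 (Prod.ext (KerTrace_eq_zero (by omega) hp.1) (hp.2.2 h'))

theorem vecSec_mem {i : ℕ} (s : Sec V (SlBundle V i)) (x : V) :
    vecSec i s x ∈ KerTrace V (i + 1) := (mem_slFiber.1 (s x).2).1

theorem vecSec_mem_VForms {i : ℕ} (s : Sec V (SlBundle V i)) (x : V) :
    vecSec i s x ∈ VForms V (i + 1) := (mem_KerTrace.1 (vecSec_mem s x)).1

theorem topSec_mem {i : ℕ} (s : Sec V (SlBundle V i)) (x : V) :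
    topSec i s x ∈ ⋀[ℝ]^(Module.finrank ℝ V) (Module.Dual ℝ V) := (mem_slFiber.1 (s x).2).2.1

theorem topSec_eq_zero {i : ℕ} (hi : i + 1 ≠ Module.finrank ℝ V) (s : Sec V (SlBundle V i)) :
    topSec i s = 0 := Sec.ext fun x => (mem_slFiber.1 (s x).2).2.2 hi

theorem vecSec_eq_zero {i : ℕ} (hi : Module.finrank ℝ V ≤ i + 1) (s : Sec V (SlBundle V i)) :
    vecSec i s = 0 := Sec.ext fun x => KerTrace_eq_zero hi (vecSec_mem s x)

theorem sl_eq_zero {i : ℕ} (hi : Module.finrank ℝ V < i + 1) (s : Sec V (SlBundle V i)) : s = 0 :=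
  sl_ext (by rw [vecSec_eq_zero hi.le, map_zero]) (by rw [topSec_eq_zero hi.ne', map_zero])

/-- The pair `(P, α)` as an operator on `Γ(∧ V^*) × ℝ`. -/
def opPair (P : Sec V (ExtDual V ⊗[ℝ] V)) (α : Sec V (ExtDual V)) :
    Module.End ℝ (Sec V (ExtDual V) × ℝ) :=
  LinearMap.inl ℝ _ _ ∘ₗ ((derivOf P).coprod (LinearMap.toSpanSingleton ℝ _ α))

@[simp] theorem opPair_apply (P : Sec V (ExtDual V ⊗[ℝ] V)) (α : Sec V (ExtDual V))
    (z : Sec V (ExtDual V) × ℝ) : opPair P α z = (derivOf P z.1 + z.2 • α, 0) := rfl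

/-- Vectors (ξ, 0) detect D_P, and (0, 1) detects α. -/
theorem opPair_injective {P Q : Sec V (ExtDual V ⊗[ℝ] V)} {α β : Sec V (ExtDual V)}
    (h : opPair P α = opPair Q β) : P = Q ∧ α = β := by
  refine ⟨derivOf_injective (LinearMap.ext fun ξ => ?_), ?_⟩
  · simpa using congrArg (fun D => (D (ξ, 0)).1) h
  · simpa using congrArg (fun D => (D (0, 1)).1) h

/-- The operator on `Γ(∧ V^*) × ℝ` defined by a homogeneous section. -/
def opLin (i : ℕ) : Sec V (SlBundle V i) →ₗ[ℝ] Module.End ℝ (Sec V (ExtDual V) × ℝ) where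
  toFun s := opPair (vecSec i s) (topSec i s)
  map_add' s t := by
    refine LinearMap.ext fun z => Prod.ext ?_ (by simp)
    simp only [opPair_apply, map_add, LinearMap.add_apply, smul_add, Prod.fst_add]
    abel
  map_smul' c s := by
    refine LinearMap.ext fun z => Prod.ext ?_ (by simp)
    have h1 : vecSec i (c • s) = c • vecSec i s :=
      map_smul (vecSec i) (algebraMap ℝ (SmoothFun V) c) s
    have h2 : topSec i (c • s) = c • topSec i s :=
      map_smul (topSec i) (algebraMap ℝ (SmoothFun V) c) s
    simp only [opPair_apply, h1, h2, RingHom.id_apply, LinearMap.smul_apply, Prod.smul_fst,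
      smul_add, map_smul]
    rw [smul_comm]

theorem opLin_apply {i : ℕ} (s : Sec V (SlBundle V i)) :
    opLin i s = opPair (vecSec i s) (topSec i s) := rfl

theorem opLin_injective (i : ℕ) : Function.Injective (opLin (V := V) i) := fun _ _ h =>
  sl_ext (opPair_injective h).1 (opPair_injective h).2

theorem opLin_smul {i : ℕ} (f : SmoothFun V) (s : Sec V (SlBundle V i))
    (z : Sec V (ExtDual V) × ℝ) : opLin i (f • s) z = (f • (opLin i s z).1, 0) := by
  simp only [opLin_apply, opPair_apply, map_smul, derivOf_smul_left, smul_add]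
  rw [smul_comm f z.2]

theorem opLin_apply_smul {i : ℕ} (f : SmoothFun V) (s : Sec V (SlBundle V i))
    (ξ : Sec V (ExtDual V)) : opLin i s (f • ξ, 0) =
      (vecApply (rhoSec (vecSec i s)) f • ξ + f • (opLin i s (ξ, 0)).1, 0) := by
  simp [opLin_apply, derivOf_smul]

/-- For i = 0 the traceless P acts on top forms by a coefficient derivative, which preserves them;
for i > 0 it raises the form degree beyond n and so kills them. -/
theorem slBr_mem {i j : ℕ} (s : Sec V (SlBundle V i)) (t : Sec V (SlBundle V j)) (x : V) :
    (nrSec i j (vecSec i s) (vecSec j t) x, (derivOf (vecSec i s) (topSec j t) -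
      (-1 : ℝ) ^ (i * j) • derivOf (vecSec j t) (topSec i s)) x) ∈ slFiber V (i + j) := by
  have key : ∀ {i j : ℕ} (s : Sec V (SlBundle V i)) (t : Sec V (SlBundle V j)) (x : V),
      derivOf (vecSec i s) (topSec j t) x ∈ ⋀[ℝ]^(Module.finrank ℝ V) (Module.Dual ℝ V) ∧
      (i + j + 1 ≠ Module.finrank ℝ V → derivOf (vecSec i s) (topSec j t) x = 0) := by
    intro i j s t x
    by_cases hi : i = 0
    · subst hi
      rw [derivOf_top (vecSec_mem s) (topSec_mem t)]
      refine ⟨nabla_mem _ _ _ (topSec_mem t) x, fun h => ?_⟩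
      rw [topSec_eq_zero (by omega) t, map_zero, Sec.zero_apply]
    · have : derivOf (vecSec i s) (topSec j t) x = 0 := by
        rw [derivOf_apply, rhoSec_eq_zero hi (vecSec_mem_VForms s), nabla_zero_left, add_zero,
          Sec.bilin_apply]
        have := act_mem (vecSec_mem_VForms s x) (topSec_mem t x)
        rwa [forms_eq_bot (by omega), Submodule.mem_bot] at this
      exact ⟨this ▸ zero_mem _, fun _ => this⟩
  refine mem_slFiber.2 ⟨nrSec_mem_KerTrace (vecSec_mem s) (vecSec_mem t) x, ?_, fun h => ?_⟩
  · exact sub_mem (key s t x).1 (Submodule.smul_mem _ _ (key t s x).1)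
  · rw [Sec.sub_apply, Sec.real_smul_apply, (key s t x).2 h,
      (key t s x).2 (by rwa [add_comm j i]), smul_zero, sub_zero]

/-- The bracket of homogeneous sections. -/
def slBr (i j : ℕ) (s : Sec V (SlBundle V i)) (t : Sec V (SlBundle V j)) :
    Sec V (SlBundle V (i + j)) := mkSec (i + j) _ _ (slBr_mem s t)

theorem vecSec_slBr {i j : ℕ} (s : Sec V (SlBundle V i)) (t : Sec V (SlBundle V j)) :
    vecSec (i + j) (slBr i j s t) = nrSec i j (vecSec i s) (vecSec j t) := vecSec_mkSec _

theorem topSec_slBr {i j : ℕ} (s : Sec V (SlBundle V i)) (t : Sec V (SlBundle V j)) :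
    topSec (i + j) (slBr i j s t) = derivOf (vecSec i s) (topSec j t) -
      (-1 : ℝ) ^ (i * j) • derivOf (vecSec j t) (topSec i s) := topSec_mkSec _

/-- These operators take values with zero ℝ-component, so the composite of (P, α) after (Q, β) is
(ξ, c) ↦ (D_P(D_Q ξ + cβ), 0). This dictates the top component D_P β ∓ D_Q α of the bracket. -/
theorem opLin_slBr {i j : ℕ} (s : Sec V (SlBundle V i)) (t : Sec V (SlBundle V j)) :
    opLin (i + j) (slBr i j s t) =
      opLin i s * opLin j t - (-1 : ℝ) ^ (i * j) • (opLin j t * opLin i s) := by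
  refine LinearMap.ext fun z => Prod.ext ?_ (by simp [opLin_apply])
  simp only [opLin_apply, LinearMap.sub_apply, LinearMap.smul_apply, Module.End.mul_apply,
    opPair_apply, zero_smul, add_zero, Prod.fst_sub, Prod.smul_fst, vecSec_slBr, topSec_slBr,
    derivOf_nrSec (vecSec_mem_VForms s) (vecSec_mem_VForms t), map_add, map_smul]
  module

/-- Contraction with x anticommutes with the trace, so it preserves tracelessness, and ι_x α ⊗ x is
traceless because ι_x ι_x = 0. The sign (-1)^n comes from φ_n⁻¹ ∂_n; see `partialTrace_top`. -/
theorem slD_mem {i : ℕ} (s : Sec V (SlBundle V (i + 1))) (x : V) :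
    ((eulerC (vecSec (i + 1) s) + (-1 : ℝ) ^ Module.finrank ℝ V • eulerTop (topSec (i + 1) s)) x,
      (0 : Sec V (ExtDual V)) x) ∈ slFiber V i := by
  refine mem_slFiber.2 ⟨add_mem ?_ (Submodule.smul_mem _ _ ?_), zero_mem _, fun _ => rfl⟩
  · have h := mem_KerTrace.1 (vecSec_mem s x)
    refine mem_KerTrace.2 ⟨eulerContr_mem x h.1, ?_⟩
    rw [eulerC_apply, trc_eulerContr, h.2, map_zero, neg_zero]
  · by_cases hi : i + 2 = Module.finrank ℝ V
    · have h := topSec_mem s x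
      rw [← hi] at h
      exact mem_KerTrace.2 ⟨tmul_mem_VForms (contr_mem x h) x, by simp⟩
    · rw [topSec_eq_zero hi, map_zero]
      exact zero_mem _

/-- The differential of a homogeneous section. -/
def slD (i : ℕ) : Sec V (SlBundle V (i + 1)) →ₗ[SmoothFun V] Sec V (SlBundle V i) where
  toFun s := mkSec i _ _ (slD_mem s)
  map_add' s t := sl_ext (by simp only [vecSec_mkSec, map_add, smul_add]; abel) (by simp)
  map_smul' f s := sl_ext
    (by
      simp only [vecSec_mkSec, map_smul, RingHom.id_apply, smul_add]
      rw [smul_comm]) (by simp)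

theorem vecSec_slD {i : ℕ} (s : Sec V (SlBundle V (i + 1))) :
    vecSec i (slD i s) = eulerC (vecSec (i + 1) s) +
      (-1 : ℝ) ^ Module.finrank ℝ V • eulerTop (topSec (i + 1) s) := vecSec_mkSec (slD_mem s)

theorem topSec_slD {i : ℕ} (s : Sec V (SlBundle V (i + 1))) : topSec i (slD i s) = 0 :=
  topSec_mkSec (slD_mem s)

theorem rhoSec_slD {i : ℕ} (s : Sec V (SlBundle V (i + 1))) : rhoSec (vecSec i (slD i s)) = 0 := by
  rw [vecSec_slD, map_add, rhoSec_eulerC, map_real_smul, rhoSec_eulerTop, smul_zero, add_zero]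

theorem slD_slD {i : ℕ} (s : Sec V (SlBundle V (i + 2))) : slD i (slD (i + 1) s) = 0 := by
  refine sl_ext ?_ (by rw [topSec_slD, map_zero])
  rw [vecSec_slD, topSec_slD, vecSec_slD, map_add, map_real_smul, eulerC_eulerC, eulerC_eulerTop]
  simp

end SlAlgebroid

end LInfSl

end

/-! ### The differential as a derivation of the bracket, and the Leibniz rule. -/

noncomputable section

namespace LInfSl

theorem graded_defect_zero {R : Type*} [Ring R] [Algebra ℝ R] {x a b : R} (c : R) (m : ℕ)
    (h : x = a * b - (-1 : ℝ) ^ (0 * m) • (b * a)) :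
    x - (0 * c - ((-1 : ℝ) ^ (0 * (m + 1)) * (-1) ^ (m + 1)) • (c * 0))
      + (-1 : ℝ) ^ (0 * (m + 1)) • (b * a - ((-1 : ℝ) ^ ((m + 1) * 0) * (-1) ^ 0) • (a * b))
      = 0 := by
  rw [h]; simp

section SlAlgebroidLaws

variable {V : Type*} [NormedAddCommGroup V] [NormedSpace ℝ V] [FiniteDimensional ℝ V]

/-- The contraction with the Euler vector field as an operator on `Γ(∧ V^*) × ℝ`. -/
def eulerOp : Module.End ℝ (Sec V (ExtDual V) × ℝ) :=
  LinearMap.inl ℝ _ _ ∘ₗ (eulerI (V := V)).restrictScalars ℝ ∘ₗ LinearMap.fst ℝ _ _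

theorem eulerOp_apply (z : Sec V (ExtDual V) × ℝ) : eulerOp z = (eulerI z.1, 0) := rfl

/-- The operator which represents the differential of a homogeneous section. -/
abbrev slOpDiff (i : ℕ) (s : Sec V (SlBundle V i)) : Module.End ℝ (Sec V (ExtDual V) × ℝ) :=
  opDiff (E := SlBundle V) opLin slD i s

theorem slOpDiff_zero (s : Sec V (SlBundle V 0)) : slOpDiff 0 s = 0 := rfl

theorem slOpDiff_succ {i : ℕ} (s : Sec V (SlBundle V (i + 1))) :
    slOpDiff (i + 1) s = opLin i (slD i s) := rfl

/-- In negative degree this is the contraction formula `eulerI_derivOf`; in degree 0 the commutator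
vanishes. For a top form the commutator would be (ξ, c) ↦ (c ι_E α, 0), which is not its
differential, hence the condition on the top part. -/
theorem slOpDiff_of_topSec_eq_zero {i : ℕ} {s : Sec V (SlBundle V i)} (hs : topSec i s = 0) :
    slOpDiff i s = eulerOp * opLin i s - (-1 : ℝ) ^ i • (opLin i s * eulerOp) := by
  refine LinearMap.ext fun z => ?_
  rw [LinearMap.sub_apply, LinearMap.smul_apply, Module.End.mul_apply, Module.End.mul_apply]
  refine Prod.ext ?_ (by cases i <;> simp [slOpDiff_zero, slOpDiff_succ, opLin_apply, eulerOp_apply])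
  rcases i with _ | i
  · simp [slOpDiff_zero, opLin_apply, eulerOp_apply, hs,
      eulerI_derivOf_zero (vecSec_mem_VForms s)]
  · simp [slOpDiff_succ, opLin_apply, eulerOp_apply, hs, eulerI_derivOf (vecSec_mem_VForms s),
      vecSec_slD, topSec_slD]

/-- The failure of the differential to be a derivation of the bracket. -/
abbrev slDefect (i j : ℕ) (s : Sec V (SlBundle V i)) (t : Sec V (SlBundle V j)) :
    Module.End ℝ (Sec V (ExtDual V) × ℝ) :=
  slOpDiff (i + j) (slBr i j s t)
    - (slOpDiff i s * opLin j t - ((-1 : ℝ) ^ (i * j) * (-1) ^ j) • (opLin j t * slOpDiff i s))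
    + (-1 : ℝ) ^ (i * j) • (slOpDiff j t * opLin i s
      - ((-1 : ℝ) ^ (j * i) * (-1) ^ i) • (opLin i s * slOpDiff j t))

theorem slDefect_of_topSec_eq_zero {i j : ℕ} {s : Sec V (SlBundle V i)}
    {t : Sec V (SlBundle V j)} (hs : topSec i s = 0) (ht : topSec j t = 0) :
    slDefect i j s t = 0 := by
  have hst : topSec (i + j) (slBr i j s t) = 0 := by rw [topSec_slBr, hs, ht]; simp
  rw [slDefect, slOpDiff_of_topSec_eq_zero hst, slOpDiff_of_topSec_eq_zero hs,
    slOpDiff_of_topSec_eq_zero ht, opLin_slBr]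
  exact graded_commutator_leibniz _ _ _ i j

/-- In form degree at least n the bracket only has its top component D_{ds} β. When ds lies in K_1
this is the derivative of β along ρ(ds) = 0; otherwise h says that β = 0 or that the target bundle
is zero. -/
theorem slBr_slD_eq_zero {i j : ℕ} (hj : Module.finrank ℝ V ≤ i + j + 1)
    (s : Sec V (SlBundle V (i + 1))) (t : Sec V (SlBundle V j))
    (h : i ≠ 0 → topSec j t = 0 ∨ Module.finrank ℝ V < i + j + 1) : slBr i j (slD i s) t = 0 := by
  by_cases hij : Module.finrank ℝ V < i + j + 1
  · exact sl_eq_zero hij _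
  refine sl_ext (by rw [vecSec_eq_zero hj, map_zero]) ?_
  rw [topSec_slBr, topSec_slD, map_zero, smul_zero, sub_zero, map_zero]
  by_cases hi : i = 0
  · subst hi
    rw [derivOf_top (vecSec_mem _) (topSec_mem t), rhoSec_slD, nabla_zero_left]
  · rw [(h hi).resolve_right hij, map_zero]

theorem slOpDiff_commutator {i j : ℕ} (s : Sec V (SlBundle V (i + 1))) (t : Sec V (SlBundle V j)) :
    slOpDiff (i + 1) s * opLin j t
      - ((-1 : ℝ) ^ ((i + 1) * j) * (-1) ^ j) • (opLin j t * slOpDiff (i + 1) s) =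
      opLin (i + j) (slBr i j (slD i s) t) := by
  have e : (-1 : ℝ) ^ ((i + 1) * j) * (-1) ^ j = (-1) ^ (i * j) := by
    rw [add_mul, one_mul, pow_add, mul_assoc, ← pow_add, ← two_mul, pow_mul]
    simp
  rw [opLin_slBr, slOpDiff_succ, e]

theorem slOpDiff_of_vecSec_eq_zero {q : ℕ} {r : Sec V (SlBundle V q)} (hq : q ≠ 0)
    (hr : vecSec q r = 0) :
    slOpDiff q r = opPair ((-1 : ℝ) ^ Module.finrank ℝ V • eulerTop (topSec q r)) 0 := by
  obtain ⟨q, rfl⟩ := Nat.exists_eq_add_one_of_ne_zero hq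
  rw [slOpDiff_succ, opLin_apply, topSec_slD, vecSec_slD, hr, map_zero, zero_add]

/-- This is d[P, α] = [P, dα], which is `nrSec_eulerTop`. -/
theorem slOpDiff_slBr_top {m : ℕ} (hm : m + 2 = Module.finrank ℝ V)
    (s : Sec V (SlBundle V 0)) (t : Sec V (SlBundle V (m + 1))) :
    slOpDiff (0 + (m + 1)) (slBr 0 (m + 1) s t) = opLin (0 + m) (slBr 0 m s (slD m t)) := by
  have ht : vecSec (m + 1) t = 0 := vecSec_eq_zero (by omega) t
  have hs : topSec 0 s = 0 := topSec_eq_zero (by omega) s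
  have h1 : topSec (0 + (m + 1)) (slBr 0 (m + 1) s t) =
      derivOf (vecSec 0 s) (topSec (m + 1) t) := by
    rw [topSec_slBr, hs, map_zero, smul_zero, sub_zero]
  have h2 : vecSec (0 + m) (slBr 0 m s (slD m t)) =
      (-1 : ℝ) ^ Module.finrank ℝ V • eulerTop (derivOf (vecSec 0 s) (topSec (m + 1) t)) := by
    rw [vecSec_slBr, vecSec_slD, ht, map_zero, zero_add, ← map_real_smul,
      nrSec_eulerTop hm (vecSec_mem_VForms s)
        (fun x => Submodule.smul_mem _ _ (topSec_mem t x)), map_smul, map_real_smul]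
  have h3 : topSec (0 + m) (slBr 0 m s (slD m t)) = 0 := by
    rw [topSec_slBr, topSec_slD, hs, map_zero, map_zero, smul_zero, sub_zero]
  exact ((slOpDiff_of_vecSec_eq_zero (by omega) (vecSec_eq_zero (by omega) _)).trans
    (congrArg (fun α => opPair ((-1 : ℝ) ^ Module.finrank ℝ V • eulerTop α) 0) h1)).trans
    ((opLin_apply _).trans (congrArg₂ opPair h2 h3)).symm

theorem slDefect_top_zero {m : ℕ} (hm : m + 2 = Module.finrank ℝ V)
    (s : Sec V (SlBundle V 0)) (t : Sec V (SlBundle V (m + 1))) :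
    slDefect 0 (m + 1) s t = 0 :=
  graded_defect_zero _ m ((slOpDiff_slBr_top hm s t).trans (opLin_slBr s (slD m t)))

theorem slDefect_top {i j : ℕ} (hn : 2 ≤ Module.finrank ℝ V)
    (hj : j + 1 = Module.finrank ℝ V) (s : Sec V (SlBundle V i)) (t : Sec V (SlBundle V j)) :
    slDefect i j s t = 0 := by
  obtain ⟨m, rfl⟩ : ∃ m, j = m + 1 := ⟨j - 1, by omega⟩
  rcases i with _ | i
  · exact slDefect_top_zero hj s t
  -- With s of negative degree, [s, t] lies below the lowest degree of the complex, so each of [ds,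
  -- t] and [dt, s] must vanish by itself.
  · rw [slDefect, sl_eq_zero (by omega) (slBr (i + 1) (m + 1) s t), slOpDiff_commutator,
      slOpDiff_commutator, slBr_slD_eq_zero (by omega) s t fun _ => Or.inr (by omega),
      slBr_slD_eq_zero (by omega) t s fun hm => ?_]
    · have : slOpDiff (i + 1 + (m + 1)) (0 : Sec V (SlBundle V (i + 1 + (m + 1)))) = 0 := by
        change opLin _ (slD _ 0) = 0
        rw [map_zero, map_zero]
      rw [this, map_zero, map_zero, smul_zero, sub_zero, add_zero]
    -- For m ≠ 0 a section of degree -1 has no top part. The case m = 0, that is n = 2, where s may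
    -- be a top form, is covered in `slBr_slD_eq_zero` by ρ ∘ d = 0.
    · by_cases hi : i = 0
      · exact Or.inl (topSec_eq_zero (by omega) s)
      · exact Or.inr (by omega)

/-- The two brackets live in bundles indexed by i + j and j + i; skew-symmetry is therefore read off
from their operators. It lets a top form be moved to the second argument. -/
theorem slOpDiff_add_comm {i j : ℕ} (s : Sec V (SlBundle V i)) (t : Sec V (SlBundle V j)) :
    slOpDiff (i + j) (slBr i j s t) = (-(-1 : ℝ) ^ (i * j)) • slOpDiff (j + i) (slBr j i t s) := by
  have hc : ∀ (p q : ℕ) (r : Sec V (SlBundle V p)) (r' : Sec V (SlBundle V q)) (c : ℝ), p = q →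
      opLin p r = c • opLin q r' → slOpDiff p r = c • slOpDiff q r' := by
    intro p q r r' c hpq h
    subst hpq
    rw [← map_smul] at h
    rw [opLin_injective _ h]
    rcases p with _ | p
    · simp [slOpDiff_zero]
    · rw [slOpDiff_succ, slOpDiff_succ, map_real_smul, map_smul]
  refine hc _ _ _ _ _ (add_comm i j) ?_
  rw [opLin_slBr, opLin_slBr, mul_comm j i]
  rcases neg_one_pow_eq_or ℝ (i * j) with h | h <;> rw [h] <;> module

theorem slDefect_eq_zero (hn : 2 ≤ Module.finrank ℝ V) (i j : ℕ) (s : Sec V (SlBundle V i))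
    (t : Sec V (SlBundle V j)) : slDefect i j s t = 0 := by
  by_cases hj : j + 1 = Module.finrank ℝ V
  · exact slDefect_top hn hj s t
  by_cases hi : i + 1 = Module.finrank ℝ V
  · have h := slDefect_top hn hi t s
    have h' : slDefect i j s t = -((-1 : ℝ) ^ (i * j) • slDefect j i t s) := by
      rw [slDefect, slDefect, slOpDiff_add_comm, mul_comm j i]
      rcases neg_one_pow_eq_or ℝ (i * j) with h' | h' <;> rw [h'] <;> module
    rw [h', h, smul_zero, neg_zero]
  · exact slDefect_of_topSec_eq_zero (topSec_eq_zero hi s) (topSec_eq_zero hj t)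

theorem commutator_apply {M : Type*} [AddCommGroup M] [Module ℝ M] (a b : Module.End ℝ M) (c : ℝ)
    (z : M) : (a * b - c • (b * a)) z = a (b z) - c • b (a z) := rfl

/-- Multiplying a section by f multiplies its operator by f, while D_P(fξ) has the extra term
ρ(P)(f) ξ; the commutator inherits exactly that term. -/
theorem slBr_leibniz {i j : ℕ} (s : Sec V (SlBundle V i)) (f : SmoothFun V)
    (t : Sec V (SlBundle V j)) : opLin (i + j) (slBr i j s (f • t)) =
      opLin j (vecApply (rhoSec (vecSec i s)) f • t) + opLin (i + j) (f • slBr i j s t) := by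
  refine LinearMap.ext fun z => ?_
  have h1 := commutator_apply (opLin i s) (opLin j (f • t)) ((-1 : ℝ) ^ (i * j)) z
  have h2 := commutator_apply (opLin i s) (opLin j t) ((-1 : ℝ) ^ (i * j)) z
  rw [← opLin_slBr] at h1 h2
  rw [opLin_smul f t z, opLin_smul f t (opLin i s z), opLin_apply_smul f s (opLin j t z).1] at h1
  have h3 := (opLin_smul f (slBr i j s t) z).trans (congrArg (fun w => (f • w.1, (0 : ℝ))) h2)
  refine h1.trans (Eq.trans ?_ (congrArg₂ (· + ·)
    (opLin_smul (vecApply (rhoSec (vecSec i s)) f) t z) h3).symm)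
  refine Prod.ext ?_ (by simp)
  have h : ((opLin j t z).1, (0 : ℝ)) = opLin j t z := rfl
  rw [h]
  simp only [Prod.fst_sub, Prod.fst_add, Prod.smul_fst, smul_sub]
  rw [smul_comm f]
  abel

variable (V) in
/-- The dg-Lie algebroid of the theorem, with its representation. -/
def slRep (hn : 2 ≤ Module.finrank ℝ V) : DGLieRep V (SlBundle V) (Sec V (ExtDual V) × ℝ) where
  op := opLin
  br := slBr
  d := slD
  anchor := rhoSec ∘ₗ vecSec 0
  op_injective := opLin_injective
  op_br _ _ s t := opLin_slBr s t
  d_d _ s := slD_slD s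
  d_br i j s t := slDefect_eq_zero hn i j s t
  leibniz j s f t := slBr_leibniz s f t
  leibniz_neg i j s f t := by
    refine opLin_injective _ ?_
    rw [slBr_leibniz, rhoSec_eq_zero (Nat.succ_ne_zero i) (vecSec_mem_VForms s)]
    have : vecApply (0 : Sec V V) f = 0 := SmoothFun.ext fun x => map_zero (fderiv ℝ f x)
    rw [this, zero_smul, map_zero, zero_add]
  anchor_d s := rhoSec_slD s
  anchor_br s t := by
    have h : rhoSec (vecSec 0 (slBr 0 0 s t)) = _ := (congrArg rhoSec (vecSec_slBr s t)).trans
      (rhoSec_nrSec (vecSec_mem_VForms s) (vecSec_mem_VForms t))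
    exact (congrArg Subtype.val h).trans (funext fun x => (lieBracket_eq_nabla _ _ x).symm)

end SlAlgebroidLaws

end LInfSl

end

/-! ### An algebroid is determined by its anchor and its brackets of homogeneous sections. -/

noncomputable section

namespace LInfSl

section GeneralBrackets

variable {V : Type*} [NormedAddCommGroup V] [NormedSpace ℝ V]
  {E : ℕ → Type*} [∀ i, AddCommGroup (E i)] [∀ i, Module ℝ (E i)]

theorem incl_apply_self (i : ℕ) (s : Sec V (E i)) : incl i s i = s := DirectSum.lof_apply _ _ _

theorem eq_incl_of_mem {i : ℕ} {y : TotalSec V E} (hy : y ∈ homog V E i) : y = incl i (y i) := by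
  obtain ⟨s, rfl⟩ := hy
  exact congrArg (incl i) (incl_apply_self i s).symm

variable [FiniteDimensional ℝ V] [∀ i, FiniteDimensional ℝ (E i)] {M : Type*} [AddCommGroup M] [Module ℝ M]

namespace DGLieRep

variable (D : DGLieRep V E M)

/-- The `L_∞`-algebroid defined by a dg-Lie algebroid with a faithful representation. -/
def toLInfty : LInftyAlgebroid V E := D.toDGLieData.toLInftyAlgebroid

theorem isDGLie_toLInfty : D.toLInfty.IsDGLie := fun _ hk => DGLieData.brackets_eq_zero _ hk

theorem diff_toLInfty (i : ℕ) (s : Sec V (E (i + 1))) : D.toLInfty.diff i s = D.d i s :=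
  (congrArg (fun y : TotalSec V E => y i) (D.diffTotal_succ i s)).trans (incl_apply_self i _)

theorem bracket_toLInfty (i j : ℕ) (s : Sec V (E i)) (t : Sec V (E j)) :
    D.toLInfty.ℓ 2 ![incl i s, incl j t] = incl (i + j) (D.br i j s t) :=
  D.brTotal_incl i j s t

end DGLieRep

namespace LInftyAlgebroid

variable (L : LInftyAlgebroid V E)

theorem diff_zero (i : ℕ) : L.diff i 0 = 0 := by
  have h : L.ℓ 1 ![incl (i + 1) 0] = 0 := MultilinearMap.map_coord_zero _ 0 (map_zero _)
  rw [diff, h]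
  rfl

theorem unary_incl_succ (i : ℕ) (s : Sec V (E (i + 1))) :
    L.ℓ 1 ![incl (i + 1) s] = incl i (L.diff i s) :=
  eq_incl_of_mem (L.degree 1 ![i + 1] _ (fun p => by
    obtain rfl := Subsingleton.elim p 0
    exact incl_mem _ _) i (by simp; omega))

theorem unary_incl_zero (s : Sec V (E 0)) : L.ℓ 1 ![incl 0 s] = 0 :=
  L.degree_pos 1 ![0] _ (fun p => by
    obtain rfl := Subsingleton.elim p 0
    exact incl_mem _ _) (by simp)

theorem binary_incl (i j : ℕ) (s : Sec V (E i)) (t : Sec V (E j)) :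
    L.ℓ 2 ![incl i s, incl j t] = incl (i + j) (L.ℓ 2 ![incl i s, incl j t] (i + j)) :=
  eq_incl_of_mem (L.degree 2 ![i, j] _ (fun p => by
    fin_cases p <;> exact incl_mem _ _) (i + j) (by simp; omega))

theorem binary_skew (i j : ℕ) (s : Sec V (E i)) (t : Sec V (E j)) :
    L.ℓ 2 ![incl j t, incl i s] = -((-1 : ℤ) ^ (i * j) • L.ℓ 2 ![incl i s, incl j t]) := by
  have h := L.skew 2 ![i, j] ![incl i s, incl j t] (fun p => by
    fin_cases p <;> exact incl_mem _ _) 0 1 rfl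
  rw [show ![incl i s, incl j t] ∘ Equiv.swap (0 : Fin 2) 1 = ![incl j t, incl i s] by
    ext p; fin_cases p <;> simp] at h
  exact h

variable {L}

theorem eq_of_anchor_unary_binary {L' : LInftyAlgebroid V E} (hL : L.IsDGLie) (hL' : L'.IsDGLie)
    (ha : L.anchor = L'.anchor) (h₁ : ∀ i s, L.diff i s = L'.diff i s)
    (h₂ : ∀ i j s t, L.ℓ 2 ![incl i s, incl j t] = L'.ℓ 2 ![incl i s, incl j t]) : L = L' := by
  have key : L.ℓ = L'.ℓ := by
    funext k
    match k with
    | 0 => rw [L.ℓ_zero, L'.ℓ_zero]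
    | 1 =>
      refine MultilinearMap.ext fun x => ?_
      obtain ⟨y, rfl⟩ : ∃ y, x = ![y] := ⟨x 0, by funext p; fin_cases p; rfl⟩
      induction y using DirectSum.induction_on with
      | zero => rw [MultilinearMap.map_coord_zero _ 0 rfl, MultilinearMap.map_coord_zero _ 0 rfl]
      | of i s =>
        rw [← DirectSum.lof_eq_of (SmoothFun V)]
        rcases i with _ | i
        · exact (L.unary_incl_zero s).trans (L'.unary_incl_zero s).symm
        · exact (L.unary_incl_succ i s).trans
            ((congrArg (incl i) (h₁ i s)).trans (L'.unary_incl_succ i s).symm)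
      | add y z hy hz =>
        have e : ∀ N : MultilinearMap ℝ (fun _ : Fin 1 => TotalSec V E) (TotalSec V E),
            N ![y + z] = N ![y] + N ![z] := fun N => MultilinearMap.cons_add N ![] y z
        rw [e, e, hy, hz]
    | 2 =>
      have e : ∀ (N : MultilinearMap ℝ (fun _ : Fin 2 => TotalSec V E) (TotalSec V E)) (y y' z),
            N ![y + y', z] = N ![y, z] + N ![y', z] := fun N y y' z =>
          MultilinearMap.cons_add N ![z] y y'
      have e' : ∀ (N : MultilinearMap ℝ (fun _ : Fin 2 => TotalSec V E) (TotalSec V E)) (y z z'),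
            N ![y, z + z'] = N ![y, z] + N ![y, z'] := fun N y z z' => by
          have u : ∀ w, Function.update ![y, z] 1 w = ![y, w] := fun w => by
            funext p; fin_cases p <;> rfl
          have h := N.map_update_add ![y, z] 1 z z'
          rwa [u, u, u] at h
      refine MultilinearMap.ext fun x => ?_
      obtain ⟨y, z, rfl⟩ : ∃ y z, x = ![y, z] := ⟨x 0, x 1, by funext p; fin_cases p <;> rfl⟩
      induction y using DirectSum.induction_on with
      | zero => rw [MultilinearMap.map_coord_zero _ 0 rfl, MultilinearMap.map_coord_zero _ 0 rfl]
      | of i s =>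
        induction z using DirectSum.induction_on with
        | zero => rw [MultilinearMap.map_coord_zero _ 1 rfl, MultilinearMap.map_coord_zero _ 1 rfl]
        | of j t =>
          rw [← DirectSum.lof_eq_of (SmoothFun V), ← DirectSum.lof_eq_of (SmoothFun V)]
          exact h₂ i j s t
        | add z z' hz hz' => rw [e', e', hz, hz']
      | add y y' hy hy' => rw [e, e, hy, hy']
    | k + 3 => rw [hL _ (by omega), hL' _ (by omega)]
  -- Apart from the brackets and the anchor, all fields are propositions.
  cases L
  cases L'
  congr

end LInftyAlgebroid

end GeneralBrackets

/-! ### The prescribed differential and brackets are those of the constructed algebroid. -/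

section SlProperties

variable {V : Type*} [NormedAddCommGroup V] [NormedSpace ℝ V] [FiniteDimensional ℝ V]
  {L : LInftyAlgebroid V (SlBundle V)}

theorem eq_of_trc_eq {P Q : ExtDual V ⊗[ℝ] V} (hP : P ∈ VForms V (Module.finrank ℝ V))
    (hQ : Q ∈ VForms V (Module.finrank ℝ V)) (h : trc P = trc Q) : P = Q := by
  rw [← cotrc_trc (Module.finBasis ℝ V) hP, h, cotrc_trc _ hQ]

theorem topSec_mem_VForms {i : ℕ} (α : Sec V (SlBundle V i)) (x : V) (c : ℝ) :
    c • topSec i α x ⊗ₜ[ℝ] x ∈ VForms V (Module.finrank ℝ V) :=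
  Submodule.smul_mem _ _ (tmul_mem_VForms (topSec_mem α x) x)

theorem neg_one_pow_pred_mul (n : ℕ) (hn : 1 ≤ n) :
    (-1 : ℝ) ^ (n - 1) * (-1 : ℝ) ^ n = -1 := by
  obtain ⟨m, rfl⟩ := Nat.exists_eq_add_of_le' hn
  rw [Nat.add_sub_cancel, pow_succ, mul_comm _ (-1 : ℝ), mul_left_comm, ← mul_pow]
  simp

omit [FiniteDimensional ℝ V] in
-- Together with injectivity of the trace in degree n, this identifies φ_n⁻¹(-ι_x α) as (-1)^n α ⊗
-- x, since (-1)^(n-1) (-1)^n = -1.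
theorem partialTrace_top {i : ℕ} (hn : 1 ≤ Module.finrank ℝ V) (α : Sec V (SlBundle V i)) (x : V) :
    partialTrace (Module.finrank ℝ V)
      ((-1 : ℝ) ^ Module.finrank ℝ V • topSec i α x ⊗ₜ[ℝ] x) = -contr x (topSec i α x) := by
  rw [partialTrace_eq, LinearMap.smul_apply, map_smul, smul_smul, trc_tmul,
    neg_one_pow_pred_mul _ hn, neg_one_smul]

theorem HasSlDifferential.anchor_eq_rhoSec (h : HasSlDifferential L) :
    L.anchor = rhoSec ∘ₗ vecSec 0 :=
  LinearMap.ext fun s => Sec.ext fun x => h.anchor_eq s x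

theorem HasSlDifferential.diff_eq_slD (h : HasSlDifferential L) (i : ℕ)
    (s : Sec V (SlBundle V (i + 1))) : L.diff i s = slD i s := by
  rcases lt_trichotomy (i + 2) (Module.finrank ℝ V) with hi | hi | hi
  · refine sl_ext (Sec.ext fun x => ?_) ?_
    · rw [vecSec_slD, topSec_eq_zero (by omega) s, map_zero, smul_zero, add_zero]
      exact h.diff_eq i hi s x
    · rw [topSec_slD, topSec_eq_zero (by omega)]
  · refine sl_ext (Sec.ext fun x => ?_) ?_
    · obtain ⟨η, hη, h1, h2⟩ := h.diff_top_eq i hi s x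
      have h3 : η = (-1 : ℝ) ^ Module.finrank ℝ V • topSec (i + 1) s x ⊗ₜ[ℝ] x := by
        refine eq_of_trc_eq hη (topSec_mem_VForms s x _) ?_
        have h4 := h1.trans (partialTrace_top (by omega) s x).symm
        rw [partialTrace_eq] at h4
        exact smul_right_injective (ExtDual V) (r := (-1 : ℝ) ^ (Module.finrank ℝ V - 1))
          (pow_ne_zero _ (by norm_num)) h4
      rw [vecSec_slD, vecSec_eq_zero (by omega) s, map_zero, zero_add]
      refine h2.trans ?_
      rw [h3, map_smul, eulerContr_tmul]
      rfl
    · rw [topSec_slD, topSec_eq_zero (by omega)]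
  · rw [sl_eq_zero (by omega) s, L.diff_zero, map_zero]

theorem hasSlDifferential_of_eq (ha : L.anchor = rhoSec ∘ₗ vecSec 0)
    (hd : ∀ i s, L.diff i s = slD i s) : HasSlDifferential L where
  anchor_eq s x := by rw [ha]; rfl
  diff_eq i hi s x := by
    rw [hd, ← vecSec_apply, vecSec_slD, topSec_eq_zero (by omega) s, map_zero, smul_zero, add_zero]
    rfl
  diff_top_eq i hi α x := by
    refine ⟨_, topSec_mem_VForms α x ((-1 : ℝ) ^ Module.finrank ℝ V),
      partialTrace_top (by omega) α x, ?_⟩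
    rw [hd, ← vecSec_apply, vecSec_slD, vecSec_eq_zero (by omega) α, map_zero, zero_add,
      map_smul, eulerContr_tmul]
    rfl

theorem restrictsNRBracket_of_eq
    (h : ∀ i j s t, L.ℓ 2 ![incl (E := SlBundle V) i s, incl (E := SlBundle V) j t] =
      incl (E := SlBundle V) (i + j) (slBr i j s t)) : RestrictsNRBracket L := by
  intro i j hi hj s t x
  have h' : L.ℓ 2 ![incl (E := SlBundle V) i s, incl (E := SlBundle V) j t] (i + j) =
      slBr i j s t :=
    (congrArg (fun y : TotalSec V (SlBundle V) => y (i + j)) (h i j s t)).trans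
      (incl_apply_self _ _)
  rw [h']
  refine ⟨?_, ?_⟩
  · rw [← vecSec_apply, vecSec_slBr]
    exact nrSec_apply (vecSec_mem_VForms s) (vecSec_mem_VForms t) x
  · rw [← topSec_apply, topSec_slBr, topSec_eq_zero (by omega) s, topSec_eq_zero (by omega) t,
      map_zero, map_zero, smul_zero, sub_zero]
    rfl

/-- A traceless P acts on top forms only through the derivative of their coefficients, which are
constant here. -/
theorem slBr_constSec_topElt {m : ℕ} (hm : m + 1 = Module.finrank ℝ V)
    (hn : 2 ≤ Module.finrank ℝ V) (μ : ⋀[ℝ]^(Module.finrank ℝ V) (Module.Dual ℝ V))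
    (X : SlBundle V 0) : slBr 0 m (constSec X) (constSec (topElt hm μ)) = 0 := by
  refine sl_ext ?_ ?_
  · rw [vecSec_eq_zero (by omega), map_zero]
  · rw [topSec_slBr, topSec_eq_zero (i := 0) (by omega), map_zero, smul_zero, sub_zero,
      derivOf_top (vecSec_mem _) (topSec_mem _), map_zero]
    exact nabla_constSec _ (μ : ExtDual V)

theorem volumeBracketZero_of_eq (hn : 2 ≤ Module.finrank ℝ V)
    (μ : ⋀[ℝ]^(Module.finrank ℝ V) (Module.Dual ℝ V))
    (h : ∀ i j s t, L.ℓ 2 ![incl (E := SlBundle V) i s, incl (E := SlBundle V) j t] =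
      incl (E := SlBundle V) (i + j) (slBr i j s t)) : VolumeBracketZero L hn μ := fun X =>
  (h _ _ _ _).trans ((congrArg (incl (E := SlBundle V) _) (slBr_constSec_topElt _ hn μ X)).trans
    (map_zero _))

end SlProperties

end LInfSl

end

/-! ### Uniqueness. -/

noncomputable section

namespace LInfSl

section Uniqueness

variable {V : Type*} [NormedAddCommGroup V] [NormedSpace ℝ V] [FiniteDimensional ℝ V]

section

variable {E : ℕ → Type*} [∀ i, AddCommGroup (E i)] [∀ i, Module ℝ (E i)]

omit [FiniteDimensional ℝ V] in
theorem incl_sum {ι : Type*} (a : Finset ι) (i : ℕ) (s : ι → Sec V (E i)) :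
    incl i (∑ k ∈ a, s k) = ∑ k ∈ a, incl i (s k) := map_sum _ _ _

omit [FiniteDimensional ℝ V] in
theorem incl_smul (i : ℕ) (f : SmoothFun V) (s : Sec V (E i)) : incl i (f • s) = f • incl i s :=
  map_smul _ _ _

variable [∀ i, FiniteDimensional ℝ (E i)] (L : LInftyAlgebroid V E)

theorem LInftyAlgebroid.bracket_add_left (y y' z : TotalSec V E) :
    L.ℓ 2 ![y + y', z] = L.ℓ 2 ![y, z] + L.ℓ 2 ![y', z] := MultilinearMap.cons_add (L.ℓ 2) ![z] y y'

theorem LInftyAlgebroid.bracket_sum_left {ι : Type*} (a : Finset ι) (y : ι → TotalSec V E)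
    (z : TotalSec V E) : L.ℓ 2 ![∑ k ∈ a, y k, z] = ∑ k ∈ a, L.ℓ 2 ![y k, z] :=
  map_sum (AddMonoidHom.mk' (fun y => L.ℓ 2 ![y, z]) fun y y' => L.bracket_add_left y y' z) y a

theorem LInftyAlgebroid.bracket_add_right (y z z' : TotalSec V E) :
    L.ℓ 2 ![y, z + z'] = L.ℓ 2 ![y, z] + L.ℓ 2 ![y, z'] := by
  have u : ∀ w, Function.update ![y, z] 1 w = ![y, w] := fun w => by
    funext p; fin_cases p <;> rfl
  have h := (L.ℓ 2).map_update_add ![y, z] 1 z z'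
  rwa [u, u, u] at h

theorem LInftyAlgebroid.bracket_sum_right {ι : Type*} (a : Finset ι) (y : TotalSec V E)
    (z : ι → TotalSec V E) : L.ℓ 2 ![y, ∑ k ∈ a, z k] = ∑ k ∈ a, L.ℓ 2 ![y, z k] :=
  map_sum (AddMonoidHom.mk' (fun z => L.ℓ 2 ![y, z]) fun z z' => L.bracket_add_right y z z') z a

theorem LInftyAlgebroid.bracket_smul_right_const (c : ℝ) (y z : TotalSec V E) :
    L.ℓ 2 ![y, c • z] = c • L.ℓ 2 ![y, z] := by
  have u : ∀ w, Function.update ![y, z] 1 w = ![y, w] := fun w => by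
    funext p; fin_cases p <;> rfl
  have h := (L.ℓ 2).map_update_smul ![y, z] 1 c z
  rwa [u, u] at h

/-- The other argument has negative degree, so its Leibniz rule has no anchor term; skew-symmetry
transfers this linearity to the first slot. -/
theorem LInftyAlgebroid.bracket_smul_left {m : ℕ} (f : SmoothFun V) (s : Sec V (E 0))
    (t : Sec V (E (m + 1))) :
    L.ℓ 2 ![incl 0 (f • s), incl (m + 1) t] = f • L.ℓ 2 ![incl 0 s, incl (m + 1) t] := by
  have h := L.leibniz_neg m t f (incl 0 s)
  rw [← incl_smul, L.binary_skew 0 (m + 1) (f • s) t, L.binary_skew 0 (m + 1) s t] at h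
  simpa using h

/-- If the constant sections of degree `0` commute with those of degree `-(m+1)`, then the bracket
in these degrees is the derivative along the anchor. -/
theorem LInftyAlgebroid.bracket_eq_nabla {m : ℕ}
    (h : ∀ (X : E 0) (ν : E (m + 1)), L.ℓ 2 ![incl 0 (constSec X), incl (m + 1) (constSec ν)] = 0)
    (s : Sec V (E 0)) (t : Sec V (E (m + 1))) :
    L.ℓ 2 ![incl 0 s, incl (m + 1) t] = incl (m + 1) (nabla (L.anchor s) t) := by
  have h1 : ∀ (X : E 0) (t : Sec V (E (m + 1))), L.ℓ 2 ![incl 0 (constSec X), incl (m + 1) t] =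
      incl (m + 1) (nabla (L.anchor (constSec X)) t) := by
    intro X t
    -- Constant sections generate: on f ν both sides reduce to the anchor term, as the bracket and
    -- the derivative of ν vanish.
    rw [Sec.eq_sum (Module.finBasis ℝ (E (m + 1))) t, map_sum, incl_sum, incl_sum,
      L.bracket_sum_right]
    refine Finset.sum_congr rfl fun k _ => ?_
    rw [nabla_smul, nabla_constSec, smul_zero, add_zero, incl_smul, incl_smul, L.leibniz, h,
      smul_zero, add_zero]
  rw [Sec.eq_sum (Module.finBasis ℝ (E 0)) s, map_sum, incl_sum, L.bracket_sum_left]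
  have h2 : ∀ a : Finset (Fin (Module.finrank ℝ (E 0))), ∀ Y : _ → Sec V V,
      nabla (∑ k ∈ a, Y k) t = ∑ k ∈ a, nabla (Y k) t := fun a Y =>
    map_sum (AddMonoidHom.mk' (fun Y => nabla Y t) fun Y Y' => nabla_add_left Y Y' t) Y a
  rw [h2, incl_sum]
  refine Finset.sum_congr rfl fun k _ => ?_
  rw [L.bracket_smul_left, h1, map_smul, nabla_smul_left, incl_smul]

end

theorem exists_eq_smul_topElt {m : ℕ} (hm : m + 1 = Module.finrank ℝ V)
    {μ : ⋀[ℝ]^(Module.finrank ℝ V) (Module.Dual ℝ V)} (hμ : μ ≠ 0) (ν : SlBundle V m) :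
    ∃ c : ℝ, ν = c • topElt hm μ := by
  have h1 : Module.finrank ℝ (⋀[ℝ]^(Module.finrank ℝ V) (Module.Dual ℝ V)) = 1 := by
    rw [exteriorPower.finrank_eq, Subspace.dual_finrank_eq, Nat.choose_self]
  obtain ⟨c, hc⟩ := (finrank_eq_one_iff_of_nonzero' μ hμ).1 h1 ⟨ν.1.2, (mem_slFiber.1 ν.2).2.1⟩
  refine ⟨c, Subtype.ext (Prod.ext ?_ (congrArg Subtype.val hc).symm)⟩
  exact (KerTrace_eq_zero (by omega) (mem_slFiber.1 ν.2).1).trans (smul_zero c).symm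

variable {L : LInftyAlgebroid V (SlBundle V)}

theorem VolumeBracketZero.bracket_constSec {hn : 2 ≤ Module.finrank ℝ V}
    {μ : ⋀[ℝ]^(Module.finrank ℝ V) (Module.Dual ℝ V)} (hμ : μ ≠ 0)
    (h : VolumeBracketZero L hn μ) {m : ℕ} (hm : m + 1 = Module.finrank ℝ V) (X : SlBundle V 0)
    (ν : SlBundle V m) :
    L.ℓ 2 ![incl (E := SlBundle V) 0 (constSec X), incl (E := SlBundle V) m (constSec ν)] = 0 := by
  -- The top exterior power is a line, so every ν is a multiple of μ.
  obtain rfl : m = Module.finrank ℝ V - 1 := by omega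
  obtain ⟨c, rfl⟩ := exists_eq_smul_topElt hm hμ ν
  have e : incl (E := SlBundle V) (Module.finrank ℝ V - 1) (constSec (V := V) (c • topElt hm μ)) =
      c • incl (E := SlBundle V) (Module.finrank ℝ V - 1) (constSec (topElt hm μ)) :=
    map_smul (DirectSum.lof (SmoothFun V) ℕ (fun i => Sec V (SlBundle V i)) _)
      (algebraMap ℝ (SmoothFun V) c) (constSec (topElt hm μ))
  rw [e, L.bracket_smul_right_const]
  exact (congrArg (c • ·) (h X)).trans (smul_zero c)

theorem bracket_eq_of_restrictsNRBracket (h : RestrictsNRBracket L) {i j : ℕ}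
    (hi : i + 1 < Module.finrank ℝ V) (hj : j + 1 < Module.finrank ℝ V)
    (s : Sec V (SlBundle V i)) (t : Sec V (SlBundle V j)) :
    L.ℓ 2 ![incl (E := SlBundle V) i s, incl (E := SlBundle V) j t] =
      incl (E := SlBundle V) (i + j) (slBr i j s t) := by
  refine (L.binary_incl i j s t).trans (congrArg (incl (E := SlBundle V) (i + j)) ?_)
  refine sl_ext (Sec.ext fun x => ?_) (Sec.ext fun x => ?_)
  · rw [vecSec_slBr, nrSec_apply (vecSec_mem_VForms s) (vecSec_mem_VForms t)]
    exact (h i j hi hj s t x).1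
  · rw [topSec_slBr, topSec_eq_zero (by omega) s, topSec_eq_zero (by omega) t,
      map_zero, map_zero, smul_zero, sub_zero]
    exact (h i j hi hj s t x).2

theorem bracket_eq_of_lt {L L' : LInftyAlgebroid V (SlBundle V)} {i j : ℕ}
    (hij : Module.finrank ℝ V < i + j + 1)
    (s : Sec V (SlBundle V i)) (t : Sec V (SlBundle V j)) :
    L.ℓ 2 ![incl (E := SlBundle V) i s, incl (E := SlBundle V) j t] =
      L'.ℓ 2 ![incl (E := SlBundle V) i s, incl (E := SlBundle V) j t] :=
  (L.binary_incl i j s t).trans <| (congrArg (incl (E := SlBundle V) (i + j))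
    ((sl_eq_zero hij _).trans (sl_eq_zero hij _).symm)).trans (L'.binary_incl i j s t).symm

theorem bracket_top_eq {L L' : LInftyAlgebroid V (SlBundle V)} {hn : 2 ≤ Module.finrank ℝ V}
    {μ : ⋀[ℝ]^(Module.finrank ℝ V) (Module.Dual ℝ V)} (hμ : μ ≠ 0)
    (h : VolumeBracketZero L hn μ) (h' : VolumeBracketZero L' hn μ) (ha : L.anchor = L'.anchor)
    {i j : ℕ} (hj : j + 1 = Module.finrank ℝ V)
    (s : Sec V (SlBundle V i)) (t : Sec V (SlBundle V j)) :
    L.ℓ 2 ![incl (E := SlBundle V) i s, incl (E := SlBundle V) j t] =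
      L'.ℓ 2 ![incl (E := SlBundle V) i s, incl (E := SlBundle V) j t] := by
  rcases i with _ | i
  · obtain ⟨m, rfl⟩ : ∃ m, j = m + 1 := ⟨j - 1, by omega⟩
    refine (L.bracket_eq_nabla (h.bracket_constSec hμ hj) s t).trans
      (Eq.trans ?_ (L'.bracket_eq_nabla (h'.bracket_constSec hμ hj) s t).symm)
    rw [ha]
  · exact bracket_eq_of_lt (by omega) s t

theorem eq_of_slProperties {L L' : LInftyAlgebroid V (SlBundle V)} {hn : 2 ≤ Module.finrank ℝ V}
    {μ : ⋀[ℝ]^(Module.finrank ℝ V) (Module.Dual ℝ V)} (hμ : μ ≠ 0)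
    (hL : L.IsDGLie) (hd : HasSlDifferential L) (hr : RestrictsNRBracket L)
    (hv : VolumeBracketZero L hn μ) (hL' : L'.IsDGLie) (hd' : HasSlDifferential L')
    (hr' : RestrictsNRBracket L') (hv' : VolumeBracketZero L' hn μ) : L = L' := by
  have ha : L.anchor = L'.anchor := hd.anchor_eq_rhoSec.trans hd'.anchor_eq_rhoSec.symm
  refine LInftyAlgebroid.eq_of_anchor_unary_binary hL hL' ha
    (fun i s => (hd.diff_eq_slD i s).trans (hd'.diff_eq_slD i s).symm) fun i j s t => ?_
  -- Four cases: the target is zero; the second or the first argument is a top form; or the bracket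
  -- is prescribed.
  by_cases hij : Module.finrank ℝ V < i + j + 1
  · exact bracket_eq_of_lt hij s t
  rcases eq_or_ne (j + 1) (Module.finrank ℝ V) with hj | hj
  · exact bracket_top_eq hμ hv hv' ha hj s t
  rcases eq_or_ne (i + 1) (Module.finrank ℝ V) with hi | hi
  · exact (L.binary_skew j i t s).trans ((congrArg (fun y => -((-1 : ℤ) ^ (j * i) • y))
      (bracket_top_eq hμ hv hv' ha hi t s)).trans (L'.binary_skew j i t s).symm)
  · exact (bracket_eq_of_restrictsNRBracket hr (by omega) (by omega) s t).trans
      (bracket_eq_of_restrictsNRBracket hr' (by omega) (by omega) s t).symm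

theorem existsUnique_slAlgebroid (hn : 2 ≤ Module.finrank ℝ V)
    {μ : ⋀[ℝ]^(Module.finrank ℝ V) (Module.Dual ℝ V)} (hμ : μ ≠ 0) :
    ∃! L : LInftyAlgebroid V (SlBundle V),
      L.IsDGLie ∧ HasSlDifferential L ∧ RestrictsNRBracket L ∧ VolumeBracketZero L hn μ := by
  have h₁ := (slRep V hn).isDGLie_toLInfty
  have h₂ : HasSlDifferential (slRep V hn).toLInfty :=
    hasSlDifferential_of_eq rfl (slRep V hn).diff_toLInfty
  have h₃ : RestrictsNRBracket (slRep V hn).toLInfty :=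
    restrictsNRBracket_of_eq (slRep V hn).bracket_toLInfty
  have h₄ : VolumeBracketZero (slRep V hn).toLInfty hn μ :=
    volumeBracketZero_of_eq hn μ (slRep V hn).bracket_toLInfty
  exact ⟨(slRep V hn).toLInfty, ⟨h₁, h₂, h₃, h₄⟩, fun L h =>
    eq_of_slProperties hμ h.1 h.2.1 h.2.2.1 h.2.2.2 h₁ h₂ h₃ h₄⟩

end Uniqueness

end LInfSl

end

/-! ### Radial means and the smooth Koszul lemma. -/

noncomputable section

namespace LInfSl

section RadialMeans

open MeasureTheory Set Filter Topology

variable {V : Type*} [NormedAddCommGroup V] [NormedSpace ℝ V]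

/-- The weighted mean of a function along the segments from the origin. -/
def radialMean (m : ℕ) (F : V → ℝ) (x : V) : ℝ := ∫ t in (0 : ℝ)..1, t ^ m * F (t • x)

variable [FiniteDimensional ℝ V]

theorem hasFDerivAt_radialMean (m : ℕ) {F : V → ℝ} (hF : ContDiff ℝ 1 F) (x : V) :
    HasFDerivAt (radialMean m F) (∫ t in (0 : ℝ)..1, t ^ (m + 1) • fderiv ℝ F (t • x)) x := by
  have hc : Continuous (fderiv ℝ F) := hF.continuous_fderiv (by simp)
  have : ProperSpace V := FiniteDimensional.proper ℝ V
  -- The ball of radius ‖x‖ + 1 contains t y for t in [0, 1] and y within distance 1 of x, so C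
  -- dominates the derivatives of the integrand.
  obtain ⟨C, hC⟩ := (isCompact_closedBall (0 : V) (‖x‖ + 1)).exists_bound_of_continuousOn
    hc.continuousOn
  refine intervalIntegral.hasFDerivAt_integral_of_dominated_of_fderiv_le
    (F := fun x t => t ^ m * F (t • x)) (F' := fun x t => t ^ (m + 1) • fderiv ℝ F (t • x))
    (bound := fun _ => C) (Metric.ball_mem_nhds x one_pos) ?_ ?_ ?_ ?_ ?_ ?_
  · refine Eventually.of_forall fun y => Continuous.aestronglyMeasurable ?_
    have := hF.continuous
    fun_prop
  · refine Continuous.intervalIntegrable ?_ _ _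
    have := hF.continuous
    fun_prop
  · exact Continuous.aestronglyMeasurable (by fun_prop)
  · refine Eventually.of_forall fun t ht y hy => ?_
    rw [uIoc_of_le zero_le_one] at ht
    have h1 : ‖y‖ ≤ ‖x‖ + 1 := by
      have := norm_sub_norm_le y x
      rw [Metric.mem_ball, dist_eq_norm] at hy
      linarith
    have h2 : t • y ∈ Metric.closedBall (0 : V) (‖x‖ + 1) := by
      rw [mem_closedBall_zero_iff, norm_smul, Real.norm_of_nonneg ht.1.le]
      exact (mul_le_of_le_one_left (norm_nonneg _) ht.2).trans h1
    rw [norm_smul, norm_pow, Real.norm_of_nonneg ht.1.le]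
    exact (mul_le_of_le_one_left (norm_nonneg _) (pow_le_one₀ ht.1.le ht.2)).trans (hC _ h2)
  · exact intervalIntegrable_const
  · refine Eventually.of_forall fun t _ y _ => ?_
    have h1 : HasFDerivAt F (fderiv ℝ F (t • y)) (t • y) :=
      (hF.differentiable (by simp) _).hasFDerivAt
    have h2 : HasFDerivAt (fun y : V => t • y) (t • ContinuousLinearMap.id ℝ V) y :=
      (hasFDerivAt_id y).const_smul t
    refine ((h1.comp y h2).const_mul (t ^ m)).congr_fderiv ?_
    ext v
    simp [pow_succ, mul_assoc]

theorem fderiv_radialMean_apply (m : ℕ) {F : V → ℝ} (hF : ContDiff ℝ 1 F) (x v : V) :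
    fderiv ℝ (radialMean m F) x v = radialMean (m + 1) (fun y => fderiv ℝ F y v) x := by
  have hc : Continuous (fderiv ℝ F) := hF.continuous_fderiv (by simp)
  rw [(hasFDerivAt_radialMean m hF x).fderiv, ContinuousLinearMap.intervalIntegral_apply]
  · rfl
  · exact Continuous.intervalIntegrable (by fun_prop) _ _

/-- A directional derivative of a radial mean is the radial mean, with weight m + 1, of the
directional derivative; hence the induction on the order of smoothness with m arbitrary. -/
theorem contDiff_radialMean (m : ℕ) {F : V → ℝ} (hF : ContDiff ℝ ∞ F) :
    ContDiff ℝ ∞ (radialMean m F) := by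
  rw [contDiff_infty]
  intro k
  induction k generalizing m F with
  | zero =>
    exact contDiff_zero.2 (continuous_iff_continuousAt.2 fun x =>
      (hasFDerivAt_radialMean m (hF.of_le (by simp)) x).continuousAt)
  | succ k ih =>
    have h1 : ContDiff ℝ 1 F := hF.of_le (by simp)
    push_cast
    refine contDiff_succ_iff_fderiv_apply.2
      ⟨fun x => (hasFDerivAt_radialMean m h1 x).differentiableAt, by simp, fun v => ?_⟩
    simp only [fderiv_radialMean_apply m h1]
    refine ih (m + 1) ?_
    exact ContDiff.clm_apply (hF.fderiv_right (m := ∞) (by simp)) contDiff_const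

/-- Integrate d/dt (t^(m+1) F(tx)) over [0, 1]. The radial mean thus inverts the Euler operator plus
m + 1. -/
theorem fderiv_radialMean_self (m : ℕ) {F : V → ℝ} (hF : ContDiff ℝ 1 F) (x : V) :
    fderiv ℝ (radialMean m F) x x + (m + 1) * radialMean m F x = F x := by
  have hc : Continuous (fderiv ℝ F) := hF.continuous_fderiv (by simp)
  have hc' := hF.continuous
  have h1 : ∀ t : ℝ, HasDerivAt (fun t => t ^ (m + 1) * F (t • x))
      (t ^ (m + 1) * fderiv ℝ F (t • x) x + (m + 1) * (t ^ m * F (t • x))) t := by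
    intro t
    have h2 : HasDerivAt (fun t : ℝ => F (t • x)) (fderiv ℝ F (t • x) x) t := by
      have h3 : HasDerivAt (fun t : ℝ => t • x) x t := by
        simpa using (hasDerivAt_id t).smul_const x
      exact (hF.differentiable (by simp) _).hasFDerivAt.comp_hasDerivAt t h3
    refine ((hasDerivAt_pow (m + 1) t).mul h2).congr_deriv ?_
    push_cast
    ring
  have h2 := intervalIntegral.integral_eq_sub_of_hasDerivAt (a := 0) (b := 1)
    (fun t _ => h1 t) (Continuous.intervalIntegrable (by fun_prop) _ _)
  rw [intervalIntegral.integral_add (Continuous.intervalIntegrable (by fun_prop) _ _)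
    (Continuous.intervalIntegrable (by fun_prop) _ _), intervalIntegral.integral_const_mul] at h2
  rw [fderiv_radialMean_apply m hF]
  simpa [radialMean] using h2

variable {W W' : Type*} [AddCommGroup W] [Module ℝ W] [FiniteDimensional ℝ W]
  [AddCommGroup W'] [Module ℝ W'] [FiniteDimensional ℝ W']

/-- The weighted mean of a smooth function along the segments from the origin. -/
def SmoothFun.radialMean (m : ℕ) (f : SmoothFun V) : SmoothFun V :=
  ⟨LInfSl.radialMean m f, contDiff_radialMean m f.2⟩

/-- The weighted mean of a section along the segments from the origin. -/
def Sec.radialMean (m : ℕ) (s : Sec V W) : Sec V W :=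
  ∑ i, (Sec.coeff ((Module.finBasis ℝ W).coord i) s).radialMean m •
    constSec (Module.finBasis ℝ W i)

theorem Sec.dual_radialMean (φ : Module.Dual ℝ W) (m : ℕ) (s : Sec V W) (x : V) :
    φ (Sec.radialMean m s x) = LInfSl.radialMean m (fun y => φ (s y)) x := by
  let b := Module.finBasis ℝ W
  have h : (fun t : ℝ => t ^ m * φ (s (t • x))) =
      fun t => ∑ i, t ^ m * b.coord i (s (t • x)) * φ (b i) := by
    funext t
    rw [dual_apply_eq_sum b, Finset.mul_sum]
    exact Finset.sum_congr rfl fun i _ => (mul_assoc _ _ _).symm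
  rw [LInfSl.radialMean, h, intervalIntegral.integral_finsetSum, Sec.radialMean, Sec.sum_apply,
    map_sum]
  · refine Finset.sum_congr rfl fun i _ => ?_
    rw [intervalIntegral.integral_mul_const, Sec.smul_apply, map_smul]
    rfl
  · intro i _
    have h := (s.2 (b.coord i)).continuous.comp 
      ((continuous_id (X := ℝ)).smul (continuous_const (y := x)))
    exact (((continuous_pow m).mul h).mul continuous_const).intervalIntegrable _ _

theorem Sec.radialMean_map (g : W →ₗ[ℝ] W') (m : ℕ) (s : Sec V W) :
    Sec.radialMean m (Sec.map g s) = Sec.map g (Sec.radialMean m s) :=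
  Sec.ext fun x => dual_ext fun φ =>
    (Sec.dual_radialMean φ m _ x).trans (Sec.dual_radialMean (φ ∘ₗ g) m s x).symm

theorem Sec.radialMean_mem (p : Submodule ℝ W) (m : ℕ) (s : Sec V W) (h : ∀ x, s x ∈ p) (x : V) :
    Sec.radialMean m s x ∈ p := by
  rw [← Submodule.Quotient.mk_eq_zero, ← Submodule.mkQ_apply, ← Sec.map_apply,
    ← Sec.radialMean_map]
  refine dual_ext fun φ => ?_
  have e : Sec.map p.mkQ s = 0 := Sec.ext fun y => by simp [h y]
  rw [Sec.dual_radialMean, e]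
  simp [LInfSl.radialMean]

theorem Sec.nabla_eulerSec_radialMean (m : ℕ) (s : Sec V W) :
    nabla (eulerSec V) (Sec.radialMean m s) + (m + 1 : ℝ) • Sec.radialMean m s = s := by
  refine Sec.ext fun x => dual_ext fun φ => ?_
  rw [Sec.add_apply, map_add, nabla_apply, dual_secDeriv, Sec.real_smul_apply, map_smul]
  simp only [Sec.dual_radialMean]
  exact fderiv_radialMean_self m ((s.2 φ).of_le (by simp)) x

omit [FiniteDimensional ℝ W'] in
-- The contraction is linear in the vector, so c(tx) s(tx) = 0 gives c(x) s(tx) = 0 for t > 0, and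
-- this integrates to the claim.
theorem Sec.bilin_eulerSec_radialMean (c : V →ₗ[ℝ] W →ₗ[ℝ] W') (m : ℕ) {s : Sec V W}
    (h : Sec.bilin c (eulerSec V) s = 0) :
    Sec.bilin c (eulerSec V) (Sec.radialMean m s) = 0 := by
  refine Sec.ext fun x => dual_ext fun φ => ?_
  change (φ ∘ₗ c x) (Sec.radialMean m s x) = φ 0
  rw [Sec.dual_radialMean, map_zero]
  refine intervalIntegral.integral_zero_ae (Eventually.of_forall fun t ht => ?_)
  rw [uIoc_of_le zero_le_one] at ht
  have h1 : c (t • x) (s (t • x)) = 0 := congrArg (fun r : Sec V W' => r (t • x)) h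
  rw [map_smul, LinearMap.smul_apply, smul_eq_zero_iff_right ht.1.ne'] at h1
  simp [h1]

/-- The Koszul lemma: if contractions `c` and multiplications `a` satisfy the canonical
anticommutation relations, then sections of positive degree which are annihilated by the contraction
with the Euler vector field are such contractions. -/
theorem exists_bilin_eulerSec_eq {ι : Type*} [Fintype ι] (b : Module.Basis ι ℝ V)
    {c : V →ₗ[ℝ] W →ₗ[ℝ] W} {a : Module.Dual ℝ V →ₗ[ℝ] W →ₗ[ℝ] W}
    (hca : ∀ v η w, c v (a η w) + a η (c v w) = η v • w) {p q : Submodule ℝ W} {m : ℕ}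
    (hp : ∀ w ∈ p, ∑ i, a (b.coord i) (c (b i) w) = (m + 1 : ℝ) • w)
    (hq : ∀ η, ∀ w ∈ p, a η w ∈ q) {s : Sec V W} (hs : ∀ x, s x ∈ p)
    (h : Sec.bilin c (eulerSec V) s = 0) :
    ∃ t : Sec V W, (∀ x, t x ∈ q) ∧ Sec.bilin c (eulerSec V) t = s := by
  set r := Sec.radialMean m s with hr
  have hrp : ∀ x, r x ∈ p := Sec.radialMean_mem p m s hs
  have hr0 : Sec.bilin c (eulerSec V) r = 0 := Sec.bilin_eulerSec_radialMean c m h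
  -- The primitive is the exterior derivative ∑ e^i ∧ ∂_i r of the radial mean r, as in the homotopy
  -- proof of the Poincaré lemma.
  refine ⟨∑ i, Sec.map (a (b.coord i)) (nabla (constSec (b i)) r), fun x => ?_, ?_⟩
  · rw [Sec.sum_apply]
    exact sum_mem fun i _ => hq _ _ (nabla_mem p _ r hrp x)
  -- Differentiating c(x) r(x) = 0 in the direction v.
  · have h1 : ∀ (v x : V), c x (nabla (constSec v) r x) = -c v (r x) := by
      intro v x
      have h2 := congrArg (nabla (constSec v)) hr0
      rw [nabla_bilin, nabla_eulerSec, map_zero] at h2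
      exact (neg_eq_of_add_eq_zero_right (congrArg (fun r : Sec V W => r x) h2)).symm
    have h2 : nabla (eulerSec V) r = ∑ i, Sec.coeff (b.coord i) (eulerSec V) •
        nabla (constSec (b i)) r := by
      conv_lhs => rw [Sec.eq_sum b (eulerSec V)]
      rw [← Finset.sum_congr rfl fun i _ => nabla_smul_left _ _ r]
      exact map_sum (AddMonoidHom.mk' (fun Y => nabla Y r) fun Y Y' => nabla_add_left Y Y' r) _ _
    -- Cartan's formula: the contracted primitive is ∇_E r + ∑ e^i ∧ ι_{e_i} r = ∇_E r + (m + 1) r,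
    -- which is s by the choice of r.
    rw [← Sec.nabla_eulerSec_radialMean m s, ← hr, h2]
    refine Sec.ext fun x => ?_
    rw [Sec.bilin_apply, Sec.sum_apply, map_sum, Sec.add_apply, Sec.sum_apply,
      Sec.real_smul_apply, ← hp _ (hrp x), ← Finset.sum_add_distrib]
    refine Finset.sum_congr rfl fun i _ => ?_
    rw [Sec.map_apply, eulerSec_apply, eq_sub_of_add_eq (hca x _ _), h1, map_neg, sub_neg_eq_add]
    rfl

end RadialMeans

end LInfSl

end

/-! ### Exactness of the resolution and minimality at the origin. -/

noncomputable section

namespace LInfSl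

section Exactness

variable {V : Type*} [NormedAddCommGroup V] [NormedSpace ℝ V]

/-- The exterior product of vector-valued forms with a covector. -/
def covecMul : Module.Dual ℝ V →ₗ[ℝ] ExtDual V ⊗[ℝ] V →ₗ[ℝ] ExtDual V ⊗[ℝ] V :=
  LinearMap.rTensorHom V ∘ₗ LinearMap.mul ℝ (ExtDual V) ∘ₗ ExteriorAlgebra.ι ℝ

theorem covecMul_tmul (η : Module.Dual ℝ V) (a : ExtDual V) (v : V) :
    covecMul η (a ⊗ₜ v) = (covec η * a) ⊗ₜ v := rfl

theorem eulerContr_covecMul (v : V) (η : Module.Dual ℝ V) (P : ExtDual V ⊗[ℝ] V) :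
    eulerContr v (covecMul η P) + covecMul η (eulerContr v P) = η v • P := by
  induction P using TensorProduct.induction_on with
  | zero => simp
  | tmul a w =>
    rw [covecMul_tmul, eulerContr_tmul, eulerContr_tmul, covecMul_tmul, contr_covec_mul,
      ← TensorProduct.add_tmul, sub_add_cancel, TensorProduct.smul_tmul']
  | add P Q hP hQ =>
    rw [smul_add, ← hP, ← hQ]
    simp only [map_add]
    abel

theorem sum_covecMul_eulerContr {ι : Type*} [Fintype ι] (b : Module.Basis ι ℝ V) {k : ℕ}
    {P : ExtDual V ⊗[ℝ] V} (hP : P ∈ VForms V k) :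
    ∑ i, covecMul (b.coord i) (eulerContr (b i) P) = (k : ℝ) • P := by
  refine VForms_induction
    (p := fun P => ∑ i, covecMul (b.coord i) (eulerContr (b i) P) = (k : ℝ) • P)
    (by simp) (fun P Q h h' => ?_) (fun a ha v => ?_) hP
  · simp only [map_add, Finset.sum_add_distrib, h, h', smul_add]
  · simp only [eulerContr_tmul, covecMul_tmul]
    rw [← TensorProduct.sum_tmul, sum_covec_mul_contr b ha, TensorProduct.smul_tmul']

theorem covecMul_mem {k : ℕ} (η : Module.Dual ℝ V) {P : ExtDual V ⊗[ℝ] V} (hP : P ∈ VForms V k) :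
    covecMul η P ∈ VForms V (k + 1) :=
  VForms_induction (p := fun P => covecMul η P ∈ VForms V (k + 1))
    (by rw [map_zero]; exact zero_mem _)
    (fun P Q h h' => by rw [map_add]; exact add_mem h h')
    (fun _ ha v => tmul_mem_VForms (covec_mul_mem η ha) v) hP

theorem trc_mem {k : ℕ} {P : ExtDual V ⊗[ℝ] V} (hP : P ∈ VForms V (k + 1)) :
    trc P ∈ ⋀[ℝ]^k (Module.Dual ℝ V) :=
  VForms_induction (p := fun P => trc P ∈ ⋀[ℝ]^k (Module.Dual ℝ V))
    (by rw [map_zero]; exact zero_mem _)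
    (fun P Q h h' => by rw [map_add]; exact add_mem h h')
    (fun _ ha v => contr_mem v ha) hP

variable [FiniteDimensional ℝ V]

theorem exists_eulerI_eq {m : ℕ} {α : Sec V (ExtDual V)}
    (hα : ∀ x, α x ∈ ⋀[ℝ]^(m + 1) (Module.Dual ℝ V)) (h : eulerI α = 0) :
    ∃ β : Sec V (ExtDual V), (∀ x, β x ∈ ⋀[ℝ]^(m + 2) (Module.Dual ℝ V)) ∧ eulerI β = α :=
  exists_bilin_eulerSec_eq (Module.finBasis ℝ V) (c := contr)
    (a := LinearMap.mul ℝ (ExtDual V) ∘ₗ ExteriorAlgebra.ι ℝ)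
    (fun v η a => (congrArg (· + covec η * contr v a) (contr_covec_mul v η a)).trans
      (sub_add_cancel _ _))
    (fun a ha => (sum_covec_mul_contr (Module.finBasis ℝ V) ha).trans (by push_cast; rfl))
    (fun η _ ha => covec_mul_mem η ha) hα h

theorem exists_eulerC_eq {m : ℕ} {P : Sec V (ExtDual V ⊗[ℝ] V)}
    (hP : ∀ x, P x ∈ VForms V (m + 1)) (h : eulerC P = 0) :
    ∃ Q : Sec V (ExtDual V ⊗[ℝ] V), (∀ x, Q x ∈ VForms V (m + 2)) ∧ eulerC Q = P :=
  exists_bilin_eulerSec_eq (Module.finBasis ℝ V) (c := eulerLin) (a := covecMul)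
    eulerContr_covecMul
    (fun _ ha => (sum_covecMul_eulerContr (Module.finBasis ℝ V) ha).trans (by push_cast; rfl))
    (fun η _ ha => covecMul_mem η ha) hP h

theorem map_trc_eulerC (P : Sec V (ExtDual V ⊗[ℝ] V)) :
    Sec.map trc (eulerC P) = -eulerI (Sec.map trc P) :=
  Sec.ext fun x => trc_eulerContr x (P x)

/-- A Koszul primitive η of s need not be traceless, but ι_E(tr η) = -tr(ι_E η) = 0, so tr η = ι_E
β. It remains to remove this trace, or to absorb it in the top form. -/
theorem exists_slD_eq {i : ℕ} (hi : i + 1 < Module.finrank ℝ V) {s : Sec V (SlBundle V i)}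
    (hs : eulerC (vecSec i s) = 0) : ∃ t, slD i t = s := by
  obtain ⟨η, hη, h1⟩ := exists_eulerC_eq (vecSec_mem_VForms s) hs
  have h2 : eulerI (Sec.map trc η) = 0 := by
    rw [← neg_eq_zero, ← map_trc_eulerC, h1]
    exact Sec.ext fun x => (mem_KerTrace.1 (vecSec_mem s x)).2
  obtain ⟨β, hβ, h3⟩ := exists_eulerI_eq (fun x => trc_mem (hη x)) h2
  rcases (Nat.succ_le_of_lt hi).lt_or_eq with hi' | hi'
  -- Here β = tr γ with γ a multiple of `cotrc` β. Adding ι_E γ to η changes the trace by -ι_E β and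
  -- does not change ι_E η.
  · have hc : (Module.finrank ℝ V : ℝ) - ((i + 2 : ℕ) : ℝ) ≠ 0 :=
      (sub_pos.2 (Nat.cast_lt.2 hi')).ne'
    set γ : Sec V (ExtDual V ⊗[ℝ] V) := ((Module.finrank ℝ V : ℝ) - ((i + 2 : ℕ) : ℝ))⁻¹ •
      Sec.map (cotrc (Module.finBasis ℝ V)) β with hγ
    have hγ1 : ∀ x, γ x ∈ VForms V (i + 3) := fun x =>
      Submodule.smul_mem _ _ (cotrc_mem _ (hβ x))
    have hγ2 : Sec.map trc γ = β := Sec.ext fun x => by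
      rw [Sec.map_apply, hγ, Sec.real_smul_apply, map_smul, Sec.map_apply, trc_cotrc _ (hβ x),
        smul_smul, inv_mul_cancel₀ hc, one_smul]
    have hm : ∀ x, ((η + eulerC γ) x, (0 : Sec V (ExtDual V)) x) ∈ slFiber V (i + 1) := by
      refine fun x => mem_slFiber.2 ⟨mem_KerTrace.2 ⟨add_mem (hη x) (eulerContr_mem x (hγ1 x)), ?_⟩,
        zero_mem _, fun _ => rfl⟩
      have h4 : Sec.map trc (η + eulerC γ) = 0 := by
        rw [map_add, map_trc_eulerC, hγ2, h3, add_neg_cancel]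
      exact congrArg (fun r : Sec V (ExtDual V) => r x) h4
    refine ⟨mkSec (i + 1) _ _ hm, sl_ext ?_ ?_⟩
    · rw [vecSec_slD, vecSec_mkSec, topSec_mkSec, map_zero, smul_zero, add_zero, map_add,
        eulerC_eulerC, add_zero, h1]
    · rw [topSec_slD, topSec_eq_zero hi.ne]
  · have hi2 : i + 2 = Module.finrank ℝ V := hi'
    rw [hi2] at hη hβ
    have hm : ∀ x, ((0 : Sec V (ExtDual V ⊗[ℝ] V)) x, ((-1 : ℝ) ^ Module.finrank ℝ V • β) x) ∈
        slFiber V (i + 1) := fun x => mem_slFiber.2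
      ⟨zero_mem _, Submodule.smul_mem _ _ (hβ x), fun h => absurd hi' h⟩
    refine ⟨mkSec (i + 1) _ _ hm, sl_ext ?_ ?_⟩
    · rw [vecSec_slD, vecSec_mkSec, topSec_mkSec, map_zero, zero_add, map_real_smul, smul_smul,
        ← mul_pow, neg_one_mul, neg_neg, one_pow, one_smul, ← h1]
      refine Sec.ext fun x => ?_
      -- Both sides have trace ι_x β, and the trace is injective in degree n; so s = ι_E β ⊗ E is
      -- the differential of (-1)^n β.
      have h4 : η x = β x ⊗ₜ x := eq_of_trc_eq (hη x) (tmul_mem_VForms (hβ x) x)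
        (congrArg (fun r : Sec V (ExtDual V) => r x) h3).symm
      rw [eulerC_apply, h4, eulerContr_tmul]
      rfl
    · rw [topSec_slD, topSec_eq_zero hi.ne]

theorem exists_dual_apply_eq_one {x : V} (hx : x ≠ 0) : ∃ η : Module.Dual ℝ V, η x = 1 := by
  obtain ⟨φ, hφ⟩ : ∃ φ : Module.Dual ℝ V, φ x ≠ 0 := by
    by_contra! h
    exact hx ((Module.forall_dual_apply_eq_zero_iff ℝ x).1 h)
  exact ⟨(φ x)⁻¹ • φ, inv_mul_cancel₀ hφ⟩

/-- At x ≠ 0 the tensor factor x can be cancelled, and contracting η ∧ α = 0 with x, where η(x) = 1,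
recovers α from ι_x α = 0. The origin follows by continuity. -/
theorem eq_zero_of_eulerTop {α : Sec V (ExtDual V)} (hn : 1 ≤ Module.finrank ℝ V)
    (hα : ∀ x, α x ∈ ⋀[ℝ]^(Module.finrank ℝ V) (Module.Dual ℝ V)) (h : eulerTop α = 0) :
    α = 0 := by
  have : Nontrivial V := Module.nontrivial_of_finrank_pos (R := ℝ) hn
  have h1 : ∀ x : V, x ≠ 0 → α x = 0 := by
    intro x hx
    obtain ⟨η, hη⟩ := exists_dual_apply_eq_one hx
    have h2 : contr x (α x) ⊗ₜ[ℝ] x = 0 :=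
      congrArg (fun r : Sec V (ExtDual V ⊗[ℝ] V) => r x) h
    have h3 : contr x (α x) = 0 := by
      have := congrArg (TensorProduct.rid ℝ (ExtDual V) ∘ LinearMap.lTensor (ExtDual V) η) h2
      simpa [hη] using this
    have h4 : covec η * α x = 0 := by
      have := covec_mul_mem η (hα x)
      rwa [forms_eq_bot (Nat.lt_succ_self _), Submodule.mem_bot] at this
    have h5 := contr_covec_mul x η (α x)
    rw [h4, h3, hη, map_zero, mul_zero, sub_zero, one_smul] at h5
    exact h5.symm
  refine Sec.ext fun x => dual_ext fun φ => ?_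
  have h2 : (fun y => φ (α y)) = fun _ => φ 0 := Continuous.ext_on (dense_compl_singleton (0 : V))
    (α.2 φ).continuous continuous_const fun y hy => congrArg φ (h1 y hy)
  exact congrFun h2 x

theorem slD_injective_top {i : ℕ} (hi : i + 2 = Module.finrank ℝ V)
    {s : Sec V (SlBundle V (i + 1))} (h : slD i s = 0) : s = 0 := by
  refine sl_ext (by rw [vecSec_eq_zero (by omega), map_zero]) ?_
  rw [map_zero]
  refine eq_zero_of_eulerTop (by omega) (topSec_mem s) ?_
  have h1 := vecSec_slD s
  rw [h, map_zero, vecSec_eq_zero (by omega) s, map_zero, zero_add] at h1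
  exact (smul_eq_zero_iff_right (pow_ne_zero _ (by norm_num))).1 h1.symm

omit [FiniteDimensional ℝ V] in
theorem Sec.map_mem_of_constSec {W M : Type*} [AddCommGroup W] [Module ℝ W]
    [FiniteDimensional ℝ W] [AddCommGroup M] [Module (SmoothFun V) M]
    (g : Sec V W →ₗ[SmoothFun V] M) (p : Submodule (SmoothFun V) M)
    (h : ∀ w : W, g (constSec w) ∈ p) (s : Sec V W) : g s ∈ p := by
  rw [Sec.eq_sum (Module.finBasis ℝ W) s, map_sum]
  refine sum_mem fun i _ => ?_
  rw [map_smul]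
  exact Submodule.smul_mem _ _ (h _)

/-- Constant sections generate Γ(K_1), and under V^* ⊗ V = End V the form trace is the usual trace,
so K_1 is sl(V). -/
theorem range_rhoSec_vecSec :
    LinearMap.range (rhoSec ∘ₗ vecSec 0) = slFoliation V := by
  refine le_antisymm ?_ (Submodule.span_le.2 ?_)
  · rintro _ ⟨s, rfl⟩
    refine Sec.map_mem_of_constSec _ _ (fun X => Submodule.subset_span ?_) s
    have h1 := mem_KerTrace.1 (mem_slFiber.1 X.2).1
    obtain ⟨A, hA, hA'⟩ := trc_eq_trace h1.1
    rw [h1.2, ← map_zero (algebraMap ℝ (ExtDual V))] at hA'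
    exact ⟨A, (ExteriorAlgebra.algebraMap_inj _ _ _).1 hA'.symm, hA⟩
  · rintro X ⟨A, hA, hX⟩
    obtain ⟨P, hP, hP'⟩ := exists_VForms_of_end A
    obtain ⟨B, hB, hB'⟩ := trc_eq_trace hP
    obtain rfl : B = A := LinearMap.ext fun x => (hB x).symm.trans (hP' x)
    rw [hA, map_zero] at hB'
    refine ⟨mkSec 0 (constSec P) 0 fun x => mem_slFiber.2
      ⟨mem_KerTrace.2 ⟨hP, hB'⟩, zero_mem _, fun _ => rfl⟩, ?_⟩
    rw [LinearMap.comp_apply, vecSec_mkSec]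
    exact Sec.ext fun x => (hP' x).trans (hX x).symm

variable {L : LInftyAlgebroid V (SlBundle V)}

theorem HasSlDifferential.isUniversal (hn : 2 ≤ Module.finrank ℝ V) (h : HasSlDifferential L) :
    L.IsUniversal (slFoliation V) where
  range_anchor := by rw [h.anchor_eq_rhoSec, range_rhoSec_vecSec]
  exact_zero s := by
    simp only [h.diff_eq_slD, h.anchor_eq_rhoSec]
    refine ⟨fun hs => exists_slD_eq hn (Sec.ext fun x => ?_), ?_⟩
    · have h1 : rho x (vecSec 0 s x) = 0 := congrArg (fun r : Sec V V => r x) hs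
      -- On V^* ⊗ V the Koszul contraction is 1 ⊗ ρ, so the kernel of the anchor consists of Koszul
      -- cycles.
      rw [eulerC_apply, eulerContr_eq_one_tmul x (vecSec_mem_VForms s x), h1,
        TensorProduct.tmul_zero]
      rfl
    · rintro ⟨t, rfl⟩
      exact rhoSec_slD t
  exact_succ i s := by
    simp only [h.diff_eq_slD]
    refine ⟨fun hs => ?_, ?_⟩
    · rcases lt_trichotomy (i + 2) (Module.finrank ℝ V) with hi | hi | hi
      · refine exists_slD_eq hi ?_
        have h1 := vecSec_slD s
        rw [hs, map_zero, topSec_eq_zero (by omega) s, map_zero, smul_zero, add_zero] at h1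
        exact h1.symm
      · exact ⟨0, by rw [slD_injective_top hi hs, map_zero]⟩
      · exact ⟨0, by rw [sl_eq_zero (by omega) s, map_zero]⟩
    · rintro ⟨t, rfl⟩
      exact slD_slD t

/-- Both the contraction with E and the factor ⊗ E depend linearly on x, so they vanish at x = 0. -/
theorem HasSlDifferential.isMinimalAt_zero (h : HasSlDifferential L) : L.IsMinimalAt 0 := by
  intro i s
  rw [h.diff_eq_slD]
  have h1 : vecSec i (slD i s) 0 = 0 := by
    rw [vecSec_slD, Sec.add_apply, Sec.real_smul_apply, eulerC_apply, eulerTop_apply,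
      TensorProduct.tmul_zero, smul_zero, add_zero]
    simp [eulerContr]
  have h2 : topSec i (slD i s) 0 = 0 := by rw [topSec_slD]; rfl
  exact Subtype.ext (Prod.ext h1 h2)

end Exactness

end LInfSl

end

theorem mainTheorem3 {V : Type*} [NormedAddCommGroup V] [NormedSpace ℝ V] [FiniteDimensional ℝ V]
    (hn : 2 ≤ Module.finrank ℝ V)
    (μ : ⋀[ℝ]^(Module.finrank ℝ V) (Module.Dual ℝ V)) (hμ : μ ≠ 0) :
    (∃! L : LInftyAlgebroid V (SlBundle V),
      L.IsDGLie ∧ HasSlDifferential L ∧ RestrictsNRBracket L ∧ VolumeBracketZero L hn μ) ∧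
    ∀ L : LInftyAlgebroid V (SlBundle V),
      L.IsDGLie → HasSlDifferential L → RestrictsNRBracket L → VolumeBracketZero L hn μ →
        L.IsUniversal (slFoliation V) ∧ L.IsMinimalAt 0 := by
  exact ⟨existsUnique_slAlgebroid hn hμ, fun L _ hd _ _ =>
    ⟨hd.isUniversal hn, hd.isMinimalAt_zero⟩⟩
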